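/- **Definitions.** For $\Re a>-\tfrac12$ let $U(a,z)=\frac{e^{-z^2/4}}{\Gamma(\frac12+a)}\int_0^\infty t^{a-\frac12}e^{-\frac12t^2-zt}\,dt$ be the parabolic cylinder function; for real $a$ let $W_j(a,z)=U\big((-1)^j ia,(-i)^jze^{-\pi i/4}\big)$. For $R\in\{0,1,2,\dots\}$ put $$W_R^{(0,3)}(a,z)=ie^{\pi a/2}\Big[W_3(a,z)\int_{e^{\pi i/4}\infty}^z t^RW_0(a,t)\,dt-W_0(a,z)\int_{e^{-\pi i/4}\infty}^z t^RW_3(a,t)\,dt\Big].$$ Let $\bar G_{0,R}(z)=-z^R/(z^2+1)$, $\bar G_{s+1,R}(z)=\bar G_{s,R}''(z)/(z^2+1)$, and let $\bar\xi(z)=\int_0^z(t^2+1)^{1/2}dt=\tfrac12z\sqrt{z^2+1}+\tfrac12\ln\big(z+\sqrt{z^2+1}\big)$ in the plane cut along $z=\pm iy$, $1\le y<\infty$ (principal branches; likewise for the other powers of $z^2+1$ below). An *admissible path* is a finite chain of $R_2$ arcs (twice continuously differentiable arcs with nonvanishing derivative) in the cut plane running from $e^{\pi i/4}\infty$ to $e^{-\pi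 i/4}\infty$ along which $\Im\bar\xi$ is monotonic. The *region of validity* $\breve Z^{(0,3)}$ is the set of all points through which an admissible path passes. For an admissible path $\mathcal L$ and $n\ge 0$ put $$\Omega_{\mathcal L}=\int_{\mathcal L}\Big|\frac{2-3t^2}{(t^2+1)^{5/2}}dt\Big|,\quad V_{\mathcal L}=\int_{\mathcal L}\Big|\big\{(t^2+1)^{1/4}\bar G_{n,R}(t)\big\}'dt\Big|,\quad L_{\mathcal L}=\sup_{t\in\mathcal L}\big|(t^2+1)^{1/4}\bar G_{n,R}(t)\big|+\tfrac12V_{\mathcal L}.$$ **Theorem.** Let $R,n\ge0$ be integers with $n>\tfrac14R-\tfrac38$. 1. For every $a>0$, $W_R^{(0,3)}(-a,\cdot)$ is an entire solution of the inhomogeneous Weber equation $y''+(\tfrac14z^2+a)y=z^R$. 2. $\breve Z^{(0,3)}$ consists exactly of the points $z$ of the cut plane with $\Re z>0$ or $|\Im\bar\xi(z)|<\tfrac{\pi}{4}$, that is, it is bounded by the two cuts and by the level curves $\Im\bar\xi=\pm\tfrac{\pi}{4}$ in the left half plane emanating from $z=\pm i$, all excluded. It contains the whole real axis, and through each of its points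 there is an admissible path $\mathcal L$ with $\Omega_{\mathcal L},L_{\mathcal L}<\infty$. 3. For $u>0$ and $z\in\breve Z^{(0,3)}$, $$W_R^{(0,3)}\big(-\tfrac12u,\sqrt{2u}\,z\big)=(2u)^{\frac12R+1}\Big[\frac1{u^2}\sum_{s=0}^{n-1}(-1)^{s+1}\frac{\bar G_{s,R}(z)}{u^{2s}}+\tilde\varepsilon_{n,R}(u,z)\Big],$$ where for every admissible path $\mathcal L$ through $z$ with $L_{\mathcal L}<\infty$ and $\Omega_{\mathcal L}<8u$ $$|\tilde\varepsilon_{n,R}(u,z)|\le\frac1{u^{2n+2}}\Big\{|\bar G_{n,R}(z)|+\frac{V_{\mathcal L}}{2|z^2+1|^{1/4}}\Big\}+\frac{L_{\mathcal L}}{8u^{2n+3}|z^2+1|^{1/4}}\Big\{1-\frac{\Omega_{\mathcal L}}{8u}\Big\}^{-1}\Omega_{\mathcal L}.$$ 4. $\tilde\varepsilon_{n,R}(u,x)=\mathcal O(u^{-2n-2})$ as $u\to\infty$, uniformly for all real $x$, and for each fixed $u>0$, $\tilde\varepsilon_{n,R}(u,x)\to0$ as $x\to+\infty$. -/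

import Mathlib

open Filter Topology MeasureTheory
open scoped ENNReal

noncomputable section

namespace Weber

/-- The parabolic cylinder function `U(a,z)` for `Re a > -1/2`, through its integral
representation.  (Only purely imaginary `a` are needed below.) -/
def pcfU (a z : ℂ) : ℂ :=
  Complex.exp (-z ^ 2 / 4) / Complex.Gamma (1 / 2 + a) *
    ∫ t in Set.Ioi (0 : ℝ),
      (t : ℂ) ^ (a - 1 / 2) * Complex.exp (-(t : ℂ) ^ 2 / 2 - z * t)

/-- The solutions `W_j(a,z) = U((-1)^j i a, (-i)^j z e^{-πi/4})` of Weber's equation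
`y'' = (a - z²/4) y`. -/
def weberW (j : ℕ) (a : ℝ) (z : ℂ) : ℂ :=
  pcfU ((-1) ^ j * Complex.I * a)
    ((-Complex.I) ^ j * z * Complex.exp (-(Real.pi : ℂ) * Complex.I / 4))

/-- The integral `∫_{ω∞}^z f(t) dt` from the point at infinity in the direction `ω` to `z`,
taken along the ray `z + rω`, `r ≥ 0`. -/
def integralFromInfinity (ω : ℂ) (f : ℂ → ℂ) (z : ℂ) : ℂ :=
  -∫ r in Set.Ioi (0 : ℝ), f (z + r * ω) * ω

/-- The particular solution `W_R^{(0,3)}(a,z)` of `y'' - (a - z²/4) y = z^R`. The prefactor is the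
reciprocal of the Wronskian `W_0 W_3' - W_0' W_3 = -i e^{-πa/2}`. -/
def weberParticular03 (R : ℕ) (a : ℝ) (z : ℂ) : ℂ :=
  Complex.I * Complex.exp ((Real.pi : ℂ) * a / 2) *
    (weberW 3 a z *
        integralFromInfinity (Complex.exp ((Real.pi : ℂ) * Complex.I / 4))
          (fun t => t ^ R * weberW 0 a t) z
      - weberW 0 a z *
        integralFromInfinity (Complex.exp (-(Real.pi : ℂ) * Complex.I / 4))
          (fun t => t ^ R * weberW 3 a t) z)

/-- The coefficients: `G_0 = -z^R/(z²+1)` and `G_{s+1} = G_s''/(z²+1)`. -/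
def coeffG (R : ℕ) : ℕ → ℂ → ℂ
  | 0 => fun z => -z ^ R / (z ^ 2 + 1)
  | s + 1 => fun z => deriv (deriv (coeffG R s)) z / (z ^ 2 + 1)

/-- The plane cut along `z = ± i y`, `1 ≤ y < ∞`. -/
def cutPlane : Set ℂ := {z | z.re ≠ 0 ∨ |z.im| < 1}

/-- `ξ(z) = ∫_0^z (t²+1)^{1/2} dt = ½ z √(z²+1) + ½ ln(z + √(z²+1))`. With the principal
branches this is analytic in the cut plane and real on the real axis. -/
def xiBar (z : ℂ) : ℂ :=
  z * (z ^ 2 + 1) ^ (1 / 2 : ℂ) / 2 + Complex.log (z + (z ^ 2 + 1) ^ (1 / 2 : ℂ)) / 2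

/-- The path is a finite chain of `R₂` arcs: it is continuous, and apart from a finite set of
break points it is, up to and including the end points of each piece, twice continuously
differentiable with nonvanishing derivative. -/
def IsR2Chain (γ : ℝ → ℂ) : Prop :=
  Continuous γ ∧ ∃ S : Set ℝ, S.Finite ∧
    ∀ a b : ℝ, a < b → Disjoint (Set.Ioo a b) S →
      ContDiffOn ℝ 2 γ (Set.Icc a b) ∧
        ∀ t ∈ Set.Icc a b, derivWithin γ (Set.Icc a b) t ≠ 0

/-- The paths of integration `L^{(0,3)}`: they run in the cut plane from `e^{πi/4}∞` to
`e^{-πi/4}∞`, are chains of `R₂` arcs, and `Im ξ` is monotonic along them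
(necessarily nonincreasing, as it tends to `+∞` at the initial and to `-∞` at the final end). -/
structure IsPath03 (γ : ℝ → ℂ) : Prop where
  chain : IsR2Chain γ
  mem_cutPlane : ∀ τ, γ τ ∈ cutPlane
  norm_atBot : Tendsto (fun τ => ‖γ τ‖) atBot atTop
  dir_atBot : Tendsto (fun τ => γ τ / (‖γ τ‖ : ℂ)) atBot
    (𝓝 (Complex.exp ((Real.pi : ℂ) * Complex.I / 4)))
  norm_atTop : Tendsto (fun τ => ‖γ τ‖) atTop atTop
  dir_atTop : Tendsto (fun τ => γ τ / (‖γ τ‖ : ℂ)) atTop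
    (𝓝 (Complex.exp (-(Real.pi : ℂ) * Complex.I / 4)))
  monotonic : Antitone (fun τ => (xiBar (γ τ)).im)

/-- The region of validity: all points through which such a path passes. -/
def region03 : Set ℂ := {z | ∃ γ : ℝ → ℂ, IsPath03 γ ∧ z ∈ Set.range γ}

/-- `∫_γ |g(t) dt|`, as an extended nonnegative number. -/
def pathIntegralAbs (γ : ℝ → ℂ) (g : ℂ → ℂ) : ℝ≥0∞ :=
  ∫⁻ τ : ℝ, ‖g (γ τ)‖ₑ * ‖deriv γ τ‖ₑ

/-- `∫_γ |(2 - 3t²) / (t²+1)^{5/2} dt|`. -/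
def pathOmega (γ : ℝ → ℂ) : ℝ≥0∞ :=
  pathIntegralAbs γ (fun t => (2 - 3 * t ^ 2) / (t ^ 2 + 1) ^ (5 / 2 : ℂ))

/-- `(t²+1)^{1/4} G_n(t)`. -/
def weightedG (n R : ℕ) (t : ℂ) : ℂ := (t ^ 2 + 1) ^ (1 / 4 : ℂ) * coeffG R n t

/-- `∫_γ |{(t²+1)^{1/4} G_n(t)}' dt|`. -/
def pathVar (n R : ℕ) (γ : ℝ → ℂ) : ℝ≥0∞ :=
  pathIntegralAbs γ (deriv (weightedG n R))

/-- `sup_γ |(t²+1)^{1/4} G_n(t)| + ½ ∫_γ |{(t²+1)^{1/4} G_n(t)}' dt|`. -/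
def pathL (n R : ℕ) (γ : ℝ → ℂ) : ℝ≥0∞ :=
  (⨆ τ : ℝ, ‖weightedG n R (γ τ)‖ₑ) + pathVar n R γ / 2

/-- The right-hand side of the error bound at `z` for the path `γ`; used only when
`pathL n R γ < ∞` and `pathOmega γ < 8u`. -/
def errorBound (n R : ℕ) (u : ℝ) (γ : ℝ → ℂ) (z : ℂ) : ℝ :=
  1 / u ^ (2 * n + 2) *
      (‖coeffG R n z‖ + 1 / (2 * ‖z ^ 2 + 1‖ ^ (1 / 4 : ℝ)) * (pathVar n R γ).toReal)
    + (pathL n R γ).toReal / (8 * u ^ (2 * n + 3) * ‖z ^ 2 + 1‖ ^ (1 / 4 : ℝ)) *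
      (1 - 1 / (8 * u) * (pathOmega γ).toReal)⁻¹ * (pathOmega γ).toReal

end Weber

end

/-! The function U is a Gaussian factor times the integral `gaussMellin`, and integration by parts
in that integral yields Weber's equation. So W_0 and W_3 solve the homogeneous equation. They are
recessive at e^{πi/4}∞ and e^{-πi/4}∞, and their Wronskian, evaluated at 0 by the duplication and
reflection formulas, is the reciprocal of the prefactor of W_R^{(0,3)}. The latter is therefore the
solution given by variation of parameters.

After rescaling z by √(2u) the equation reads y'' + u²(z²+1)y = z^R. The partial sums telescope
(`expansion_telescopes`), so the remainder e solves e'' + u²(z²+1)e = c(z²+1)G_n with |c| = u^{-2n}.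
With W = (z²+1)^{1/4}e, g = (z²+1)^{1/4}G_n and ξ as variable this becomes W_ξξ + u²W = ψW + cg. For
k = ±iu, the function e^{kξ}(W_ξ - kW - cg/k) has a derivative containing only ψW and g'. Along an
admissible path, e^{iuξ} is no larger than its value at the chosen point on the part before that
point, and e^{-iuξ} is no larger on the part after it. If the contributions from both ends vanish,
subtracting the two integrated identities bounds W by g, V and M·Ω/(8u), where M = sup |W|. Taking
the supremum and absorbing M, which needs Ω < 8u, gives the stated bound (`liouville_estimate`,
`norm_le_errorBound`).

The vanishing at the ends singles out W_R^{(0,3)}. It grows at most polynomially for |Im z| ≤ 2 Re z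
(`weberParticular03_growth`), because the exponential factors of the W_j and of the opposite
integrals cancel; where the direct bounds fail, an energy inequality for a damped system replaces
them. Solving the equation for e and estimating e'' by Cauchy then gains four powers of z at a time,
down to the order R-2-4n of G_n (`sectorBound_bootstrap`). The hypothesis n > R/4-3/8 is exactly
R-3/2-4n < 0: it makes W and g tend to 0 and g' integrable at infinity.

For the region: Re √(z²+1) > 0 in the cut plane, so Im ξ increases upwards, and |Im ξ| ≥ π/4 on the
lines Im z = ±1. Hence the level curves Im ξ = h with |h| < π/4 are graphs over the real axis
(`exists_levelCurve`). From the left half plane such a curve leads to the imaginary axis; from the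
right half plane a vertical segment and a ray finish the path. Conversely a path visiting Re z ≤ 0
meets the imaginary axis between the branch points before and after that visit, and monotonicity
traps Im ξ (`IsPath03.mem_validityRegion`). For real x a path along the real axis to the origin and
back makes all bounds independent of x. -/

namespace Weber

/-! ### The Mellin-type integral and the parabolic cylinder function U -/

/-- The integral `∫_0^∞ t^{s-1} e^{-t²/2 - zt} dt`. -/
noncomputable def gaussMellin (s z : ℂ) : ℂ :=
  ∫ t in Set.Ioi (0 : ℝ), (t : ℂ) ^ (s - 1) * Complex.exp (-(t : ℂ) ^ 2 / 2 - z * t)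

theorem norm_gaussMellin_integrand {t : ℝ} (ht : 0 < t) (s z : ℂ) :
    ‖(t : ℂ) ^ (s - 1) * Complex.exp (-(t : ℂ) ^ 2 / 2 - z * t)‖ =
      t ^ (s.re - 1) * Real.exp (-t ^ 2 / 2 - z.re * t) := by
  rw [norm_mul, Complex.norm_cpow_eq_rpow_re_of_pos ht, Complex.norm_exp]
  congr 2
  have : (-(t : ℂ) ^ 2 / 2 - z * t) = ((-t ^ 2 / 2 : ℝ) : ℂ) - z * (t : ℂ) := by push_cast; ring
  rw [this, Complex.sub_re, Complex.ofReal_re, Complex.re_mul_ofReal]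

theorem continuousOn_gaussMellin_integrand (s z : ℂ) :
    ContinuousOn (fun t : ℝ => (t : ℂ) ^ (s - 1) * Complex.exp (-(t : ℂ) ^ 2 / 2 - z * t))
      (Set.Ioi 0) := by
  apply ContinuousOn.mul
  · intro t ht
    exact ((Complex.continuousAt_ofReal_cpow_const t (s - 1) (Or.inr (ne_of_gt ht)))).continuousWithinAt
  · fun_prop

theorem integrableOn_gaussMellin_majorant {σ : ℝ} (hσ : 0 < σ) (K : ℝ) :
    IntegrableOn (fun t : ℝ => Real.exp (K ^ 2) * (t ^ (σ - 1) * Real.exp (-(1 / 4) * t ^ 2)))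
      (Set.Ioi 0) :=
  (integrableOn_rpow_mul_exp_neg_mul_sq (by norm_num : (0 : ℝ) < 1 / 4)
    (by linarith : -1 < σ - 1)).const_mul _

/-- Since Kt ≤ K² + t²/4, half of the Gaussian exponent absorbs e^{-zt}, which leaves a majorant
independent of z in the disc. -/
theorem norm_gaussMellin_integrand_le {t K : ℝ} (ht : 0 < t) (s z : ℂ) (hz : ‖z‖ ≤ K) :
    ‖(t : ℂ) ^ (s - 1) * Complex.exp (-(t : ℂ) ^ 2 / 2 - z * t)‖ ≤
      Real.exp (K ^ 2) * (t ^ (s.re - 1) * Real.exp (-(1 / 4) * t ^ 2)) := by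
  rw [norm_gaussMellin_integrand ht, mul_left_comm, ← Real.exp_add]
  refine mul_le_mul_of_nonneg_left (Real.exp_le_exp.2 ?_) (Real.rpow_nonneg ht.le _)
  have h1 := (abs_le.1 (Complex.abs_re_le_norm z)).1
  have h2 : -z.re * t ≤ K * t := mul_le_mul_of_nonneg_right (by linarith) ht.le
  nlinarith [sq_nonneg (K - t / 2)]

theorem integrableOn_gaussMellin {s : ℂ} (hs : 0 < s.re) (z : ℂ) :
    IntegrableOn (fun t : ℝ => (t : ℂ) ^ (s - 1) * Complex.exp (-(t : ℂ) ^ 2 / 2 - z * t))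
      (Set.Ioi 0) := by
  refine Integrable.mono' (integrableOn_gaussMellin_majorant hs ‖z‖)
    ((continuousOn_gaussMellin_integrand s z).aestronglyMeasurable measurableSet_Ioi) ?_
  filter_upwards [ae_restrict_mem measurableSet_Ioi] with t ht
  exact norm_gaussMellin_integrand_le ht s z le_rfl

theorem hasDerivAt_gaussMellin {s : ℂ} (hs : 0 < s.re) (z : ℂ) :
    HasDerivAt (gaussMellin s) (-gaussMellin (s + 1) z) z := by
  have hs1 : 0 < (s + 1).re := by simp; linarith
  have h := (hasDerivAt_integral_of_dominated_loc_of_deriv_le (𝕜 := ℂ)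
    (μ := volume.restrict (Set.Ioi (0 : ℝ)))
    (F := fun z t => (t : ℂ) ^ (s - 1) * Complex.exp (-(t : ℂ) ^ 2 / 2 - z * t))
    (F' := fun z t => -((t : ℂ) ^ (s + 1 - 1) * Complex.exp (-(t : ℂ) ^ 2 / 2 - z * t)))
    (bound := fun t : ℝ => Real.exp ((‖z‖ + 1) ^ 2) *
      (t ^ ((s + 1).re - 1) * Real.exp (-(1 / 4) * t ^ 2)))
    (x₀ := z) (Metric.ball_mem_nhds z one_pos)
    (Eventually.of_forall fun w =>
      (continuousOn_gaussMellin_integrand s w).aestronglyMeasurable measurableSet_Ioi)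
    (integrableOn_gaussMellin hs z)
    ((continuousOn_gaussMellin_integrand (s + 1) z).aestronglyMeasurable measurableSet_Ioi).neg
    ?_ (integrableOn_gaussMellin_majorant hs1 _) ?_).2
  · rw [integral_neg] at h
    exact h
  · filter_upwards [ae_restrict_mem measurableSet_Ioi] with t ht w hw
    rw [norm_neg]
    refine norm_gaussMellin_integrand_le ht _ w ?_
    have := norm_le_norm_add_norm_sub' w z
    rw [Metric.mem_ball, dist_eq_norm] at hw
    linarith
  · filter_upwards [ae_restrict_mem measurableSet_Ioi] with t ht w _
    have ht0 : (t : ℂ) ≠ 0 := by exact_mod_cast (ne_of_gt ht)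
    have h1 : HasDerivAt (fun w : ℂ => -(t : ℂ) ^ 2 / 2 - w * t) (-(t : ℂ)) w := by
      simpa using ((hasDerivAt_id w).mul_const (t : ℂ)).const_sub (-(t : ℂ) ^ 2 / 2)
    have h2 := (h1.cexp).const_mul ((t : ℂ) ^ (s - 1))
    refine h2.congr_deriv ?_
    rw [show s + 1 - 1 = (s - 1) + 1 by ring, Complex.cpow_add _ _ ht0, Complex.cpow_one]
    ring

/-- Integrate the derivative of t^s e^{-t²/2-zt} over (0,∞); the boundary term at 0 vanishes because
Re s > 0. As differentiation in z raises s by one, this is the second-order equation behind Weber's.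
-/
theorem gaussMellin_recurrence {s : ℂ} (hs : 0 < s.re) (z : ℂ) :
    s * gaussMellin s z = gaussMellin (s + 2) z + z * gaussMellin (s + 1) z := by
  have hs1 : 0 < (s + 1).re := by simp; linarith
  have hs2 : 0 < (s + 2).re := by simp; linarith
  have hs0 : s ≠ 0 := by rintro rfl; simp at hs
  have I0 := integrableOn_gaussMellin hs z
  have I1 := integrableOn_gaussMellin hs1 z
  have I2 := integrableOn_gaussMellin hs2 z
  have I12 : IntegrableOn (fun t : ℝ => (t : ℂ) ^ (s + 2 - 1) *
      Complex.exp (-(t : ℂ) ^ 2 / 2 - z * t) + z * ((t : ℂ) ^ (s + 1 - 1) *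
      Complex.exp (-(t : ℂ) ^ 2 / 2 - z * t))) (Set.Ioi 0) := I2.add (I1.const_mul z)
  have I' := ((I0.const_mul s).sub I12)
  have hd : ∀ t ∈ Set.Ioi (0 : ℝ), HasDerivAt
      (fun t : ℝ => (t : ℂ) ^ (s + 1 - 1) * Complex.exp (-(t : ℂ) ^ 2 / 2 - z * t))
      (s * ((t : ℂ) ^ (s - 1) * Complex.exp (-(t : ℂ) ^ 2 / 2 - z * t)) -
        ((t : ℂ) ^ (s + 2 - 1) * Complex.exp (-(t : ℂ) ^ 2 / 2 - z * t) +
          z * ((t : ℂ) ^ (s + 1 - 1) * Complex.exp (-(t : ℂ) ^ 2 / 2 - z * t)))) t := by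
    intro t ht
    have ht0 : (t : ℂ) ≠ 0 := by exact_mod_cast (ne_of_gt ht)
    have h1 : HasDerivAt (fun t : ℂ => t ^ s) (s * (t : ℂ) ^ (s - 1)) (t : ℂ) := by
      simpa using (hasDerivAt_id (t : ℂ)).cpow_const (c := s)
        (Or.inl (by simpa using ht))
    have h2 : HasDerivAt (fun t : ℂ => -t ^ 2 / 2 - z * t) (-(t : ℂ) - z) (t : ℂ) := by
      have := (((hasDerivAt_id' (t : ℂ)).fun_pow 2).fun_neg.div_const 2).fun_sub
        ((hasDerivAt_id' (t : ℂ)).const_mul z)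
      refine this.congr_deriv ?_
      simp; ring
    have h3 := (h1.fun_mul h2.cexp).comp_ofReal
    rw [show s + 1 - 1 = s by ring, show s + 2 - 1 = s + 1 by ring, Complex.cpow_add _ _ ht0,
      Complex.cpow_one]
    refine h3.congr_deriv ?_
    ring
  have hlim := tendsto_zero_of_hasDerivAt_of_integrableOn_Ioi hd I' I1
  have hcont : ContinuousWithinAt
      (fun t : ℝ => (t : ℂ) ^ (s + 1 - 1) * Complex.exp (-(t : ℂ) ^ 2 / 2 - z * t))
      (Set.Ici 0) 0 := by
    apply ContinuousAt.continuousWithinAt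
    apply ContinuousAt.mul
    · rw [show s + 1 - 1 = s by ring]
      exact Complex.continuousAt_ofReal_cpow_const 0 s (Or.inl hs)
    · fun_prop
  have key := integral_Ioi_of_hasDerivAt_of_tendsto hcont hd I' hlim
  rw [integral_sub (I0.const_mul s) I12,
    integral_add I2 (I1.const_mul z), integral_const_mul, integral_const_mul] at key
  rw [show s + 1 - 1 = s by ring, Complex.ofReal_zero, Complex.zero_cpow hs0] at key
  simp only [zero_mul, sub_zero] at key
  have := sub_eq_zero.1 key
  simp only [gaussMellin]
  rw [this]
  congr 3
  simp

/-- The modulus of the integrand depends on z only through Re z and decreases in it, so the integral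
of the modulus at z = -K dominates. -/
theorem norm_gaussMellin_le {s : ℂ} (hs : 0 < s.re) (K : ℝ) :
    ∃ C : ℝ, 0 ≤ C ∧ ∀ z : ℂ, -K ≤ z.re → ‖gaussMellin s z‖ ≤ C := by
  refine ⟨∫ t in Set.Ioi (0 : ℝ), ‖(t : ℂ) ^ (s - 1) *
    Complex.exp (-(t : ℂ) ^ 2 / 2 - ((-K : ℝ) : ℂ) * t)‖,
    integral_nonneg fun _ => norm_nonneg _, fun z hz => ?_⟩
  refine norm_integral_le_of_norm_le (integrableOn_gaussMellin hs _).norm ?_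
  filter_upwards [ae_restrict_mem measurableSet_Ioi] with t ht
  rw [norm_gaussMellin_integrand ht, norm_gaussMellin_integrand ht, Complex.ofReal_re]
  refine mul_le_mul_of_nonneg_left (Real.exp_le_exp.2 ?_) (Real.rpow_nonneg (le_of_lt ht) _)
  have := mul_le_mul_of_nonneg_right hz (le_of_lt ht)
  linarith

/-- Substituting x = t² turns the integral at z = 0 into a Gamma integral with rate 1/2. -/
theorem gaussMellin_zero {s : ℂ} (hs : 0 < s.re) :
    gaussMellin s 0 = 2 ^ (s / 2 - 1) * Complex.Gamma (s / 2) := by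
  have hs2 : 0 < (s / 2).re := by simp; linarith
  have h1 := Complex.integral_cpow_mul_exp_neg_mul_Ioi hs2 (by norm_num : (0 : ℝ) < 1 / 2)
  rw [← integral_comp_rpow_Ioi_of_pos (by norm_num : (0 : ℝ) < 2)] at h1
  have h2 : (∫ x in Set.Ioi (0 : ℝ), ((2 : ℝ) * x ^ ((2 : ℝ) - 1)) •
      (((x ^ (2 : ℝ) : ℝ) : ℂ) ^ (s / 2 - 1) *
        Complex.exp (-(((1 / 2 : ℝ) : ℂ) * ((x ^ (2 : ℝ) : ℝ) : ℂ))))) = 2 * gaussMellin s 0 := by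
    rw [gaussMellin, ← integral_const_mul]
    refine setIntegral_congr_fun measurableSet_Ioi fun x hx => ?_
    have hx0 : (x : ℂ) ≠ 0 := by exact_mod_cast (ne_of_gt hx)
    have hx' : 0 < x := hx
    have e1 : ((x ^ (2 : ℝ) : ℝ) : ℂ) ^ (s / 2 - 1) = (x : ℂ) ^ (s - 2) := by
      rw [Complex.ofReal_cpow hx'.le, ← Complex.ofReal_cpow hx'.le, Complex.ofReal_cpow hx'.le,
        ← Complex.cpow_mul]
      · congr 1; push_cast; ring
      · rw [← Complex.ofReal_log hx'.le]
        simp [Real.pi_pos]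
      · rw [← Complex.ofReal_log hx'.le, ← Complex.ofReal_mul, Complex.ofReal_im]
        exact Real.pi_pos.le
    rw [e1, show ((2 : ℝ) - 1) = 1 by norm_num, Real.rpow_one,
      show s - 1 = (s - 2) + 1 by ring, Complex.cpow_add _ _ hx0, Complex.cpow_one,
      Complex.real_smul]
    rw [show (-(((1 / 2 : ℝ) : ℂ) * ((x ^ (2 : ℝ) : ℝ) : ℂ))) = -(x : ℂ) ^ 2 / 2 - 0 * x by
      rw [Real.rpow_two]; push_cast; ring]
    push_cast
    ring
  rw [h2] at h1
  have h3 : (1 / (((1 / 2 : ℝ) : ℝ) : ℂ)) = 2 := by push_cast; norm_num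
  rw [h3] at h1
  rw [Complex.cpow_sub _ _ two_ne_zero, Complex.cpow_one]
  linear_combination h1 / 2

theorem pcfU_eq (a z : ℂ) : pcfU a z =
    Complex.exp (-z ^ 2 / 4) / Complex.Gamma (1 / 2 + a) * gaussMellin (1 / 2 + a) z := by
  rw [pcfU, gaussMellin, show (1 / 2 + a - 1 : ℂ) = a - 1 / 2 by ring]

/-- The derivative of `pcfU a`. -/
noncomputable def pcfUderiv (a z : ℂ) : ℂ :=
  Complex.exp (-z ^ 2 / 4) / Complex.Gamma (1 / 2 + a) *
    (-z / 2 * gaussMellin (1 / 2 + a) z - gaussMellin (1 / 2 + a + 1) z)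

theorem hasDerivAt_exp_neg_sq (z : ℂ) :
    HasDerivAt (fun z : ℂ => Complex.exp (-z ^ 2 / 4)) (Complex.exp (-z ^ 2 / 4) * (-z / 2)) z := by
  have h : HasDerivAt (fun z : ℂ => -z ^ 2 / 4) (-z / 2) z := by
    refine (((hasDerivAt_id' z).fun_pow 2).fun_neg.div_const 4).congr_deriv ?_
    simp; ring
  exact h.cexp

theorem hasDerivAt_pcfU {a : ℂ} (ha : 0 < (1 / 2 + a).re) (z : ℂ) :
    HasDerivAt (pcfU a) (pcfUderiv a z) z := by
  have h := ((hasDerivAt_exp_neg_sq z).div_const (Complex.Gamma (1 / 2 + a))).mul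
    (hasDerivAt_gaussMellin ha z)
  have e : pcfU a = (fun z : ℂ => Complex.exp (-z ^ 2 / 4) / Complex.Gamma (1 / 2 + a)) *
    gaussMellin (1 / 2 + a) := funext fun z => pcfU_eq a z
  rw [e]
  refine h.congr_deriv ?_
  simp only [pcfUderiv]
  ring

theorem hasDerivAt_pcfUderiv {a : ℂ} (ha : 0 < (1 / 2 + a).re) (z : ℂ) :
    HasDerivAt (pcfUderiv a) ((z ^ 2 / 4 + a) * pcfU a z) z := by
  have ha1 : 0 < (1 / 2 + a + 1).re := by
    rw [Complex.add_re, Complex.one_re]; linarith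
  have h := ((hasDerivAt_exp_neg_sq z).div_const (Complex.Gamma (1 / 2 + a))).mul
    (((((hasDerivAt_id z).neg.div_const 2)).mul (hasDerivAt_gaussMellin ha z)).sub
      (hasDerivAt_gaussMellin ha1 z))
  have hr := gaussMellin_recurrence ha z
  rw [show (1 / 2 + a + 2 : ℂ) = 1 / 2 + a + 1 + 1 by ring] at hr
  rw [pcfU_eq]
  refine h.congr_deriv ?_
  simp only [id, Pi.mul_apply, Pi.sub_apply, Pi.neg_apply]
  linear_combination (-Complex.exp (-z ^ 2 / 4) / Complex.Gamma (1 / 2 + a)) * hr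

/-! ### The directions e^{±πi/4} and the solutions W_0, W_3 -/

/-- The unit vector `e^{πi/4}`. -/
noncomputable def dirUp : ℂ := Complex.exp ((Real.pi : ℂ) * Complex.I / 4)

/-- The unit vector `e^{-πi/4}`. -/
noncomputable def dirDown : ℂ := Complex.exp (-(Real.pi : ℂ) * Complex.I / 4)

theorem dirUp_mul_dirDown : dirUp * dirDown = 1 := by
  rw [dirUp, dirDown, ← Complex.exp_add]
  rw [show (Real.pi : ℂ) * Complex.I / 4 + -(Real.pi : ℂ) * Complex.I / 4 = 0 by ring,
    Complex.exp_zero]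

theorem dirUp_sq : dirUp ^ 2 = Complex.I := by
  rw [dirUp, ← Complex.exp_nat_mul, show ((2 : ℕ) : ℂ) * ((Real.pi : ℂ) * Complex.I / 4) =
    Real.pi / 2 * Complex.I by push_cast; ring, Complex.exp_pi_div_two_mul_I]

theorem dirDown_sq : dirDown ^ 2 = -Complex.I := by
  have h := dirUp_mul_dirDown
  have h2 := dirUp_sq
  have : dirUp ^ 2 * dirDown ^ 2 = 1 := by rw [← mul_pow, h, one_pow]
  rw [h2] at this
  linear_combination (-Complex.I) * this + dirDown ^ 2 * Complex.I_sq

theorem conj_dirUp : (starRingEnd ℂ) dirUp = dirDown := by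
  rw [dirUp, dirDown, ← Complex.exp_conj]
  congr 1
  rw [map_div₀, map_mul, Complex.conj_ofReal, Complex.conj_I, map_ofNat]
  ring

theorem dirUp_re : dirUp.re = Real.sqrt 2 / 2 := by
  rw [dirUp, show (Real.pi : ℂ) * Complex.I / 4 = ((Real.pi / 4 : ℝ) : ℂ) * Complex.I by
    push_cast; ring, Complex.exp_ofReal_mul_I_re, Real.cos_pi_div_four]

theorem dirUp_im : dirUp.im = Real.sqrt 2 / 2 := by
  rw [dirUp, show (Real.pi : ℂ) * Complex.I / 4 = ((Real.pi / 4 : ℝ) : ℂ) * Complex.I by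
    push_cast; ring, Complex.exp_ofReal_mul_I_im, Real.sin_pi_div_four]

theorem norm_dirUp : ‖dirUp‖ = 1 := by
  rw [dirUp, show (Real.pi : ℂ) * Complex.I / 4 = ((Real.pi / 4 : ℝ) : ℂ) * Complex.I by
    push_cast; ring, Complex.norm_exp_ofReal_mul_I]

theorem norm_dirDown : ‖dirDown‖ = 1 := by
  rw [← conj_dirUp, RCLike.norm_conj, norm_dirUp]

theorem I_mul_dirDown : Complex.I * dirDown = dirUp := by
  rw [← dirUp_sq]
  linear_combination dirUp * dirUp_mul_dirDown

theorem weberW_zero_eq (a : ℝ) (z : ℂ) :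
    weberW 0 a z = pcfU (Complex.I * a) (z * dirDown) := by
  simp [weberW, dirDown]

theorem weberW_three_eq (a : ℝ) (z : ℂ) :
    weberW 3 a z = pcfU (-(Complex.I * a)) (z * dirUp) := by
  rw [weberW, ← I_mul_dirDown, dirDown]
  have h : (-Complex.I) ^ 3 = Complex.I := by
    linear_combination (-Complex.I) * Complex.I_sq
  rw [h]
  congr 1 <;> ring

theorem re_half_add_I_mul (a : ℝ) : 0 < (1 / 2 + Complex.I * a).re := by simp

theorem re_half_sub_I_mul (a : ℝ) : 0 < (1 / 2 + -(Complex.I * a)).re := by simp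

/-- The derivative of `weberW 0 a`. -/
noncomputable def weberW0deriv (a : ℝ) (z : ℂ) : ℂ :=
  pcfUderiv (Complex.I * a) (z * dirDown) * dirDown

/-- The derivative of `weberW 3 a`. -/
noncomputable def weberW3deriv (a : ℝ) (z : ℂ) : ℂ :=
  pcfUderiv (-(Complex.I * a)) (z * dirUp) * dirUp

theorem hasDerivAt_weberW_zero (a : ℝ) (z : ℂ) :
    HasDerivAt (weberW 0 a) (weberW0deriv a z) z := by
  rw [funext (weberW_zero_eq a)]
  refine ((hasDerivAt_pcfU (re_half_add_I_mul a) _).comp z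
    ((hasDerivAt_id' z).mul_const dirDown)).congr_deriv ?_
  rw [weberW0deriv, one_mul]

theorem hasDerivAt_weberW_three (a : ℝ) (z : ℂ) :
    HasDerivAt (weberW 3 a) (weberW3deriv a z) z := by
  rw [funext (weberW_three_eq a)]
  refine ((hasDerivAt_pcfU (re_half_sub_I_mul a) _).comp z
    ((hasDerivAt_id' z).mul_const dirUp)).congr_deriv ?_
  rw [weberW3deriv, one_mul]

theorem hasDerivAt_weberW0deriv (a : ℝ) (z : ℂ) :
    HasDerivAt (weberW0deriv a) ((a - z ^ 2 / 4) * weberW 0 a z) z := by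
  refine (((hasDerivAt_pcfUderiv (re_half_add_I_mul a) _).comp z
    ((hasDerivAt_id' z).mul_const dirDown)).mul_const dirDown).congr_deriv ?_
  rw [weberW_zero_eq]
  linear_combination (pcfU (Complex.I * a) (z * dirDown)) *
    ((z ^ 2 / 4 * (dirDown ^ 2 - Complex.I) + Complex.I * a) * dirDown_sq
      + (z ^ 2 / 4 - a) * Complex.I_sq)

theorem hasDerivAt_weberW3deriv (a : ℝ) (z : ℂ) :
    HasDerivAt (weberW3deriv a) ((a - z ^ 2 / 4) * weberW 3 a z) z := by
  refine (((hasDerivAt_pcfUderiv (re_half_sub_I_mul a) _).comp z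
    ((hasDerivAt_id' z).mul_const dirUp)).mul_const dirUp).congr_deriv ?_
  rw [weberW_three_eq]
  linear_combination (pcfU (-(Complex.I * a)) (z * dirUp)) *
    ((z ^ 2 / 4 * (dirUp ^ 2 + Complex.I) - Complex.I * a) * dirUp_sq
      + (z ^ 2 / 4 - a) * Complex.I_sq)

/-! ### Values at the origin and the Wronskian -/

/-- Legendre's duplication formula cancels Γ(1/2+a). The remaining Gamma factor stays on the left,
so that the products in the Wronskian can later be paired by reflection. -/
theorem pcfU_zero {a : ℂ} (ha : 0 < (1 / 2 + a).re) :
    pcfU a 0 * Complex.Gamma (3 / 4 + a / 2) =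
      Real.sqrt Real.pi * 2 ^ (-(1 / 4 + a / 2)) := by
  have hG := Complex.Gamma_ne_zero_of_re_pos ha
  have hd := Complex.Gamma_mul_Gamma_add_half (1 / 4 + a / 2)
  rw [show (1 / 4 + a / 2 + 1 / 2 : ℂ) = 3 / 4 + a / 2 by ring,
    show (2 * (1 / 4 + a / 2) : ℂ) = 1 / 2 + a by ring] at hd
  rw [pcfU_eq, gaussMellin_zero ha, show ((1 / 2 + a) / 2 : ℂ) = 1 / 4 + a / 2 by ring]
  have e : (2 : ℂ) ^ (-(1 / 4 + a / 2)) =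
      2 ^ (1 / 4 + a / 2 - 1) * 2 ^ (1 - (1 / 2 + a)) := by
    rw [← Complex.cpow_add _ _ two_ne_zero]; congr 1; ring
  rw [e]
  simp only [ne_eq, OfNat.ofNat_ne_zero, not_false_eq_true, zero_pow, neg_zero, zero_div,
    Complex.exp_zero]
  generalize Complex.Gamma (1 / 2 + a) = G at *
  generalize Complex.Gamma (1 / 4 + a / 2) = G₁ at *
  generalize Complex.Gamma (3 / 4 + a / 2) = G₂ at *
  generalize (2 : ℂ) ^ (1 - (1 / 2 + a)) = p at *
  field_simp
  linear_combination hd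

theorem pcfUderiv_zero {a : ℂ} (ha : 0 < (1 / 2 + a).re) :
    pcfUderiv a 0 * Complex.Gamma (1 / 4 + a / 2) =
      -(Real.sqrt Real.pi * 2 ^ (1 / 4 - a / 2)) := by
  have hG := Complex.Gamma_ne_zero_of_re_pos ha
  have ha1 : 0 < (1 / 2 + a + 1).re := by
    rw [Complex.add_re, Complex.one_re]; linarith
  have hd := Complex.Gamma_mul_Gamma_add_half (1 / 4 + a / 2)
  rw [show (1 / 4 + a / 2 + 1 / 2 : ℂ) = 3 / 4 + a / 2 by ring,
    show (2 * (1 / 4 + a / 2) : ℂ) = 1 / 2 + a by ring] at hd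
  rw [pcfUderiv, gaussMellin_zero ha1, show ((1 / 2 + a + 1) / 2 : ℂ) = 3 / 4 + a / 2 by ring]
  have e : (2 : ℂ) ^ (1 / 4 - a / 2) =
      2 ^ (3 / 4 + a / 2 - 1) * 2 ^ (1 - (1 / 2 + a)) := by
    rw [← Complex.cpow_add _ _ two_ne_zero]; congr 1; ring
  rw [e]
  simp only [ne_eq, OfNat.ofNat_ne_zero, not_false_eq_true, zero_pow, neg_zero, zero_div,
    Complex.exp_zero, zero_mul, zero_sub]
  generalize Complex.Gamma (1 / 2 + a) = G at *
  generalize Complex.Gamma (1 / 4 + a / 2) = G₁ at *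
  generalize Complex.Gamma (3 / 4 + a / 2) = G₂ at *
  generalize (2 : ℂ) ^ (1 - (1 / 2 + a)) = p at *
  field_simp
  linear_combination -hd

/-- In each of the two products the Gamma factors have arguments summing to 1, so reflection turns
them into a sine; the powers of 2 cancel. What remains is an identity between exponentials. -/
theorem weberW_wronskian_at_zero (a : ℝ) :
    weberW 0 a 0 * weberW3deriv a 0 - weberW0deriv a 0 * weberW 3 a 0 =
      -Complex.I * Complex.exp (-((Real.pi : ℂ) * a / 2)) := by
  set b : ℂ := Complex.I * a with hb
  set s : ℂ := 1 / 4 + b / 2 with hs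
  have h1 := pcfU_zero (re_half_add_I_mul a)
  have h2 := pcfUderiv_zero (re_half_add_I_mul a)
  have h3 := pcfU_zero (re_half_sub_I_mul a)
  have h4 := pcfUderiv_zero (re_half_sub_I_mul a)
  rw [← hb] at h1 h2 h3 h4
  have g1 := Complex.Gamma_mul_Gamma_one_sub s
  have g2 := Complex.Gamma_mul_Gamma_one_sub (3 / 4 + b / 2)
  rw [show (1 - (3 / 4 + b / 2) : ℂ) = 1 / 4 + -b / 2 by ring] at g2
  rw [show (1 - s : ℂ) = 3 / 4 + -b / 2 by rw [hs]; ring] at g1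
  have n1 : Complex.Gamma s ≠ 0 := Complex.Gamma_ne_zero_of_re_pos (by simp [hs, hb])
  have n2 : Complex.Gamma (3 / 4 + -b / 2) ≠ 0 :=
    Complex.Gamma_ne_zero_of_re_pos (by simp [hb])
  have n3 : Complex.Gamma (3 / 4 + b / 2) ≠ 0 :=
    Complex.Gamma_ne_zero_of_re_pos (by simp [hb])
  have n4 : Complex.Gamma (1 / 4 + -b / 2) ≠ 0 :=
    Complex.Gamma_ne_zero_of_re_pos (by simp [hb])
  have hpi : (Real.pi : ℂ) ≠ 0 := by exact_mod_cast Real.pi_ne_zero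
  have sqpi : (Real.sqrt Real.pi : ℂ) ^ 2 = Real.pi := by
    exact_mod_cast Real.sq_sqrt Real.pi_pos.le
  have p1 : (2 : ℂ) ^ (-(1 / 4 + b / 2)) * 2 ^ (1 / 4 - -b / 2) = 1 := by
    rw [← Complex.cpow_add _ _ two_ne_zero, show (-(1 / 4 + b / 2) + (1 / 4 - -b / 2) : ℂ) = 0 by
      ring, Complex.cpow_zero]
  have p2 : (2 : ℂ) ^ (1 / 4 - b / 2) * 2 ^ (-(1 / 4 + -b / 2)) = 1 := by
    rw [← Complex.cpow_add _ _ two_ne_zero, show (1 / 4 - b / 2 + -(1 / 4 + -b / 2) : ℂ) = 0 by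
      ring, Complex.cpow_zero]
  have sn1 : Complex.sin (Real.pi * s) ≠ 0 := by
    intro h; rw [h, div_zero] at g1; exact mul_ne_zero n1 n2 g1
  have sn2 : Complex.sin (Real.pi * (3 / 4 + b / 2)) ≠ 0 := by
    intro h; rw [h, div_zero] at g2; exact mul_ne_zero n3 n4 g2
  have q1 : pcfU b 0 * pcfUderiv (-b) 0 = -Complex.sin (Real.pi * (3 / 4 + b / 2)) := by
    have : pcfU b 0 * pcfUderiv (-b) 0 * (Complex.Gamma (3 / 4 + b / 2) *
        Complex.Gamma (1 / 4 + -b / 2)) = -Real.pi := by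
      linear_combination (pcfUderiv (-b) 0 * Complex.Gamma (1 / 4 + -b / 2)) * h1 +
        (Real.sqrt Real.pi * 2 ^ (-(1 / 4 + b / 2))) * h4 -
          (Real.sqrt Real.pi : ℂ) ^ 2 * p1 - sqpi
    rw [g2] at this
    generalize Complex.sin (Real.pi * (3 / 4 + b / 2)) = S at *
    field_simp at this
    linear_combination this
  have q2 : pcfUderiv b 0 * pcfU (-b) 0 = -Complex.sin (Real.pi * s) := by
    have : pcfUderiv b 0 * pcfU (-b) 0 * (Complex.Gamma s *
        Complex.Gamma (3 / 4 + -b / 2)) = -Real.pi := by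
      linear_combination (pcfU (-b) 0 * Complex.Gamma (3 / 4 + -b / 2)) * h2 -
        (Real.sqrt Real.pi * 2 ^ (1 / 4 - b / 2)) * h3 -
          (Real.sqrt Real.pi : ℂ) ^ 2 * p2 - sqpi
    rw [g1] at this
    field_simp at this
    linear_combination this
  rw [weberW_zero_eq, weberW_three_eq, weberW0deriv, weberW3deriv, ← hb]
  simp only [zero_mul]
  -- The two reflection arguments 3/4+b/2 and s = 1/4+b/2 differ by 1/2, so one sine becomes the
  -- cosine of πs.
  have e1 : Complex.sin (Real.pi * (3 / 4 + b / 2)) = Complex.cos (Real.pi * s) := by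
    rw [show (Real.pi * (3 / 4 + b / 2) : ℂ) = Real.pi * s + Real.pi / 2 by rw [hs]; ring,
      Complex.sin_add_pi_div_two]
  have e2 : Complex.exp (Real.pi * s * Complex.I) =
      dirUp * Complex.exp (-((Real.pi : ℂ) * a / 2)) := by
    rw [dirUp, ← Complex.exp_add]; congr 1; rw [hs, hb]
    linear_combination (Real.pi * a / 2 : ℂ) * Complex.I_sq
  have e3 : Complex.exp (-(Real.pi * s) * Complex.I) =
      dirDown * Complex.exp ((Real.pi : ℂ) * a / 2) := by
    rw [dirDown, ← Complex.exp_add]; congr 1; rw [hs, hb]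
    linear_combination (-Real.pi * a / 2 : ℂ) * Complex.I_sq
  have r1 : pcfU b 0 * (pcfUderiv (-b) 0 * dirUp) - pcfUderiv b 0 * dirDown * pcfU (-b) 0 =
      -dirUp * Complex.cos (Real.pi * s) + dirDown * Complex.sin (Real.pi * s) := by
    rw [← e1]
    linear_combination dirUp * q1 - dirDown * q2
  rw [r1, Complex.cos, Complex.sin, e2, e3]
  have u1 := dirUp_mul_dirDown
  have u2 := dirUp_sq
  have u3 := dirDown_sq
  set E := Complex.exp (-((Real.pi : ℂ) * a / 2))
  set F := Complex.exp ((Real.pi : ℂ) * a / 2)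
  linear_combination (-F / 2 - E * Complex.I / 2) * u1 - (E / 2) * u2 + (F * Complex.I / 2) * u3
    - (F / 2) * Complex.I_sq

/-- Weber's equation has no first-order term, so the Wronskian is constant. -/
theorem weberW_wronskian (a : ℝ) (z : ℂ) :
    weberW 0 a z * weberW3deriv a z - weberW0deriv a z * weberW 3 a z =
      -Complex.I * Complex.exp (-((Real.pi : ℂ) * a / 2)) := by
  rw [← weberW_wronskian_at_zero]
  have hd : ∀ z, HasDerivAt (fun z => weberW 0 a z * weberW3deriv a z -
      weberW0deriv a z * weberW 3 a z) 0 z := fun z => by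
    refine (((hasDerivAt_weberW_zero a z).fun_mul (hasDerivAt_weberW3deriv a z)).fun_sub
      ((hasDerivAt_weberW0deriv a z).fun_mul (hasDerivAt_weberW_three a z))).congr_deriv ?_
    ring
  exact is_const_of_deriv_eq_zero (fun z => (hd z).differentiableAt) (fun z => (hd z).deriv) z 0

/-! ### Decay along rays and integrals from infinity -/

/-- Gaussian decay of an entire function along the rays in the direction `ω`, locally uniformly. -/
def DecaysAlong (ω : ℂ) (f : ℂ → ℂ) : Prop :=
  ∀ K : ℝ, ∃ b : ℝ → ℝ, IntegrableOn b (Set.Ioi 0) ∧ Tendsto b atTop (𝓝 0) ∧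
    ∀ z : ℂ, ‖z‖ ≤ K → ∀ r : ℝ, 0 < r → ‖f (z + r * ω)‖ ≤ b r

theorem DecaysAlong.integrableOn {ω : ℂ} {f : ℂ → ℂ} (hf : Differentiable ℂ f)
    (h : DecaysAlong ω f) (z : ℂ) :
    IntegrableOn (fun r : ℝ => f (z + r * ω)) (Set.Ioi 0) := by
  obtain ⟨b, hb, -, hb2⟩ := h ‖z‖
  refine Integrable.mono' hb ?_ ?_
  · have := hf.continuous
    exact (Continuous.aestronglyMeasurable (by fun_prop))
  · filter_upwards [ae_restrict_mem measurableSet_Ioi] with r hr using hb2 z le_rfl r hr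

/-- Differentiating under the integral leaves the r-derivative of f(z+rω), which integrates to -f(z)
because f vanishes along the ray. -/
theorem hasDerivAt_integralFromInfinity {ω : ℂ} {f : ℂ → ℂ}
    (hf : Differentiable ℂ f) (h : DecaysAlong ω f) (z : ℂ) :
    HasDerivAt (integralFromInfinity ω f) (f z) z := by
  -- One unit of the margin is for moving the base point, the other for Cauchy's estimate on unit
  -- circles, which bounds f' by the same majorant b.
  obtain ⟨b, hb, hb0, hb2⟩ := h (‖z‖ + 2)
  have hfc := hf.continuous
  have hdf : Differentiable ℂ (deriv f) := by
    rw [← differentiableOn_univ]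
    exact (hf.differentiableOn).deriv isOpen_univ
  have hdc := hdf.continuous
  have hd : ∀ w : ℂ, ‖w‖ ≤ ‖z‖ + 1 → ∀ r : ℝ, 0 < r → ‖deriv f (w + r * ω)‖ ≤ b r := by
    intro w hw r hr
    have := Complex.norm_deriv_le_of_forall_mem_sphere_norm_le (f := f) (c := w + r * ω) (C := b r)
      one_pos hf.diffContOnCl ?_
    · simpa using this
    · intro v hv
      have e : v = (v - r * ω) + r * ω := by ring
      rw [e]
      refine hb2 _ ?_ r hr
      rw [mem_sphere_iff_norm] at hv
      calc ‖v - r * ω‖ = ‖w + (v - (w + r * ω))‖ := by congr 1; ring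
        _ ≤ ‖w‖ + 1 := by rw [← hv]; exact norm_add_le _ _
        _ ≤ _ := by linarith
  have key := (hasDerivAt_integral_of_dominated_loc_of_deriv_le (𝕜 := ℂ)
    (μ := volume.restrict (Set.Ioi (0 : ℝ)))
    (F := fun w (r : ℝ) => f (w + r * ω) * ω) (F' := fun w (r : ℝ) => deriv f (w + r * ω) * ω)
    (bound := fun r => b r * ‖ω‖) (x₀ := z) (Metric.ball_mem_nhds z one_pos)
    (Eventually.of_forall fun w => Continuous.aestronglyMeasurable (by fun_prop))
    ((h.integrableOn hf z).mul_const ω)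
    (Continuous.aestronglyMeasurable (by fun_prop))
    ?_ (hb.mul_const _) ?_)
  · have hlim : Tendsto (fun r : ℝ => f (z + r * ω)) atTop (𝓝 0) := by
      refine squeeze_zero_norm' ?_ hb0
      filter_upwards [eventually_gt_atTop 0] with r hr using hb2 z (by linarith) r hr
    have hder : ∀ r ∈ Set.Ioi (0 : ℝ), HasDerivAt (fun r : ℝ => f (z + r * ω))
        (deriv f (z + r * ω) * ω) r := fun r _ => by
      have h1 : HasDerivAt (fun r : ℂ => z + r * ω) ω (r : ℂ) := by
        simpa using ((hasDerivAt_id' (r : ℂ)).mul_const ω).const_add z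
      exact ((hf (z + r * ω)).hasDerivAt.comp (r : ℂ) h1).comp_ofReal
    have hI := integral_Ioi_of_hasDerivAt_of_tendsto
      (Continuous.continuousWithinAt (by fun_prop)) hder key.1 hlim
    have := key.2.neg
    rw [hI] at this
    rw [zero_sub, neg_neg, Complex.ofReal_zero, zero_mul, add_zero] at this
    exact this
  · filter_upwards [ae_restrict_mem measurableSet_Ioi] with r hr w hw
    rw [norm_mul]
    refine mul_le_mul_of_nonneg_right (hd w ?_ r hr) (norm_nonneg _)
    have := norm_le_norm_add_norm_sub' w z
    rw [Metric.mem_ball, dist_eq_norm] at hw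
    linarith
  · refine Eventually.of_forall fun r w _ => ?_
    have h1 : HasDerivAt (fun w : ℂ => w + r * ω) 1 w := (hasDerivAt_id' w).add_const _
    have := ((hf (w + r * ω)).hasDerivAt.comp w h1).mul_const ω
    simpa using this

theorem norm_pcfU_le {α : ℂ} (hα : 0 < (1 / 2 + α).re) (K : ℝ) :
    ∃ C : ℝ, 0 ≤ C ∧ ∀ z : ℂ, -K ≤ z.re → ‖pcfU α z‖ ≤ C * Real.exp (-(z ^ 2).re / 4) := by
  obtain ⟨C, hC, h⟩ := norm_gaussMellin_le hα K
  refine ⟨C / ‖Complex.Gamma (1 / 2 + α)‖, by positivity, fun z hz => ?_⟩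
  rw [pcfU_eq, norm_mul, norm_div, Complex.norm_exp]
  have e : (-z ^ 2 / 4 : ℂ).re = -(z ^ 2).re / 4 := by
    rw [show (-z ^ 2 / 4 : ℂ) = ((-1 / 4 : ℝ) : ℂ) * z ^ 2 by push_cast; ring,
      Complex.re_ofReal_mul]
    ring
  rw [e]
  calc _ ≤ Real.exp (-(z ^ 2).re / 4) / ‖Complex.Gamma (1 / 2 + α)‖ * C := by
        gcongr; exact h z hz
    _ = _ := by ring

theorem re_sq_add_ofReal (ζ : ℂ) (r : ℝ) :
    ((ζ + r) ^ 2).re = (ζ ^ 2).re + 2 * r * ζ.re + r ^ 2 := by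
  simp [sq, Complex.add_re, Complex.add_im]
  ring

/-- Use (1+r)^R ≤ R! e^{1+r} and 1 + r ≤ 5 + r²/16. -/
theorem one_add_pow_mul_exp_le (R : ℕ) {r : ℝ} (hr : 0 ≤ r) :
    (1 + r) ^ R * Real.exp (-r ^ 2 / 8) ≤
      R.factorial * Real.exp 5 * Real.exp (-(1 / 16) * r ^ 2) := by
  have h := Real.pow_div_factorial_le_exp (1 + r) (by linarith) R
  have hf : (0 : ℝ) < R.factorial := by exact_mod_cast R.factorial_pos
  rw [div_le_iff₀ hf] at h
  calc (1 + r) ^ R * Real.exp (-r ^ 2 / 8)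
      ≤ (Real.exp (1 + r) * R.factorial) * Real.exp (-r ^ 2 / 8) := by gcongr
    _ = R.factorial * Real.exp (1 + r + -r ^ 2 / 8) := by rw [Real.exp_add (1 + r)]; ring
    _ ≤ R.factorial * Real.exp (5 + -(1 / 16) * r ^ 2) := by
        refine mul_le_mul_of_nonneg_left (Real.exp_le_exp.2 ?_) hf.le
        nlinarith [sq_nonneg (r / 4 - 2)]
    _ = _ := by rw [Real.exp_add]; ring

theorem integrableOn_gaussian_tail (C : ℝ) :
    IntegrableOn (fun r : ℝ => C * Real.exp (-(1 / 16) * r ^ 2)) (Set.Ioi 0) :=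
  ((integrable_exp_neg_mul_sq (by norm_num : (0 : ℝ) < 1 / 16)).const_mul C).integrableOn

theorem tendsto_gaussian_tail (C : ℝ) :
    Tendsto (fun r : ℝ => C * Real.exp (-(1 / 16) * r ^ 2)) atTop (𝓝 0) := by
  have h : Tendsto (fun r : ℝ => -(1 / 16) * r ^ 2) atTop atBot :=
    (tendsto_pow_atTop two_ne_zero).const_mul_atTop_of_neg (by norm_num)
  simpa using (Real.tendsto_exp_atBot.comp h).const_mul C

/-- Because ωκ = 1, moving by rω shifts the argument of U by the positive real r, and the factor
e^{-r²/4} wins. -/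
theorem decaysAlong_pow_mul_pcfU {α ω κ : ℂ} (hα : 0 < (1 / 2 + α).re)
    (hωκ : ω * κ = 1) (hω : ‖ω‖ = 1) (hκ : ‖κ‖ = 1) (R : ℕ) :
    DecaysAlong ω (fun t => t ^ R * pcfU α (t * κ)) := by
  intro K
  obtain ⟨C, hC, h⟩ := norm_pcfU_le hα K
  refine ⟨fun r => (C * (1 + |K|) ^ R * Real.exp (K ^ 2 / 4) * (R.factorial * Real.exp 5)) *
    Real.exp (-(1 / 16) * r ^ 2), integrableOn_gaussian_tail _, tendsto_gaussian_tail _,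
    fun z hz r hr => ?_⟩
  have hK : 0 ≤ K := (norm_nonneg z).trans hz
  have e : (z + r * ω) * κ = z * κ + r := by linear_combination (r : ℂ) * hωκ
  have hζ : ‖z * κ‖ ≤ K := by rwa [norm_mul, hκ, mul_one]
  have hre := Complex.abs_re_le_norm (z * κ)
  have him := Complex.abs_im_le_norm (z * κ)
  have hre' := abs_le.1 (hre.trans hζ)
  have him' := abs_le.1 (him.trans hζ)
  rw [norm_mul, norm_pow, e]
  have h1 : ‖z + r * ω‖ ≤ (1 + |K|) * (1 + r) := by
    have : ‖z + r * ω‖ ≤ K + r := by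
      refine (norm_add_le _ _).trans ?_
      rw [norm_mul, hω, mul_one, Complex.norm_real, Real.norm_of_nonneg hr.le]
      linarith
    rw [abs_of_nonneg hK]
    nlinarith
  have h2 := h (z * κ + r) (by simp only [Complex.add_re, Complex.ofReal_re]; linarith)
  -- Half of r²/4 pays for the cross term, whose sign is unknown here.
  have h3 : -((z * κ + r) ^ 2).re / 4 ≤ K ^ 2 / 4 + -r ^ 2 / 8 := by
    rw [sq (z * κ + r), Complex.mul_re]
    simp only [Complex.add_re, Complex.add_im, Complex.ofReal_re, Complex.ofReal_im, add_zero]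
    have : (z * κ).re ^ 2 + (z * κ).im ^ 2 ≤ K ^ 2 := by
      have := Complex.sq_norm (z * κ)
      rw [Complex.normSq_apply] at this
      nlinarith [norm_nonneg (z * κ)]
    nlinarith [sq_nonneg (2 * (z * κ).re + r)]
  calc ‖z + r * ω‖ ^ R * ‖pcfU α (z * κ + r)‖
      ≤ ((1 + |K|) * (1 + r)) ^ R * (C * Real.exp (K ^ 2 / 4 + -r ^ 2 / 8)) := by
        gcongr
        exact h2.trans (by gcongr)
    _ = C * (1 + |K|) ^ R * Real.exp (K ^ 2 / 4) * ((1 + r) ^ R * Real.exp (-r ^ 2 / 8)) := by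
        rw [mul_pow, Real.exp_add]; ring
    _ ≤ C * (1 + |K|) ^ R * Real.exp (K ^ 2 / 4) * (R.factorial * Real.exp 5 *
          Real.exp (-(1 / 16) * r ^ 2)) := by
        exact mul_le_mul_of_nonneg_left (one_add_pow_mul_exp_le R hr.le) (by positivity)
    _ = _ := by ring

/-- For Re(zκ) ≥ 0 the cross term 2r Re(zκ) has the favourable sign, so the integral inherits the
exponential factor of its integrand at z with only a power lost. -/
theorem norm_integralFromInfinity_pow_mul_pcfU_le {α ω κ : ℂ} (hα : 0 < (1 / 2 + α).re)
    (hωκ : ω * κ = 1) (hω : ‖ω‖ = 1)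
    (R : ℕ) :
    ∃ C : ℝ, 0 ≤ C ∧ ∀ z : ℂ, 0 ≤ (z * κ).re →
      ‖integralFromInfinity ω (fun t => t ^ R * pcfU α (t * κ)) z‖ ≤
        C * (1 + ‖z‖) ^ R * Real.exp (-((z * κ) ^ 2).re / 4) := by
  obtain ⟨C, hC, h⟩ := norm_pcfU_le hα 0
  have hint := integrableOn_gaussian_tail (R.factorial * Real.exp 5)
  refine ⟨C * ∫ r in Set.Ioi (0 : ℝ), R.factorial * Real.exp 5 * Real.exp (-(1 / 16) * r ^ 2),
    mul_nonneg hC (integral_nonneg fun r => by positivity), fun z hz => ?_⟩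
  rw [integralFromInfinity, norm_neg]
  have := norm_integral_le_of_norm_le (f := fun r : ℝ => (z + r * ω) ^ R *
    pcfU α ((z + r * ω) * κ) * ω)
    (hint.const_mul (C * (1 + ‖z‖) ^ R * Real.exp (-((z * κ) ^ 2).re / 4))) ?_
  · refine this.trans (le_of_eq ?_)
    rw [integral_const_mul]
    ring
  filter_upwards [ae_restrict_mem measurableSet_Ioi] with r hr
  have hr0 : 0 < r := hr
  have e : (z + r * ω) * κ = z * κ + r := by linear_combination (r : ℂ) * hωκ
  rw [norm_mul, norm_mul, norm_pow, e, hω, mul_one]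
  have h1 : ‖z + r * ω‖ ≤ (1 + ‖z‖) * (1 + r) := by
    have : ‖z + r * ω‖ ≤ ‖z‖ + r := by
      refine (norm_add_le _ _).trans ?_
      rw [norm_mul, hω, mul_one, Complex.norm_real, Real.norm_of_nonneg hr0.le]
    nlinarith [norm_nonneg z, mul_nonneg (norm_nonneg z) hr0.le]
  have h2 := h (z * κ + r) (by simp only [Complex.add_re, Complex.ofReal_re]; linarith)
  have h3 : -((z * κ + r) ^ 2).re / 4 ≤ -((z * κ) ^ 2).re / 4 + -r ^ 2 / 8 := by
    rw [re_sq_add_ofReal]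
    nlinarith [mul_nonneg hr0.le hz]
  calc ‖z + r * ω‖ ^ R * ‖pcfU α (z * κ + r)‖
      ≤ ((1 + ‖z‖) * (1 + r)) ^ R *
          (C * Real.exp (-((z * κ) ^ 2).re / 4 + -r ^ 2 / 8)) := by
        gcongr
        exact h2.trans (by gcongr)
    _ = C * (1 + ‖z‖) ^ R * Real.exp (-((z * κ) ^ 2).re / 4) *
          ((1 + r) ^ R * Real.exp (-r ^ 2 / 8)) := by
        rw [mul_pow, Real.exp_add]; ring
    _ ≤ _ := by
        exact mul_le_mul_of_nonneg_left (one_add_pow_mul_exp_le R hr0.le) (by positivity)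

/-! ### The particular solution by variation of parameters -/

/-- The integral of `t^R W_0(a,t)` from `e^{πi/4}∞`. -/
noncomputable def upIntegral (R : ℕ) (a : ℝ) : ℂ → ℂ :=
  integralFromInfinity dirUp (fun t => t ^ R * weberW 0 a t)

/-- The integral of `t^R W_3(a,t)` from `e^{-πi/4}∞`. -/
noncomputable def downIntegral (R : ℕ) (a : ℝ) : ℂ → ℂ :=
  integralFromInfinity dirDown (fun t => t ^ R * weberW 3 a t)

theorem weberParticular03_eq (R : ℕ) (a : ℝ) (z : ℂ) :
    weberParticular03 R a z = Complex.I * Complex.exp ((Real.pi : ℂ) * a / 2) *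
      (weberW 3 a z * upIntegral R a z - weberW 0 a z * downIntegral R a z) := rfl

theorem dirDown_mul_dirUp : dirDown * dirUp = 1 := by rw [mul_comm, dirUp_mul_dirDown]

theorem differentiable_weberW_zero (a : ℝ) : Differentiable ℂ (weberW 0 a) :=
  fun z => (hasDerivAt_weberW_zero a z).differentiableAt

theorem differentiable_weberW_three (a : ℝ) : Differentiable ℂ (weberW 3 a) :=
  fun z => (hasDerivAt_weberW_three a z).differentiableAt

theorem hasDerivAt_upIntegral (R : ℕ) (a : ℝ) (z : ℂ) :
    HasDerivAt (upIntegral R a) (z ^ R * weberW 0 a z) z := by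
  have h := decaysAlong_pow_mul_pcfU (re_half_add_I_mul a) dirUp_mul_dirDown norm_dirUp
    norm_dirDown R
  simp only [← weberW_zero_eq] at h
  exact hasDerivAt_integralFromInfinity
    ((differentiable_id.pow R).mul (differentiable_weberW_zero a)) h z

theorem hasDerivAt_downIntegral (R : ℕ) (a : ℝ) (z : ℂ) :
    HasDerivAt (downIntegral R a) (z ^ R * weberW 3 a z) z := by
  have h := decaysAlong_pow_mul_pcfU (re_half_sub_I_mul a) dirDown_mul_dirUp norm_dirDown
    norm_dirUp R
  simp only [← weberW_three_eq] at h
  exact hasDerivAt_integralFromInfinity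
    ((differentiable_id.pow R).mul (differentiable_weberW_three a)) h z

/-- The derivative of `weberParticular03 R a`. -/
noncomputable def weberParticular03deriv (R : ℕ) (a : ℝ) (z : ℂ) : ℂ :=
  Complex.I * Complex.exp ((Real.pi : ℂ) * a / 2) *
    (weberW3deriv a z * upIntegral R a z - weberW0deriv a z * downIntegral R a z)

/-- The derivatives of the two integrals contribute z^R W_0 W_3 twice with opposite signs, so only
the derivatives of the W_j survive. -/
theorem hasDerivAt_weberParticular03 (R : ℕ) (a : ℝ) (z : ℂ) :
    HasDerivAt (weberParticular03 R a) (weberParticular03deriv R a z) z := by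
  rw [funext (weberParticular03_eq R a)]
  refine ((((hasDerivAt_weberW_three a z).fun_mul (hasDerivAt_upIntegral R a z)).fun_sub
    ((hasDerivAt_weberW_zero a z).fun_mul (hasDerivAt_downIntegral R a z))).const_mul
      (Complex.I * Complex.exp ((Real.pi : ℂ) * a / 2))).congr_deriv ?_
  rw [weberParticular03deriv]
  ring

/-- Differentiating the integrals now produces z^R times the Wronskian, which the prefactor
normalises to z^R. -/
theorem hasDerivAt_weberParticular03deriv (R : ℕ) (a : ℝ) (z : ℂ) :
    HasDerivAt (weberParticular03deriv R a)
      ((a - z ^ 2 / 4) * weberParticular03 R a z + z ^ R) z := by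
  refine ((((hasDerivAt_weberW3deriv a z).fun_mul (hasDerivAt_upIntegral R a z)).fun_sub
    ((hasDerivAt_weberW0deriv a z).fun_mul (hasDerivAt_downIntegral R a z))).const_mul
      (Complex.I * Complex.exp ((Real.pi : ℂ) * a / 2))).congr_deriv ?_
  have hw := weberW_wronskian a z
  have he : Complex.exp ((Real.pi : ℂ) * a / 2) * Complex.exp (-((Real.pi : ℂ) * a / 2)) = 1 := by
    rw [← Complex.exp_add, add_neg_cancel, Complex.exp_zero]
  rw [weberParticular03_eq]
  linear_combination (Complex.I * Complex.exp ((Real.pi : ℂ) * a / 2) * z ^ R) * hw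
    - z ^ R * Complex.I ^ 2 * he - z ^ R * Complex.I_sq

theorem differentiable_weberParticular03 (R : ℕ) (a : ℝ) :
    Differentiable ℂ (weberParticular03 R a) :=
  fun z => (hasDerivAt_weberParticular03 R a z).differentiableAt

theorem deriv_deriv_weberParticular03 (R : ℕ) (a : ℝ) (z : ℂ) :
    deriv (deriv (weberParticular03 R a)) z =
      (a - z ^ 2 / 4) * weberParticular03 R a z + z ^ R := by
  rw [show deriv (weberParticular03 R a) = weberParticular03deriv R a from
    funext fun z => (hasDerivAt_weberParticular03 R a z).deriv]
  exact (hasDerivAt_weberParticular03deriv R a z).deriv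

/-! ### Exponential bounds for W_0, W_3 and their integrals -/

theorem neg_re_sq_mul_dirDown (z : ℂ) : -((z * dirDown) ^ 2).re / 4 = -(z.re * z.im / 2) := by
  rw [mul_pow, dirDown_sq]
  simp [sq]
  ring

theorem neg_re_sq_mul_dirUp (z : ℂ) : -((z * dirUp) ^ 2).re / 4 = z.re * z.im / 2 := by
  rw [mul_pow, dirUp_sq]
  simp [sq]
  ring

theorem dirDown_re : dirDown.re = Real.sqrt 2 / 2 := by
  rw [← conj_dirUp, Complex.conj_re, dirUp_re]

theorem dirDown_im : dirDown.im = -(Real.sqrt 2 / 2) := by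
  rw [← conj_dirUp, Complex.conj_im, dirUp_im]

theorem re_mul_dirDown_nonneg {z : ℂ} (h : 0 ≤ z.re + z.im) : 0 ≤ (z * dirDown).re := by
  rw [Complex.mul_re, dirDown_re, dirDown_im]
  nlinarith [mul_nonneg h (Real.sqrt_nonneg 2)]

theorem re_mul_dirUp_nonneg {z : ℂ} (h : 0 ≤ z.re - z.im) : 0 ≤ (z * dirUp).re := by
  rw [Complex.mul_re, dirUp_re, dirUp_im]
  nlinarith [mul_nonneg h (Real.sqrt_nonneg 2)]

theorem norm_weberW_zero_le (a : ℝ) : ∃ C : ℝ, 0 ≤ C ∧ ∀ z : ℂ, 0 ≤ z.re + z.im →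
    ‖weberW 0 a z‖ ≤ C * Real.exp (-(z.re * z.im / 2)) := by
  obtain ⟨C, hC, h⟩ := norm_pcfU_le (re_half_add_I_mul a) 0
  refine ⟨C, hC, fun z hz => ?_⟩
  rw [weberW_zero_eq, ← neg_re_sq_mul_dirDown]
  exact h _ (by simpa using re_mul_dirDown_nonneg hz)

theorem norm_weberW_three_le (a : ℝ) : ∃ C : ℝ, 0 ≤ C ∧ ∀ z : ℂ, 0 ≤ z.re - z.im →
    ‖weberW 3 a z‖ ≤ C * Real.exp (z.re * z.im / 2) := by
  obtain ⟨C, hC, h⟩ := norm_pcfU_le (re_half_sub_I_mul a) 0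
  refine ⟨C, hC, fun z hz => ?_⟩
  rw [weberW_three_eq, ← neg_re_sq_mul_dirUp]
  exact h _ (by simpa using re_mul_dirUp_nonneg hz)

theorem norm_upIntegral_le (R : ℕ) (a : ℝ) : ∃ C : ℝ, 0 ≤ C ∧ ∀ z : ℂ, 0 ≤ z.re + z.im →
    ‖upIntegral R a z‖ ≤ C * (1 + ‖z‖) ^ R * Real.exp (-(z.re * z.im / 2)) := by
  obtain ⟨C, hC, h⟩ := norm_integralFromInfinity_pow_mul_pcfU_le (re_half_add_I_mul a)
    dirUp_mul_dirDown norm_dirUp R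
  simp only [← weberW_zero_eq] at h
  refine ⟨C, hC, fun z hz => ?_⟩
  rw [← neg_re_sq_mul_dirDown]
  exact h z (re_mul_dirDown_nonneg hz)

theorem norm_downIntegral_le (R : ℕ) (a : ℝ) : ∃ C : ℝ, 0 ≤ C ∧ ∀ z : ℂ, 0 ≤ z.re - z.im →
    ‖downIntegral R a z‖ ≤ C * (1 + ‖z‖) ^ R * Real.exp (z.re * z.im / 2) := by
  obtain ⟨C, hC, h⟩ := norm_integralFromInfinity_pow_mul_pcfU_le (re_half_sub_I_mul a)
    dirDown_mul_dirUp norm_dirDown R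
  simp only [← weberW_three_eq] at h
  refine ⟨C, hC, fun z hz => ?_⟩
  rw [← neg_re_sq_mul_dirUp]
  exact h z (re_mul_dirUp_nonneg hz)

/-- A damped linear system grows at most polynomially. -/
theorem damped_growth {P Q : ℝ → ℂ} {l b : ℂ} {B : ℝ} {N : ℕ} {c : ℝ} (hc : 0 < c)
    (hl : l.re ≤ -c) (hb : ‖b‖ ≤ B) (hN : (1 + B) ^ 2 / (2 * c) ≤ N)
    (hP : ∀ r : ℝ, HasDerivAt P (Q r) r)
    (hQ : ∀ r : ℝ, HasDerivAt Q (l * r * Q r + b * P r) r) {r : ℝ} (hr : 1 ≤ r) :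
    ‖P r‖ ^ 2 + ‖Q r‖ ^ 2 ≤ (‖P 1‖ ^ 2 + ‖Q 1‖ ^ 2) * r ^ N := by
  have hE : ∀ r : ℝ, HasDerivAt (fun r => ‖P r‖ ^ 2 + ‖Q r‖ ^ 2)
      (2 * inner ℝ (P r) (Q r) + 2 * inner ℝ (Q r) (l * r * Q r + b * P r)) r := fun r =>
    (hP r).norm_sq.add (hQ r).norm_sq
  have hB : 0 ≤ B := (norm_nonneg b).trans hb
  -- With E = |P|²+|Q|², completing the square in r|Q| uses the damping -2c r²|Q|² to absorb the
  -- mixed term; what is left is (1+B)²|P|²/(2c). So rE' ≤ NE, and E/r^N is nonincreasing.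
  have hE' : ∀ r : ℝ, 1 ≤ r → r * (2 * inner ℝ (P r) (Q r) +
      2 * inner ℝ (Q r) (l * r * Q r + b * P r)) ≤ N * (‖P r‖ ^ 2 + ‖Q r‖ ^ 2) := by
    intro r hr
    have h1 : inner ℝ (P r) (Q r) ≤ ‖P r‖ * ‖Q r‖ := real_inner_le_norm _ _
    have h2 : inner ℝ (Q r) (b * P r) ≤ B * (‖P r‖ * ‖Q r‖) := by
      refine (real_inner_le_norm _ _).trans ?_
      rw [norm_mul]
      nlinarith [mul_nonneg (norm_nonneg (P r)) (norm_nonneg (Q r))]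
    have h3 : inner ℝ (Q r) (l * r * Q r) = l.re * r * ‖Q r‖ ^ 2 := by
      rw [Complex.inner, ← Complex.normSq_eq_norm_sq, Complex.normSq_apply]
      simp
      ring
    rw [inner_add_right, h3]
    have h4 : (1 + B) ^ 2 ≤ N * (2 * c) := (div_le_iff₀ (by positivity)).1 hN
    have h5 : l.re * r * ‖Q r‖ ^ 2 ≤ -c * r * ‖Q r‖ ^ 2 := by gcongr
    have h6 : 2 * inner ℝ (P r) (Q r) + 2 * (l.re * r * ‖Q r‖ ^ 2 + inner ℝ (Q r) (b * P r)) ≤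
        2 * (1 + B) * (‖P r‖ * ‖Q r‖) - 2 * c * r * ‖Q r‖ ^ 2 := by nlinarith
    have h7 : r * (2 * (1 + B) * (‖P r‖ * ‖Q r‖) - 2 * c * r * ‖Q r‖ ^ 2) ≤ N * ‖P r‖ ^ 2 := by
      have h8 : (2 * c) * (r * (2 * (1 + B) * (‖P r‖ * ‖Q r‖) - 2 * c * r * ‖Q r‖ ^ 2)) ≤
          (2 * c) * (N * ‖P r‖ ^ 2) := by
        nlinarith [sq_nonneg (2 * c * r * ‖Q r‖ - (1 + B) * ‖P r‖),
          mul_le_mul_of_nonneg_right h4 (sq_nonneg ‖P r‖)]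
      exact le_of_mul_le_mul_left h8 (by positivity)
    have h9 : 0 ≤ (N : ℝ) * ‖Q r‖ ^ 2 := by positivity
    calc _ ≤ _ := mul_le_mul_of_nonneg_left h6 (by linarith)
      _ ≤ _ := h7
      _ ≤ _ := by linarith
  have hder : ∀ r ∈ Set.Ici (1 : ℝ), HasDerivAt (fun r => (‖P r‖ ^ 2 + ‖Q r‖ ^ 2) / r ^ N)
      (((2 * inner ℝ (P r) (Q r) + 2 * inner ℝ (Q r) (l * r * Q r + b * P r)) * r ^ N -
        (‖P r‖ ^ 2 + ‖Q r‖ ^ 2) * (N * r ^ (N - 1))) / (r ^ N) ^ 2) r := fun r hr =>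
    (hE r).fun_div (hasDerivAt_pow N r)
      (pow_ne_zero _ (ne_of_gt (lt_of_lt_of_le one_pos hr)))
  have hanti : AntitoneOn (fun r => (‖P r‖ ^ 2 + ‖Q r‖ ^ 2) / r ^ N) (Set.Ici 1) := by
    refine antitoneOn_of_deriv_nonpos (convex_Ici 1)
      (fun r hr => (hder r hr).continuousAt.continuousWithinAt)
      (fun r hr => (hder r (interior_subset hr)).differentiableAt.differentiableWithinAt) ?_
    intro r hr
    have hr1 : r ∈ Set.Ici (1 : ℝ) := interior_subset hr
    have hr0 : 0 < r := lt_of_lt_of_le one_pos hr1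
    rw [(hder r hr1).deriv]
    refine div_nonpos_of_nonpos_of_nonneg ?_ (by positivity)
    have h := hE' r hr1
    rcases Nat.eq_zero_or_pos N with h0 | h0
    · subst h0
      simp only [CharP.cast_eq_zero, zero_mul] at h
      have := nonpos_of_mul_nonpos_right h hr0
      simpa using this
    · have e : r ^ N = r * r ^ (N - 1) := by
        rw [← pow_succ', Nat.sub_add_cancel h0]
      rw [e]
      have := mul_le_mul_of_nonneg_right h (pow_nonneg hr0.le (N - 1))
      nlinarith
  have := hanti (Set.self_mem_Ici) (show r ∈ Set.Ici 1 from hr) hr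
  simp only [one_pow, div_one] at this
  rwa [div_le_iff₀ (by positivity)] at this

/-- Solutions of Weber's equation grow at most like `e^{-iz²/4}` times a power in a sector around
`e^{πi/4}∞`. -/
theorem exists_growth_of_weber {y y' : ℂ → ℂ} {a : ℝ} (hy : ∀ z, HasDerivAt y (y' z) z)
    (hy' : ∀ z, HasDerivAt y' ((a - z ^ 2 / 4) * y z) z) :
    ∃ (C : ℝ) (N : ℕ), 0 ≤ C ∧ ∀ z : ℂ, 1 ≤ ‖z‖ → z.re ≤ z.im → z.im ≤ 2 * z.re →
      ‖y z‖ ≤ C * ‖z‖ ^ N * Real.exp (z.re * z.im / 2) := by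
  obtain ⟨N, hN⟩ := exists_nat_ge ((1 + (|a| + 1 / 2)) ^ 2 / (2 * (2 / 5)))
  have hyc : Continuous y := continuous_iff_continuousAt.2 fun z => (hy z).continuousAt
  have hyc' : Continuous y' := continuous_iff_continuousAt.2 fun z => (hy' z).continuousAt
  -- Removing the dominant factor e^{-iz²/4} leaves v'' = izv' + (a+i/2)v, which is damped along
  -- rays in the sector.
  let E : ℂ → ℂ := fun z => Complex.exp (Complex.I * z ^ 2 / 4)
  let v : ℂ → ℂ := fun z => y z * E z
  let v' : ℂ → ℂ := fun z => (y' z + Complex.I * z / 2 * y z) * E z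
  have hE : ∀ z, HasDerivAt E (E z * (Complex.I * z / 2)) z := fun z => by
    have : HasDerivAt (fun z : ℂ => Complex.I * z ^ 2 / 4) (Complex.I * z / 2) z := by
      refine ((((hasDerivAt_id' z).fun_pow 2).const_mul Complex.I).div_const 4).congr_deriv ?_
      simp; ring
    exact this.cexp
  have hv : ∀ z, HasDerivAt v (v' z) z := fun z =>
    ((hy z).fun_mul (hE z)).congr_deriv (by simp only [v']; ring)
  have hv' : ∀ z, HasDerivAt v' (Complex.I * z * v' z + (a + Complex.I / 2) * v z) z := fun z => by
    refine (((hy' z).fun_add ((((hasDerivAt_id' z).const_mul Complex.I).div_const 2).fun_mul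
      (hy z))).fun_mul (hE z)).congr_deriv ?_
    simp only [v, v']
    linear_combination (-(z ^ 2 * y z * E z) / 4) * Complex.I_sq
  have hcont : Continuous fun z => ‖v z‖ ^ 2 + ‖v' z‖ ^ 2 := by
    have : Continuous E := by fun_prop
    fun_prop
  obtain ⟨M, hM⟩ := (isCompact_sphere (0 : ℂ) 1).exists_bound_of_continuousOn hcont.continuousOn
  have hM0 : 0 ≤ M := (norm_nonneg _).trans (hM 1 (by simp))
  refine ⟨Real.sqrt M, N, Real.sqrt_nonneg _, fun z hz h1 h2 => ?_⟩
  have hz0 : 0 < ‖z‖ := by linarith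
  obtain ⟨e, he⟩ : ∃ e : ℂ, e = z / ‖z‖ := ⟨_, rfl⟩
  have hzn : (‖z‖ : ℂ) ≠ 0 := by exact_mod_cast hz0.ne'
  have hze : z = ‖z‖ * e := by rw [he]; field_simp
  have hen : ‖e‖ = 1 := by rw [he, norm_div, Complex.norm_real, norm_norm, div_self hz0.ne']
  have hzr : z.re = ‖z‖ * e.re := by
    conv_lhs => rw [hze, Complex.re_ofReal_mul]
  have hzi : z.im = ‖z‖ * e.im := by
    conv_lhs => rw [hze, Complex.im_ofReal_mul]
  have k1 : e.re ≤ e.im := by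
    rw [hzr, hzi] at h1; exact le_of_mul_le_mul_left h1 hz0
  have k2 : e.im ≤ 2 * e.re := by
    rw [hzr, hzi] at h2; refine le_of_mul_le_mul_left ?_ hz0; linarith
  have k3 : e.re ^ 2 + e.im ^ 2 = 1 := by
    have := Complex.sq_norm e
    rw [hen, Complex.normSq_apply] at this
    nlinarith
  have k0 : 0 ≤ e.re := by linarith
  -- On a ray in the unit direction e the damping coefficient is Re(ie²) = -2 Re e Im e. For Re e ≤
  -- Im e ≤ 2 Re e it is at most -4/5, so c = 2/5 is ample.
  have hgr := damped_growth (P := fun r : ℝ => v (r * e)) (Q := fun r : ℝ => v' (r * e) * e)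
    (l := Complex.I * e ^ 2) (b := e ^ 2 * (a + Complex.I / 2)) (B := |a| + 1 / 2) (N := N)
    (c := 2 / 5) (by norm_num) ?_ ?_ hN ?_ ?_ hz
  · simp only [Complex.ofReal_one, one_mul, norm_mul, hen, mul_one, ← hze] at hgr
    have hMe := hM e (by simp [hen])
    rw [Real.norm_of_nonneg (by positivity)] at hMe
    have hv2 : ‖v z‖ ^ 2 ≤ (Real.sqrt M * ‖z‖ ^ N) ^ 2 := by
      calc ‖v z‖ ^ 2 ≤ (‖v e‖ ^ 2 + ‖v' e‖ ^ 2) * ‖z‖ ^ N := by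
            refine le_trans ?_ hgr
            have := sq_nonneg ‖v' z‖
            linarith
        _ ≤ M * (‖z‖ ^ N * ‖z‖ ^ N) := by
            have : ‖z‖ ^ N ≤ ‖z‖ ^ N * ‖z‖ ^ N := by
              have : 1 ≤ ‖z‖ ^ N := one_le_pow₀ hz
              nlinarith
            gcongr
        _ = _ := by rw [mul_pow, Real.sq_sqrt hM0]; ring
    have hv1 : ‖v z‖ ≤ Real.sqrt M * ‖z‖ ^ N := abs_le_of_sq_le_sq' hv2 (by positivity) |>.2
    have hEn : ‖E z‖ = Real.exp (-(z.re * z.im / 2)) := by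
      simp only [E]
      rw [Complex.norm_exp]
      congr 1
      rw [show Complex.I * z ^ 2 / 4 = ((1 / 4 : ℝ) : ℂ) * (Complex.I * z ^ 2) by push_cast; ring,
        Complex.re_ofReal_mul]
      simp [sq]; ring
    have hvn : ‖v z‖ = ‖y z‖ * Real.exp (-(z.re * z.im / 2)) := by
      rw [← hEn, ← norm_mul]
    rw [hvn, Real.exp_neg, ← div_eq_mul_inv, div_le_iff₀ (Real.exp_pos _)] at hv1
    exact hv1
  · simp [sq]
    nlinarith
  · rw [norm_mul, norm_pow, hen, one_pow, one_mul]
    refine (norm_add_le _ _).trans ?_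
    simp
  · intro r
    have h1 : HasDerivAt (fun r : ℂ => r * e) e (r : ℂ) := by
      simpa using (hasDerivAt_id' (r : ℂ)).mul_const e
    exact ((hv (r * e)).comp (r : ℂ) h1).comp_ofReal
  · intro r
    have h1 : HasDerivAt (fun r : ℂ => r * e) e (r : ℂ) := by
      simpa using (hasDerivAt_id' (r : ℂ)).mul_const e
    refine ((((hv' (r * e)).comp (r : ℂ) h1).comp_ofReal).mul_const e).congr_deriv ?_
    ring

/-- Beyond the direction e^{πi/4} the bound by integration from infinity is lost. Instead integrate
t^R W_3 outwards from the unit circle: the exponent grows along the ray, so its end value dominates.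
-/
theorem norm_downIntegral_le_of_growth (R : ℕ) (a : ℝ) :
    ∃ (C : ℝ) (N : ℕ), 0 ≤ C ∧ ∀ z : ℂ, 1 ≤ ‖z‖ → z.re ≤ z.im → z.im ≤ 2 * z.re →
      ‖downIntegral R a z‖ ≤ C * ‖z‖ ^ N * Real.exp (z.re * z.im / 2) := by
  obtain ⟨C, N, hC, h⟩ := exists_growth_of_weber (hasDerivAt_weberW_three a)
    (hasDerivAt_weberW3deriv a)
  have hcont : Continuous (downIntegral R a) :=
    continuous_iff_continuousAt.2 fun z => (hasDerivAt_downIntegral R a z).continuousAt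
  obtain ⟨M, hM⟩ := (isCompact_sphere (0 : ℂ) 1).exists_bound_of_continuousOn hcont.continuousOn
  have hM0 : 0 ≤ M := (norm_nonneg _).trans (hM 1 (by simp))
  refine ⟨M + C, R + N + 1, by positivity, fun z hz h1 h2 => ?_⟩
  have hz0 : 0 < ‖z‖ := by linarith
  obtain ⟨e, he⟩ : ∃ e : ℂ, e = z / ‖z‖ := ⟨_, rfl⟩
  have hzn : (‖z‖ : ℂ) ≠ 0 := by exact_mod_cast hz0.ne'
  have hze : z = ‖z‖ * e := by rw [he]; field_simp
  have hen : ‖e‖ = 1 := by rw [he, norm_div, Complex.norm_real, norm_norm, div_self hz0.ne']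
  have hzr : z.re = ‖z‖ * e.re := by
    conv_lhs => rw [hze, Complex.re_ofReal_mul]
  have hzi : z.im = ‖z‖ * e.im := by
    conv_lhs => rw [hze, Complex.im_ofReal_mul]
  have k1 : e.re ≤ e.im := by
    rw [hzr, hzi] at h1; exact le_of_mul_le_mul_left h1 hz0
  have k2 : e.im ≤ 2 * e.re := by
    rw [hzr, hzi] at h2; refine le_of_mul_le_mul_left ?_ hz0; linarith
  have k0 : 0 ≤ e.re := by linarith
  have hder : ∀ r : ℝ, HasDerivAt (fun r : ℝ => downIntegral R a (r * e))
      ((r * e) ^ R * weberW 3 a (r * e) * e) r := fun r => by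
    have h1 : HasDerivAt (fun r : ℂ => r * e) e (r : ℂ) := by
      simpa using (hasDerivAt_id' (r : ℂ)).mul_const e
    exact ((hasDerivAt_downIntegral R a (r * e)).comp (r : ℂ) h1).comp_ofReal
  have hmv := (convex_Icc (1 : ℝ) ‖z‖).norm_image_sub_le_of_norm_hasDerivWithin_le
    (C := C * ‖z‖ ^ (R + N) * Real.exp (z.re * z.im / 2))
    (fun r _ => (hder r).hasDerivWithinAt) ?_ (Set.left_mem_Icc.2 hz) (Set.right_mem_Icc.2 hz)
  · simp only [Complex.ofReal_one, one_mul, ← hze] at hmv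
    have hx : 1 ≤ Real.exp (z.re * z.im / 2) := by
      rw [Real.one_le_exp_iff, hzr, hzi]
      have := mul_nonneg k0 (k0.trans k1)
      have := mul_nonneg (mul_nonneg hz0.le hz0.le) this
      nlinarith
    have hMe := hM e (by simp [hen])
    have hp : 1 ≤ ‖z‖ ^ (R + N + 1) := one_le_pow₀ hz
    calc ‖downIntegral R a z‖ ≤ ‖downIntegral R a e‖ +
          ‖downIntegral R a z - downIntegral R a e‖ := norm_le_norm_add_norm_sub' _ _
      _ ≤ M * (‖z‖ ^ (R + N + 1) * Real.exp (z.re * z.im / 2)) +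
          C * ‖z‖ ^ (R + N) * Real.exp (z.re * z.im / 2) * ‖z‖ := by
          refine add_le_add ?_ (hmv.trans ?_)
          · have : 1 ≤ ‖z‖ ^ (R + N + 1) * Real.exp (z.re * z.im / 2) :=
              one_le_mul_of_one_le_of_one_le hp hx
            nlinarith
          · refine mul_le_mul_of_nonneg_left ?_ (by positivity)
            rw [Real.norm_of_nonneg (by linarith)]
            linarith
      _ = _ := by ring
  · intro r hr
    have hr0 : 0 < r := lt_of_lt_of_le one_pos hr.1
    have hn : ‖(r : ℂ) * e‖ = r := by
      rw [norm_mul, hen, mul_one, Complex.norm_real, Real.norm_of_nonneg hr0.le]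
    have hw := h (r * e) (by rw [hn]; exact hr.1)
      (by rw [Complex.re_ofReal_mul, Complex.im_ofReal_mul]; gcongr)
      (by rw [Complex.re_ofReal_mul, Complex.im_ofReal_mul]; nlinarith)
    rw [norm_mul, norm_mul, norm_pow, hn, hen, mul_one]
    rw [hn, Complex.re_ofReal_mul, Complex.im_ofReal_mul] at hw
    calc r ^ R * ‖weberW 3 a (r * e)‖
        ≤ ‖z‖ ^ R * (C * ‖z‖ ^ N * Real.exp (z.re * z.im / 2)) := by
          refine mul_le_mul (pow_le_pow_left₀ hr0.le hr.2 _) (hw.trans ?_) (norm_nonneg _)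
            (by positivity)
          rw [hzr, hzi]
          have : 0 ≤ e.im := k0.trans k1
          have := hr.2
          gcongr
      _ = _ := by rw [pow_add]; ring

/-! ### Conjugation symmetry and polynomial growth of the particular solution -/

theorem pcfU_conj (α z : ℂ) :
    pcfU ((starRingEnd ℂ) α) ((starRingEnd ℂ) z) = (starRingEnd ℂ) (pcfU α z) := by
  rw [pcfU, pcfU, map_mul, map_div₀, ← Complex.exp_conj, ← Complex.Gamma_conj, ← integral_conj]
  congr 1
  · simp [Complex.conj_ofNat]
  · refine setIntegral_congr_fun measurableSet_Ioi fun t ht => ?_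
    have ht0 : (0 : ℝ) < t := ht
    simp only [map_mul, ← Complex.exp_conj]
    congr 1
    · have harg : Complex.arg (t : ℂ) ≠ Real.pi := by
        rw [Complex.arg_ofReal_of_nonneg ht0.le]; exact Real.pi_pos.ne
      rw [show (starRingEnd ℂ) α - 1 / 2 = (starRingEnd ℂ) (α - 1 / 2) by
        simp [Complex.conj_ofNat], Complex.cpow_conj _ _ harg, Complex.conj_ofReal]
    · simp [Complex.conj_ofNat]

theorem weberW_three_conj (a : ℝ) (z : ℂ) :
    weberW 3 a ((starRingEnd ℂ) z) = (starRingEnd ℂ) (weberW 0 a z) := by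
  rw [weberW_zero_eq, weberW_three_eq, ← pcfU_conj]
  congr 1
  · simp
  · rw [map_mul, ← conj_dirUp, Complex.conj_conj]

theorem weberW_zero_conj (a : ℝ) (z : ℂ) :
    weberW 0 a ((starRingEnd ℂ) z) = (starRingEnd ℂ) (weberW 3 a z) := by
  rw [← Complex.conj_conj z, weberW_three_conj]
  simp

theorem upIntegral_conj (R : ℕ) (a : ℝ) (z : ℂ) :
    upIntegral R a ((starRingEnd ℂ) z) = (starRingEnd ℂ) (downIntegral R a z) := by
  rw [upIntegral, downIntegral, integralFromInfinity, integralFromInfinity, map_neg,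
    ← integral_conj]
  congr 1
  refine integral_congr_ae (Eventually.of_forall fun r => ?_)
  have e : (starRingEnd ℂ) z + r * dirUp = (starRingEnd ℂ) (z + r * dirDown) := by
    rw [← conj_dirUp]; simp
  simp only [e, weberW_zero_conj, map_mul, map_pow]
  rw [← conj_dirUp, Complex.conj_conj]

theorem downIntegral_conj (R : ℕ) (a : ℝ) (z : ℂ) :
    downIntegral R a ((starRingEnd ℂ) z) = (starRingEnd ℂ) (upIntegral R a z) := by
  rw [← Complex.conj_conj z, upIntegral_conj]
  simp

theorem weberParticular03_conj (R : ℕ) (a : ℝ) (z : ℂ) :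
    weberParticular03 R a ((starRingEnd ℂ) z) = (starRingEnd ℂ) (weberParticular03 R a z) := by
  rw [weberParticular03_eq, weberParticular03_eq, weberW_three_conj, weberW_zero_conj,
    upIntegral_conj, downIntegral_conj]
  have : (starRingEnd ℂ) (Complex.exp ((Real.pi : ℂ) * a / 2)) =
      Complex.exp ((Real.pi : ℂ) * a / 2) := by
    rw [← Complex.exp_conj]
    congr 1
    rw [map_div₀, map_mul, Complex.conj_ofReal, Complex.conj_ofReal, map_ofNat]
  simp only [map_mul, map_sub, this, Complex.conj_I]
  ring

/-- The particular solution grows at most polynomially in the sector `|Im z| ≤ 2 Re z`. -/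
theorem weberParticular03_growth (R : ℕ) (a : ℝ) :
    ∃ (C : ℝ) (N : ℕ), 0 ≤ C ∧ ∀ z : ℂ, 1 ≤ ‖z‖ → |z.im| ≤ 2 * z.re →
      ‖weberParticular03 R a z‖ ≤ C * ‖z‖ ^ N := by
  obtain ⟨A0, hA0, a0⟩ := norm_weberW_zero_le a
  obtain ⟨A3, hA3, a3⟩ := norm_weberW_three_le a
  obtain ⟨B0, hB0, b0⟩ := norm_upIntegral_le R a
  obtain ⟨B3, hB3, b3⟩ := norm_downIntegral_le R a
  obtain ⟨C3, N3, hC3, c3⟩ := exists_growth_of_weber (hasDerivAt_weberW_three a)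
    (hasDerivAt_weberW3deriv a)
  obtain ⟨D3, M3, hD3, d3⟩ := norm_downIntegral_le_of_growth R a
  -- In the upper half of the sector W_3 and `downIntegral` are at most a power times X, while W_0
  -- and `upIntegral` are at most a power times Y = 1/X. In both products the exponentials cancel.
  -- Conjugation covers the lower half.
  have key : ∃ (C : ℝ) (N : ℕ), 0 ≤ C ∧ ∀ z : ℂ, 1 ≤ ‖z‖ → |z.im| ≤ 2 * z.re → 0 ≤ z.im →
      ‖weberW 3 a z * upIntegral R a z‖ + ‖weberW 0 a z * downIntegral R a z‖ ≤
        C * ‖z‖ ^ N := by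
    refine ⟨(A3 + C3) * B0 * 2 ^ R + A0 * (B3 * 2 ^ R + D3), N3 + M3 + R, by positivity,
      fun z hz hs hi => ?_⟩
    rw [abs_of_nonneg hi] at hs
    have hz0 : 0 < ‖z‖ := by linarith
    set X := Real.exp (z.re * z.im / 2) with hX
    have hX0 : 0 < X := Real.exp_pos _
    have hXX : X * Real.exp (-(z.re * z.im / 2)) = 1 := by
      rw [hX, ← Real.exp_add, add_neg_cancel, Real.exp_zero]
    set Y := Real.exp (-(z.re * z.im / 2)) with hY
    have hY0 : 0 < Y := Real.exp_pos _
    have hsum : 0 ≤ z.re + z.im := by linarith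
    have hp : ∀ k l : ℕ, ‖z‖ ^ k ≤ ‖z‖ ^ (k + l) := fun k l =>
      pow_le_pow_right₀ hz (Nat.le_add_right k l)
    have p2 : (1 + ‖z‖) ^ R ≤ 2 ^ R * ‖z‖ ^ R := by
      rw [← mul_pow]; gcongr; linarith
    -- The direct bound requires Im z ≤ Re z; above the diagonal the damped-system bound takes over.
    have w3 : ‖weberW 3 a z‖ ≤ (A3 + C3) * ‖z‖ ^ N3 * X := by
      rcases le_total z.re z.im with hle | hle
      · refine (c3 z hz hle hs).trans ?_
        gcongr; linarith
      · refine (a3 z (by linarith)).trans ?_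
        have : 1 ≤ ‖z‖ ^ N3 := one_le_pow₀ hz
        gcongr
        nlinarith [mul_nonneg hA3 hC3]
    have i3 : ‖downIntegral R a z‖ ≤ (B3 * 2 ^ R + D3) * ‖z‖ ^ (R + M3) * X := by
      rcases le_total z.re z.im with hle | hle
      · refine (d3 z hz hle hs).trans ?_
        have := hp M3 R
        rw [add_comm R M3]
        gcongr
        linarith [show 0 ≤ B3 * 2 ^ R by positivity]
      · refine (b3 z (by linarith)).trans ?_
        refine mul_le_mul_of_nonneg_right ?_ hX0.le
        calc B3 * (1 + ‖z‖) ^ R ≤ B3 * (2 ^ R * ‖z‖ ^ (R + M3)) :=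
              mul_le_mul_of_nonneg_left (p2.trans (mul_le_mul_of_nonneg_left (hp R M3)
                (by positivity))) hB3
          _ ≤ _ := by nlinarith [show 0 ≤ D3 * ‖z‖ ^ (R + M3) by positivity]
    have w0 := a0 z hsum
    have i0 : ‖upIntegral R a z‖ ≤ B0 * (2 ^ R * ‖z‖ ^ R) * Y :=
      (b0 z hsum).trans (by gcongr)
    rw [norm_mul, norm_mul]
    calc _ ≤ ((A3 + C3) * ‖z‖ ^ N3 * X) * (B0 * (2 ^ R * ‖z‖ ^ R) * Y) +
          (A0 * Y) * ((B3 * 2 ^ R + D3) * ‖z‖ ^ (R + M3) * X) := by gcongr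
      _ = (A3 + C3) * B0 * 2 ^ R * ‖z‖ ^ (N3 + R) * (X * Y) +
          A0 * (B3 * 2 ^ R + D3) * ‖z‖ ^ (R + M3) * (X * Y) := by ring
      _ ≤ (A3 + C3) * B0 * 2 ^ R * ‖z‖ ^ (N3 + M3 + R) * (X * Y) +
          A0 * (B3 * 2 ^ R + D3) * ‖z‖ ^ (N3 + M3 + R) * (X * Y) := by
          have q1 : ‖z‖ ^ (N3 + R) ≤ ‖z‖ ^ (N3 + M3 + R) := pow_le_pow_right₀ hz (by omega)
          have q2 : ‖z‖ ^ (R + M3) ≤ ‖z‖ ^ (N3 + M3 + R) := pow_le_pow_right₀ hz (by omega)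
          exact add_le_add
            (mul_le_mul_of_nonneg_right (mul_le_mul_of_nonneg_left q1 (by positivity))
              (by positivity))
            (mul_le_mul_of_nonneg_right (mul_le_mul_of_nonneg_left q2 (by positivity))
              (by positivity))
      _ = _ := by rw [hXX]; ring
  obtain ⟨C, N, hC, h⟩ := key
  have h' : ∀ z : ℂ, 1 ≤ ‖z‖ → |z.im| ≤ 2 * z.re → 0 ≤ z.im →
      ‖weberParticular03 R a z‖ ≤ Real.exp (Real.pi * a / 2) * C * ‖z‖ ^ N := by
    intro z h1 h2 h3
    rw [weberParticular03_eq, norm_mul, norm_mul, Complex.norm_I, one_mul]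
    have : ‖Complex.exp ((Real.pi : ℂ) * a / 2)‖ = Real.exp (Real.pi * a / 2) := by
      rw [show (Real.pi : ℂ) * a / 2 = ((Real.pi * a / 2 : ℝ) : ℂ) by push_cast; ring,
        Complex.norm_exp_ofReal]
    rw [this, mul_assoc]
    gcongr
    exact (norm_sub_le _ _).trans (h z h1 h2 h3)
  refine ⟨Real.exp (Real.pi * a / 2) * C, N, by positivity, fun z h1 h2 => ?_⟩
  rcases le_total 0 z.im with hi | hi
  · exact h' z h1 h2 hi
  · have := h' ((starRingEnd ℂ) z) (by rwa [RCLike.norm_conj]) (by simpa using h2) (by simpa using hi)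
    rwa [weberParticular03_conj, RCLike.norm_conj, RCLike.norm_conj] at this

/-! ### The coefficients G_s as rational functions and their size at infinity -/

open Polynomial in
/-- The numerator of the derivative of `P / (X²+1)^k`, over `(X²+1)^{k+1}`. -/
noncomputable def derivNumerator (k : ℕ) (P : ℂ[X]) : ℂ[X] :=
  derivative P * (X ^ 2 + 1) - C (2 * k : ℂ) * X * P

open Polynomial in
/-- The numerator of `coeffG R s` over `(X²+1)^{3s+1}`. -/
noncomputable def coeffNumerator (R : ℕ) : ℕ → ℂ[X]
  | 0 => -X ^ R
  | s + 1 => derivNumerator (3 * s + 2) (derivNumerator (3 * s + 1) (coeffNumerator R s))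

open Polynomial in
theorem natDegree_derivNumerator_le (k : ℕ) (P : ℂ[X]) :
    (derivNumerator k P).natDegree ≤ P.natDegree + 1 := by
  rw [derivNumerator]
  refine (natDegree_sub_le _ _).trans (max_le ?_ ?_)
  -- Constants are separated because deg P - 1 truncates in ℕ; their derivative is zero.
  · rcases Nat.eq_zero_or_pos P.natDegree with h | h
    · rw [natDegree_eq_zero.1 h |>.choose_spec.symm]
      simp
    · refine natDegree_mul_le.trans ?_
      have h1 := natDegree_derivative_le P
      have h2 : (X ^ 2 + 1 : ℂ[X]).natDegree ≤ 2 := by compute_degree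
      omega
  · refine natDegree_mul_le.trans ?_
    have h2 : (C (2 * k : ℂ) * X : ℂ[X]).natDegree ≤ 1 := by compute_degree
    omega

theorem natDegree_coeffNumerator_le (R s : ℕ) : (coeffNumerator R s).natDegree ≤ R + 2 * s := by
  induction s with
  | zero => simp [coeffNumerator]
  | succ s ih =>
    rw [coeffNumerator]
    have h1 := natDegree_derivNumerator_le (3 * s + 1) (coeffNumerator R s)
    have h2 := natDegree_derivNumerator_le (3 * s + 2)
      (derivNumerator (3 * s + 1) (coeffNumerator R s))
    omega

theorem hasDerivAt_eval_div (P : Polynomial ℂ) (k : ℕ) {z : ℂ} (hz : z ^ 2 + 1 ≠ 0) :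
    HasDerivAt (fun z => P.eval z / (z ^ 2 + 1) ^ k)
      ((derivNumerator k P).eval z / (z ^ 2 + 1) ^ (k + 1)) z := by
  have h1 : HasDerivAt (fun z : ℂ => z ^ 2 + 1) (2 * z) z := by
    refine (((hasDerivAt_id' z).fun_pow 2).add_const 1).congr_deriv ?_
    simp
  refine ((P.hasDerivAt z).fun_div (h1.fun_pow k) (pow_ne_zero k hz)).congr_deriv ?_
  rw [derivNumerator]
  simp only [Polynomial.eval_sub, Polynomial.eval_mul, Polynomial.eval_add, Polynomial.eval_pow,
    Polynomial.eval_X, Polynomial.eval_one, Polynomial.eval_C]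
  rcases Nat.eq_zero_or_pos k with h | h
  · subst h; field_simp; simp
  · obtain ⟨m, rfl⟩ := Nat.exists_eq_succ_of_ne_zero h.ne'
    simp only [Nat.succ_eq_add_one, Nat.add_sub_cancel]
    field_simp
    ring

theorem isOpen_sq_add_one_ne_zero : IsOpen {z : ℂ | z ^ 2 + 1 ≠ 0} :=
  isOpen_ne_fun (by fun_prop) continuous_const

/-- Two quotient-rule differentiations and one division raise the exponent of z²+1 by 3. The
induction runs over the whole open set z²+1 ≠ 0, since `deriv` needs the formula in a neighbourhood.
-/
theorem coeffG_eq (R s : ℕ) {z : ℂ} (hz : z ^ 2 + 1 ≠ 0) :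
    coeffG R s z = (coeffNumerator R s).eval z / (z ^ 2 + 1) ^ (3 * s + 1) := by
  induction s generalizing z with
  | zero => simp [coeffG, coeffNumerator]
  | succ s ih =>
    have ev : ∀ w ∈ {z : ℂ | z ^ 2 + 1 ≠ 0}, deriv (coeffG R s) w =
        (derivNumerator (3 * s + 1) (coeffNumerator R s)).eval w / (w ^ 2 + 1) ^ (3 * s + 2) := by
      intro w hw
      refine ((hasDerivAt_eval_div _ _ hw).congr_of_eventuallyEq ?_).deriv
      filter_upwards [isOpen_sq_add_one_ne_zero.mem_nhds hw] with v hv using ih hv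
    have ev2 : deriv (deriv (coeffG R s)) z =
        (coeffNumerator R (s + 1)).eval z / (z ^ 2 + 1) ^ (3 * s + 3) := by
      refine ((hasDerivAt_eval_div _ _ hz).congr_of_eventuallyEq ?_).deriv
      filter_upwards [isOpen_sq_add_one_ne_zero.mem_nhds hz] with v hv using ev v hv
    change deriv (deriv (coeffG R s)) z / (z ^ 2 + 1) = _
    rw [ev2, div_div, ← pow_succ]
    rfl

/-- The derivative of `coeffG R s`. -/
noncomputable def coeffGderiv (R s : ℕ) (z : ℂ) : ℂ :=
  (derivNumerator (3 * s + 1) (coeffNumerator R s)).eval z / (z ^ 2 + 1) ^ (3 * s + 2)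

theorem hasDerivAt_coeffG (R s : ℕ) {z : ℂ} (hz : z ^ 2 + 1 ≠ 0) :
    HasDerivAt (coeffG R s) (coeffGderiv R s z) z := by
  refine (hasDerivAt_eval_div _ _ hz).congr_of_eventuallyEq ?_
  filter_upwards [isOpen_sq_add_one_ne_zero.mem_nhds hz] with v hv using coeffG_eq R s hv

theorem hasDerivAt_coeffGderiv (R s : ℕ) {z : ℂ} (hz : z ^ 2 + 1 ≠ 0) :
    HasDerivAt (coeffGderiv R s) ((z ^ 2 + 1) * coeffG R (s + 1) z) z := by
  refine (hasDerivAt_eval_div _ _ hz).congr_deriv ?_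
  rw [coeffG_eq R (s + 1) hz, coeffNumerator]
  rw [show 3 * (s + 1) + 1 = (3 * s + 3) + 1 by ring, pow_succ (z ^ 2 + 1) (3 * s + 3)]
  field_simp

theorem norm_eval_le (P : Polynomial ℂ) {d : ℕ} (hd : P.natDegree ≤ d) :
    ∃ C : ℝ, 0 ≤ C ∧ ∀ z : ℂ, 1 ≤ ‖z‖ → ‖P.eval z‖ ≤ C * ‖z‖ ^ d := by
  refine ⟨∑ i ∈ Finset.range (P.natDegree + 1), ‖P.coeff i‖,
    Finset.sum_nonneg fun _ _ => norm_nonneg _, fun z hz => ?_⟩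
  rw [Polynomial.eval_eq_sum_range, Finset.sum_mul]
  refine (norm_sum_le _ _).trans (Finset.sum_le_sum fun i hi => ?_)
  rw [norm_mul, norm_pow]
  have := Finset.mem_range.1 hi
  exact mul_le_mul_of_nonneg_left (pow_le_pow_right₀ hz (by omega)) (norm_nonneg _)

theorem norm_sq_add_one_ge {z : ℂ} (hz : 2 ≤ ‖z‖) : ‖z‖ ^ 2 / 2 ≤ ‖z ^ 2 + 1‖ := by
  have h := norm_sub_le (z ^ 2 + 1) 1
  rw [add_sub_cancel_right, norm_pow, norm_one] at h
  nlinarith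

theorem norm_sq_add_one_le {z : ℂ} (hz : 2 ≤ ‖z‖) : ‖z ^ 2 + 1‖ ≤ 2 * ‖z‖ ^ 2 := by
  have h := norm_add_le (z ^ 2) 1
  rw [norm_pow, norm_one] at h
  nlinarith

theorem norm_eval_div_le (P : Polynomial ℂ) {d k : ℕ} (hd : P.natDegree ≤ d) {β : ℝ}
    (hβ : β = (d : ℝ) - 2 * k) :
    ∃ C : ℝ, 0 ≤ C ∧ ∀ z : ℂ, 2 ≤ ‖z‖ → ‖P.eval z / (z ^ 2 + 1) ^ k‖ ≤ C * ‖z‖ ^ β := by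
  obtain ⟨C, hC, h⟩ := norm_eval_le P hd
  refine ⟨C * 2 ^ k, by positivity, fun z hz => ?_⟩
  have hz0 : 0 < ‖z‖ := by linarith
  have h1 : (‖z‖ ^ 2 / 2) ^ k ≤ ‖z ^ 2 + 1‖ ^ k := by
    gcongr; exact norm_sq_add_one_ge hz
  rw [norm_div, norm_pow, hβ, Real.rpow_sub hz0, Real.rpow_natCast,
    show (2 * (k : ℝ)) = ((2 * k : ℕ) : ℝ) by push_cast; ring, Real.rpow_natCast]
  calc ‖P.eval z‖ / ‖z ^ 2 + 1‖ ^ k ≤ C * ‖z‖ ^ d / (‖z‖ ^ 2 / 2) ^ k := by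
        have : 0 < (‖z‖ ^ 2 / 2) ^ k := by positivity
        gcongr
        exact h z (by linarith)
    _ = _ := by rw [div_pow, pow_mul]; field_simp

/-- Degree R+2s over degree 2(3s+1): each step of the recursion gains four powers. -/
theorem norm_coeffG_le (R s : ℕ) : ∃ C : ℝ, 0 ≤ C ∧ ∀ z : ℂ, 2 ≤ ‖z‖ →
    ‖coeffG R s z‖ ≤ C * ‖z‖ ^ ((R : ℝ) - 2 - 4 * s) := by
  obtain ⟨C, hC, h⟩ := norm_eval_div_le (coeffNumerator R s) (k := 3 * s + 1)
    (natDegree_coeffNumerator_le R s) (β := (R : ℝ) - 2 - 4 * s) (by push_cast; ring)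
  refine ⟨C, hC, fun z hz => ?_⟩
  have := norm_sq_add_one_ge hz
  rw [coeffG_eq R s (norm_pos_iff.1 (by nlinarith))]
  exact h z hz

theorem norm_coeffGderiv_le (R s : ℕ) : ∃ C : ℝ, 0 ≤ C ∧ ∀ z : ℂ, 2 ≤ ‖z‖ →
    ‖coeffGderiv R s z‖ ≤ C * ‖z‖ ^ ((R : ℝ) - 3 - 4 * s) :=
  norm_eval_div_le _ (k := 3 * s + 2)
    ((natDegree_derivNumerator_le _ _).trans
      (Nat.add_le_add_right (natDegree_coeffNumerator_le R s) 1)) (by push_cast; ring)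

/-! ### The cut plane -/

theorem sq_add_one_mem_slitPlane {z : ℂ} (hz : z ∈ cutPlane) : z ^ 2 + 1 ∈ Complex.slitPlane := by
  rw [Complex.mem_slitPlane_iff]
  have h1 : (z ^ 2 + 1).re = z.re ^ 2 - z.im ^ 2 + 1 := by simp [sq]
  have h2 : (z ^ 2 + 1).im = 2 * (z.re * z.im) := by simp [sq]; ring
  rw [h1, h2]
  by_cases h : z.re = 0
  · left
    have him : |z.im| < 1 := hz.resolve_left (by simp [h])
    have := (sq_lt_one_iff_abs_lt_one z.im).2 him
    nlinarith
  · by_cases h' : z.im = 0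
    · left
      rw [h']
      have := sq_nonneg z.re
      nlinarith
    · right
      exact mul_ne_zero two_ne_zero (mul_ne_zero h h')

theorem sq_add_one_ne_zero {z : ℂ} (hz : z ∈ cutPlane) : z ^ 2 + 1 ≠ 0 :=
  Complex.slitPlane_ne_zero (sq_add_one_mem_slitPlane hz)

theorem isOpen_cutPlane : IsOpen cutPlane :=
  (isOpen_ne_fun Complex.continuous_re continuous_const).union
    (isOpen_lt (Complex.continuous_im.abs) continuous_const)

/-- The principal fourth root of `z²+1`. -/
noncomputable def quartRoot (z : ℂ) : ℂ := (z ^ 2 + 1) ^ (1 / 4 : ℂ)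

theorem quartRoot_pow_four (z : ℂ) : quartRoot z ^ 4 = z ^ 2 + 1 := by
  rw [quartRoot, ← Complex.cpow_nat_mul]
  norm_num

theorem quartRoot_sq (z : ℂ) : quartRoot z ^ 2 = (z ^ 2 + 1) ^ (1 / 2 : ℂ) := by
  rw [quartRoot, ← Complex.cpow_nat_mul]
  norm_num

theorem quartRoot_pow_ten (z : ℂ) : quartRoot z ^ 10 = (z ^ 2 + 1) ^ (5 / 2 : ℂ) := by
  rw [quartRoot, ← Complex.cpow_nat_mul]
  norm_num

theorem quartRoot_ne_zero {z : ℂ} (hz : z ∈ cutPlane) : quartRoot z ≠ 0 := by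
  intro h
  have := quartRoot_pow_four z
  rw [h] at this
  exact sq_add_one_ne_zero hz (by rw [← this]; norm_num)

theorem norm_quartRoot_pow_four (z : ℂ) : ‖quartRoot z‖ ^ 4 = ‖z ^ 2 + 1‖ := by
  rw [← norm_pow, quartRoot_pow_four]

theorem norm_quartRoot (z : ℂ) : ‖quartRoot z‖ = ‖z ^ 2 + 1‖ ^ (1 / 4 : ℝ) := by
  rw [← norm_quartRoot_pow_four, ← Real.rpow_natCast, ← Real.rpow_mul (norm_nonneg _)]
  norm_num

theorem hasDerivAt_quartRoot {z : ℂ} (hz : z ∈ cutPlane) :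
    HasDerivAt quartRoot (z / (2 * quartRoot z ^ 3)) z := by
  have h1 : HasDerivAt (fun z : ℂ => z ^ 2 + 1) (2 * z) z := by
    refine (((hasDerivAt_id' z).fun_pow 2).add_const 1).congr_deriv ?_
    simp
  have hr := quartRoot_ne_zero hz
  refine (h1.cpow_const (c := 1 / 4) (sq_add_one_mem_slitPlane hz)).congr_deriv ?_
  have : (z ^ 2 + 1) ^ ((1 / 4 : ℂ) - 1) = quartRoot z / quartRoot z ^ 4 := by
    rw [Complex.cpow_sub _ _ (sq_add_one_ne_zero hz), Complex.cpow_one, quartRoot_pow_four]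
    rfl
  rw [this]
  field_simp
  norm_num

theorem norm_quartRoot_le {z : ℂ} (hz : 2 ≤ ‖z‖) : ‖quartRoot z‖ ≤ 2 * ‖z‖ ^ (1 / 2 : ℝ) := by
  refine le_of_pow_le_pow_left₀ four_ne_zero (by positivity) ?_
  rw [norm_quartRoot_pow_four, mul_pow, ← Real.rpow_natCast (‖z‖ ^ (1 / 2 : ℝ)),
    ← Real.rpow_mul (norm_nonneg _), show (1 / 2 : ℝ) * (4 : ℕ) = (2 : ℕ) by norm_num,
    Real.rpow_natCast]
  have := norm_sq_add_one_le hz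
  nlinarith

theorem norm_quartRoot_ge {z : ℂ} (hz : 2 ≤ ‖z‖) : ‖z‖ ^ (1 / 2 : ℝ) / 2 ≤ ‖quartRoot z‖ := by
  refine le_of_pow_le_pow_left₀ four_ne_zero (by positivity) ?_
  rw [norm_quartRoot_pow_four, div_pow, ← Real.rpow_natCast (‖z‖ ^ (1 / 2 : ℝ)),
    ← Real.rpow_mul (norm_nonneg _), show (1 / 2 : ℝ) * (4 : ℕ) = (2 : ℕ) by norm_num,
    Real.rpow_natCast]
  have := norm_sq_add_one_ge hz
  nlinarith

/-- The derivative of `weightedG n R` in the cut plane. -/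
noncomputable def weightedGderiv (n R : ℕ) (z : ℂ) : ℂ :=
  z / (2 * quartRoot z ^ 3) * coeffG R n z + quartRoot z * coeffGderiv R n z

theorem weightedG_eq (n R : ℕ) (z : ℂ) : weightedG n R z = quartRoot z * coeffG R n z := rfl

theorem hasDerivAt_weightedG (n R : ℕ) {z : ℂ} (hz : z ∈ cutPlane) :
    HasDerivAt (weightedG n R) (weightedGderiv n R z) z :=
  (hasDerivAt_quartRoot hz).mul (hasDerivAt_coeffG R n (sq_add_one_ne_zero hz))

theorem continuousOn_quartRoot : ContinuousOn quartRoot cutPlane := fun _ hz =>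
  (hasDerivAt_quartRoot hz).continuousAt.continuousWithinAt

theorem continuousOn_coeffG (R s : ℕ) : ContinuousOn (coeffG R s) cutPlane := fun _ hz =>
  (hasDerivAt_coeffG R s (sq_add_one_ne_zero hz)).continuousAt.continuousWithinAt

theorem continuousOn_weightedG (n R : ℕ) : ContinuousOn (weightedG n R) cutPlane := fun _ hz =>
  (hasDerivAt_weightedG n R hz).continuousAt.continuousWithinAt

theorem continuousOn_deriv_weightedG (n R : ℕ) :
    ContinuousOn (deriv (weightedG n R)) cutPlane := by
  have h1 : ContinuousOn (weightedGderiv n R) cutPlane := by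
    have hd : ContinuousOn (coeffGderiv R n) cutPlane := fun _ hz =>
      (hasDerivAt_coeffGderiv R n (sq_add_one_ne_zero hz)).continuousAt.continuousWithinAt
    refine ((continuousOn_id.div (continuousOn_const.mul (continuousOn_quartRoot.pow 3))
      fun z hz => ?_).mul (continuousOn_coeffG R n)).add (continuousOn_quartRoot.mul hd)
    exact mul_ne_zero two_ne_zero (pow_ne_zero _ (quartRoot_ne_zero hz))
  exact h1.congr fun z hz => (hasDerivAt_weightedG n R hz).deriv

/-- The integrand of `pathOmega`. -/
noncomputable def omegaIntegrand (t : ℂ) : ℂ := (2 - 3 * t ^ 2) / (t ^ 2 + 1) ^ (5 / 2 : ℂ)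

theorem omegaIntegrand_eq (t : ℂ) : omegaIntegrand t = (2 - 3 * t ^ 2) / quartRoot t ^ 10 := by
  rw [quartRoot_pow_ten, omegaIntegrand]

theorem continuousOn_omegaIntegrand : ContinuousOn omegaIntegrand cutPlane := by
  rw [funext omegaIntegrand_eq]
  exact ContinuousOn.div (by fun_prop) (continuousOn_quartRoot.pow 10) fun z hz =>
    pow_ne_zero _ (quartRoot_ne_zero hz)

/-- Decay like `‖z‖^β` in the cut plane. -/
def HasDecay (h : ℂ → ℂ) (β : ℝ) : Prop :=
  ∃ C : ℝ, 0 ≤ C ∧ ∀ z ∈ cutPlane, 2 ≤ ‖z‖ → ‖h z‖ ≤ C * ‖z‖ ^ β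

theorem hasDecay_weightedG (n R : ℕ) :
    HasDecay (weightedG n R) ((R : ℝ) - 3 / 2 - 4 * n) := by
  obtain ⟨C, hC, h⟩ := norm_coeffG_le R n
  refine ⟨2 * C, by positivity, fun z _ hz => ?_⟩
  have hz0 : 0 < ‖z‖ := by linarith
  rw [weightedG_eq, norm_mul]
  calc _ ≤ (2 * ‖z‖ ^ (1 / 2 : ℝ)) * (C * ‖z‖ ^ ((R : ℝ) - 2 - 4 * n)) :=
        mul_le_mul (norm_quartRoot_le hz) (h z hz) (norm_nonneg _) (by positivity)
    _ = 2 * C * (‖z‖ ^ (1 / 2 : ℝ) * ‖z‖ ^ ((R : ℝ) - 2 - 4 * n)) := by ring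
    _ = _ := by rw [← Real.rpow_add hz0]; congr 2; ring

theorem hasDecay_deriv_weightedG (n R : ℕ) :
    HasDecay (deriv (weightedG n R)) ((R : ℝ) - 5 / 2 - 4 * n) := by
  obtain ⟨C, hC, h⟩ := norm_coeffG_le R n
  obtain ⟨D, hD, h'⟩ := norm_coeffGderiv_le R n
  refine ⟨4 * C + 2 * D, by positivity, fun z hzc hz => ?_⟩
  have hz0 : 0 < ‖z‖ := by linarith
  rw [(hasDerivAt_weightedG n R hzc).deriv, weightedGderiv]
  refine (norm_add_le _ _).trans ?_
  rw [norm_mul, norm_mul, norm_div, norm_mul, norm_pow, Complex.norm_ofNat]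
  have h1 : ‖z‖ / (2 * ‖quartRoot z‖ ^ 3) ≤ 4 * ‖z‖ ^ (-(1 / 2) : ℝ) := by
    have e : ‖z‖ = ‖z‖ ^ (-(1 / 2) : ℝ) * (‖z‖ ^ (1 / 2 : ℝ)) ^ 3 := by
      rw [← Real.rpow_natCast (‖z‖ ^ (1 / 2 : ℝ)), ← Real.rpow_mul hz0.le, ← Real.rpow_add hz0]
      norm_num
    have h2 : (‖z‖ ^ (1 / 2 : ℝ) / 2) ^ 3 ≤ ‖quartRoot z‖ ^ 3 := by
      gcongr; exact norm_quartRoot_ge hz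
    have h3 : 0 < (‖z‖ ^ (1 / 2 : ℝ) / 2) ^ 3 := by positivity
    rw [div_le_iff₀ (by linarith)]
    conv_lhs => rw [e]
    have h4 : 0 ≤ ‖z‖ ^ (-(1 / 2) : ℝ) := by positivity
    calc _ = ‖z‖ ^ (-(1 / 2) : ℝ) * (8 * (‖z‖ ^ (1 / 2 : ℝ) / 2) ^ 3) := by ring
      _ ≤ ‖z‖ ^ (-(1 / 2) : ℝ) * (8 * ‖quartRoot z‖ ^ 3) := by gcongr
      _ = _ := by ring
  have e1 : ‖z‖ ^ (-(1 / 2) : ℝ) * ‖z‖ ^ ((R : ℝ) - 2 - 4 * n) =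
      ‖z‖ ^ ((R : ℝ) - 5 / 2 - 4 * n) := by
    rw [← Real.rpow_add hz0]; congr 1; ring
  have e2 : ‖z‖ ^ (1 / 2 : ℝ) * ‖z‖ ^ ((R : ℝ) - 3 - 4 * n) =
      ‖z‖ ^ ((R : ℝ) - 5 / 2 - 4 * n) := by
    rw [← Real.rpow_add hz0]; congr 1; ring
  calc _ ≤ (4 * ‖z‖ ^ (-(1 / 2) : ℝ)) * (C * ‖z‖ ^ ((R : ℝ) - 2 - 4 * n)) +
        (2 * ‖z‖ ^ (1 / 2 : ℝ)) * (D * ‖z‖ ^ ((R : ℝ) - 3 - 4 * n)) :=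
        add_le_add (mul_le_mul h1 (h z hz) (norm_nonneg _) (by positivity))
          (mul_le_mul (norm_quartRoot_le hz) (h' z hz) (norm_nonneg _) (by positivity))
    _ = _ := by linear_combination (4 * C) * e1 + (2 * D) * e2

theorem hasDecay_omegaIntegrand : HasDecay omegaIntegrand (-3) := by
  refine ⟨4 * 2 ^ 10, by positivity, fun z _ hz => ?_⟩
  have hz0 : 0 < ‖z‖ := by linarith
  have h2 : (‖z‖ ^ (1 / 2 : ℝ) / 2) ^ 10 ≤ ‖quartRoot z‖ ^ 10 := by
    gcongr; exact norm_quartRoot_ge hz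
  have h3 : 0 < (‖z‖ ^ (1 / 2 : ℝ) / 2) ^ 10 := by positivity
  have e : (‖z‖ ^ (1 / 2 : ℝ)) ^ 10 = ‖z‖ ^ 5 := by
    rw [← Real.rpow_natCast, ← Real.rpow_mul hz0.le, ← Real.rpow_natCast]
    norm_num
  have h4 : ‖2 - 3 * z ^ 2‖ ≤ 4 * ‖z‖ ^ 2 := by
    refine (norm_sub_le _ _).trans ?_
    rw [norm_mul, norm_pow, Complex.norm_ofNat, Complex.norm_ofNat]
    nlinarith
  rw [omegaIntegrand_eq, norm_div, norm_pow, Real.rpow_neg hz0.le,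
    show (3 : ℝ) = (3 : ℕ) by norm_num, Real.rpow_natCast]
  calc _ ≤ 4 * ‖z‖ ^ 2 / (‖z‖ ^ (1 / 2 : ℝ) / 2) ^ 10 := by gcongr
    _ = _ := by rw [div_pow, e]; field_simp

/-- A principal square root off the cut has argument in (-π/2, π/2). This positivity is what makes
Im ξ increase upwards. -/
theorem quartRoot_sq_re_pos {z : ℂ} (hz : z ∈ cutPlane) : 0 < (quartRoot z ^ 2).re := by
  rw [quartRoot_sq, Complex.cpow_def_of_ne_zero (sq_add_one_ne_zero hz), Complex.exp_re]
  refine mul_pos (Real.exp_pos _) (Real.cos_pos_of_mem_Ioo ?_)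
  have h1 := Complex.neg_pi_lt_arg (z ^ 2 + 1)
  have h2 := (Complex.arg_le_pi (z ^ 2 + 1)).lt_of_ne
    (Complex.mem_slitPlane_iff_arg.1 (sq_add_one_mem_slitPlane hz)).1
  have : (Complex.log (z ^ 2 + 1) * (1 / 2)).im = Complex.arg (z ^ 2 + 1) / 2 := by
    rw [show (1 / 2 : ℂ) = ((1 / 2 : ℝ) : ℂ) by push_cast; ring, Complex.im_mul_ofReal,
      Complex.log_im]
    ring
  rw [this]
  constructor <;> linarith

/-- Compare imaginary parts in (√(z²+1))² = z²+1. Together with Re > 0 this fixes the sign of Im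
√(z²+1), hence how Im ξ varies horizontally. -/
theorem quartRoot_sq_re_mul_im (z : ℂ) :
    (quartRoot z ^ 2).re * (quartRoot z ^ 2).im = z.re * z.im := by
  have h : ((quartRoot z ^ 2) ^ 2).im = (z ^ 2 + 1).im := by
    rw [← quartRoot_pow_four]; ring_nf
  rw [sq (quartRoot z ^ 2), Complex.mul_im] at h
  simp only [sq z, Complex.add_im, Complex.mul_im, Complex.one_im] at h
  linarith

theorem quartRoot_conj {z : ℂ} (hz : z ∈ cutPlane) :
    quartRoot ((starRingEnd ℂ) z) = (starRingEnd ℂ) (quartRoot z) := by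
  have harg := (Complex.mem_slitPlane_iff_arg.1 (sq_add_one_mem_slitPlane hz)).1
  rw [quartRoot, quartRoot, show ((starRingEnd ℂ) z) ^ 2 + 1 = (starRingEnd ℂ) (z ^ 2 + 1) by simp]
  rw [Complex.conj_cpow _ _ harg, map_div₀, map_one, map_ofNat]

theorem conj_mem_cutPlane {z : ℂ} (hz : z ∈ cutPlane) : (starRingEnd ℂ) z ∈ cutPlane := by
  simpa [cutPlane] using hz

theorem xiBar_eq (z : ℂ) : xiBar z = z * quartRoot z ^ 2 / 2 +
    Complex.log (z + quartRoot z ^ 2) / 2 := by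
  rw [xiBar, quartRoot_sq]

/-- With w = √(z²+1) one has (z+w)(w-z) = 1. Were z+w = t real with t ≤ 0, the real part of the
product would be t(2 Re w - t) ≤ 0. -/
theorem add_quartRoot_sq_mem_slitPlane {z : ℂ} (hz : z ∈ cutPlane) :
    z + quartRoot z ^ 2 ∈ Complex.slitPlane := by
  have hre := quartRoot_sq_re_pos hz
  have h4 := quartRoot_pow_four z
  rw [Complex.mem_slitPlane_iff]
  by_contra! hcon
  obtain ⟨h1, h2⟩ := hcon
  set w := quartRoot z ^ 2 with hw
  have hmul : (z + w) * (w - z) = 1 := by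
    rw [hw]; linear_combination h4
  have hr := congrArg Complex.re hmul
  rw [Complex.mul_re, h2, zero_mul, sub_zero, Complex.one_re] at hr
  have h3 : (w - z).re = 2 * w.re - (z + w).re := by simp; ring
  rw [h3] at hr
  nlinarith

theorem hasDerivAt_xiBar {z : ℂ} (hz : z ∈ cutPlane) :
    HasDerivAt xiBar (quartRoot z ^ 2) z := by
  have hr := quartRoot_ne_zero hz
  have h4 := quartRoot_pow_four z
  have hw : HasDerivAt (fun z => quartRoot z ^ 2) (z / quartRoot z ^ 2) z := by
    refine ((hasDerivAt_quartRoot hz).fun_pow 2).congr_deriv ?_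
    simp; field_simp
  have hs := add_quartRoot_sq_mem_slitPlane hz
  have hs0 := Complex.slitPlane_ne_zero hs
  rw [funext xiBar_eq]
  refine ((((hasDerivAt_id' z).fun_mul hw).div_const 2).fun_add
    ((((hasDerivAt_id' z).fun_add hw).clog hs).div_const 2)).congr_deriv ?_
  have e : (1 + z / quartRoot z ^ 2) / (z + quartRoot z ^ 2) = 1 / quartRoot z ^ 2 := by
    field_simp; ring
  rw [e]
  field_simp
  linear_combination -h4

theorem continuousOn_xiBar : ContinuousOn xiBar cutPlane := fun _ hz =>
  (hasDerivAt_xiBar hz).continuousAt.continuousWithinAt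

theorem xiBar_conj {z : ℂ} (hz : z ∈ cutPlane) :
    xiBar ((starRingEnd ℂ) z) = (starRingEnd ℂ) (xiBar z) := by
  have hs := add_quartRoot_sq_mem_slitPlane hz
  rw [xiBar_eq, xiBar_eq, quartRoot_conj hz]
  have : (starRingEnd ℂ) z + (starRingEnd ℂ) (quartRoot z) ^ 2 =
      (starRingEnd ℂ) (z + quartRoot z ^ 2) := by simp
  rw [this, Complex.log_conj _ (Complex.mem_slitPlane_iff_arg.1 hs).1]
  simp only [map_add, map_div₀, map_mul, map_pow, map_ofNat]

/-! ### Liouville transform -/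

/-- If `e'' + u²(z²+1)e = c(z²+1)G` then `W = (z²+1)^{1/4} e` satisfies
`W_ξξ + u²W = ψW + c (z²+1)^{1/4} G`; this is `W_ξ`. -/
noncomputable def liouvilleDeriv (e e' : ℂ → ℂ) (z : ℂ) : ℂ :=
  e' z / quartRoot z + z * e z / (2 * quartRoot z ^ 5)

theorem hasDerivAt_liouville {e e' : ℂ → ℂ} {z : ℂ} (hz : z ∈ cutPlane)
    (he : HasDerivAt e (e' z) z) :
    HasDerivAt (fun z => quartRoot z * e z) (quartRoot z ^ 2 * liouvilleDeriv e e' z) z := by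
  have hr := quartRoot_ne_zero hz
  refine ((hasDerivAt_quartRoot hz).fun_mul he).congr_deriv ?_
  rw [liouvilleDeriv]
  field_simp
  ring

/-- Since dξ = (z²+1)^{1/2} dz, the coefficient u²(z²+1) becomes the constant u². The price is the
potential ψ with (z²+1)^{1/2} ψ = Ω-integrand/4, which explains the integrand of `pathOmega`. -/
theorem hasDerivAt_liouvilleDeriv {e e' : ℂ → ℂ} {z u c g : ℂ} (hz : z ∈ cutPlane)
    (he : HasDerivAt e (e' z) z)
    (he' : HasDerivAt e' (-(u ^ 2 * (z ^ 2 + 1) * e z) + c * (z ^ 2 + 1) * g) z) :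
    HasDerivAt (liouvilleDeriv e e')
      (quartRoot z ^ 2 * (-(u ^ 2 * (quartRoot z * e z)) + c * (quartRoot z * g)) +
        omegaIntegrand z / 4 * (quartRoot z * e z)) z := by
  have hr := quartRoot_ne_zero hz
  have hq := hasDerivAt_quartRoot hz
  have h4 := quartRoot_pow_four z
  refine ((he'.fun_div hq hr).fun_add (((hasDerivAt_id' z).fun_mul he).fun_div
    ((hq.fun_pow 5).const_mul 2) (mul_ne_zero two_ne_zero (pow_ne_zero 5 hr)))).congr_deriv ?_
  rw [omegaIntegrand_eq, ← h4]
  have hz2 : z ^ 2 = quartRoot z ^ 4 - 1 := by rw [h4]; ring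
  simp only [Nat.cast_ofNat, Nat.add_one_sub_one]
  rw [show (2 - 3 * z ^ 2 : ℂ) = 2 * quartRoot z ^ 4 - 5 * z ^ 2 by rw [h4]; ring]
  field_simp
  ring

/-! ### The estimate along an admissible path -/

theorem IsR2Chain.exists_finite_hasDerivAt {γ : ℝ → ℂ} (h : IsR2Chain γ) :
    ∃ S : Set ℝ, S.Finite ∧ ∀ τ ∉ S, HasDerivAt γ (deriv γ τ) τ := by
  obtain ⟨-, S, hS, h⟩ := h
  refine ⟨S, hS, fun τ hτ => ?_⟩
  have ho : Sᶜ ∈ 𝓝 τ := hS.isClosed.isOpen_compl.mem_nhds hτ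
  obtain ⟨δ, hδ, hball⟩ := Metric.mem_nhds_iff.1 ho
  rw [Real.ball_eq_Ioo] at hball
  have hc := (h (τ - δ) (τ + δ) (by linarith) (Set.disjoint_left.2 fun x hx => hball hx)).1
  have hd := (hc.differentiableOn (by norm_num)).differentiableAt
    (Icc_mem_nhds (by linarith : τ - δ < τ) (by linarith : τ < τ + δ))
  exact hd.hasDerivAt

theorem integrable_of_pathIntegralAbs {γ : ℝ → ℂ} {h : ℂ → ℂ} (hγ : Continuous γ)
    (hγc : ∀ τ, γ τ ∈ cutPlane) (hh : ContinuousOn h cutPlane) (hfin : pathIntegralAbs γ h ≠ ⊤) :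
    Integrable (fun τ => h (γ τ) * deriv γ τ) ∧
      ∫ τ, ‖h (γ τ) * deriv γ τ‖ = (pathIntegralAbs γ h).toReal := by
  have hm : AEStronglyMeasurable (fun τ => h (γ τ) * deriv γ τ) volume :=
    ((hh.comp_continuous hγ hγc).measurable.mul (measurable_deriv γ)).aestronglyMeasurable
  have e : pathIntegralAbs γ h = ∫⁻ τ, ‖h (γ τ) * deriv γ τ‖ₑ := by
    simp only [pathIntegralAbs, enorm_mul]
  refine ⟨⟨hm, ?_⟩, ?_⟩
  · rw [hasFiniteIntegral_iff_enorm, ← e]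
    exact hfin.lt_top
  · rw [e, integral_norm_eq_lintegral_enorm hm]

/-- One half of the variation-of-parameters estimate. -/
theorem liouville_half_estimate {e e' : ℂ → ℂ} {u : ℝ} {c k : ℂ} {n R : ℕ} {γ : ℝ → ℂ}
    (hγ : IsPath03 γ) (hk0 : k ≠ 0) (hk : k ^ 2 = -(u : ℂ) ^ 2)
    (he : ∀ z ∈ cutPlane, HasDerivAt e (e' z) z)
    (he' : ∀ z ∈ cutPlane, HasDerivAt e'
      (-((u : ℂ) ^ 2 * (z ^ 2 + 1) * e z) + c * (z ^ 2 + 1) * coeffG R n z) z)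
    (hV : pathIntegralAbs γ (deriv (weightedG n R)) ≠ ⊤)
    (hΩ : pathIntegralAbs γ omegaIntegrand ≠ ⊤) {M : ℝ}
    (hM : ∀ τ, ‖quartRoot (γ τ) * e (γ τ)‖ ≤ M) {a b τ₀ : ℝ} (hab : a ≤ b)
    (hexp : ∀ τ ∈ Set.Icc a b, ‖Complex.exp (k * (xiBar (γ τ) - xiBar (γ τ₀)))‖ ≤ 1) :
    ‖Complex.exp (k * (xiBar (γ b) - xiBar (γ τ₀))) * (liouvilleDeriv e e' (γ b) -
        k * (quartRoot (γ b) * e (γ b)) - c / k * weightedG n R (γ b)) -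
      Complex.exp (k * (xiBar (γ a) - xiBar (γ τ₀))) * (liouvilleDeriv e e' (γ a) -
        k * (quartRoot (γ a) * e (γ a)) - c / k * weightedG n R (γ a))‖ ≤
      ∫ τ in Set.Ioc a b, (M / 4 * ‖omegaIntegrand (γ τ) * deriv γ τ‖ +
        ‖c / k‖ * ‖deriv (weightedG n R) (γ τ) * deriv γ τ‖) := by
  have hc := hγ.chain.1
  have hmem := hγ.mem_cutPlane
  obtain ⟨S, hS, hder⟩ := hγ.chain.exists_finite_hasDerivAt
  have iV := (integrable_of_pathIntegralAbs hc hmem (continuousOn_deriv_weightedG n R) hV).1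
  have iΩ := (integrable_of_pathIntegralAbs hc hmem continuousOn_omegaIntegrand hΩ).1
  have cX : Continuous fun τ => xiBar (γ τ) := continuousOn_xiBar.comp_continuous hc hmem
  have cG : Continuous fun τ => weightedG n R (γ τ) :=
    (continuousOn_weightedG n R).comp_continuous hc hmem
  have cW : Continuous fun τ => quartRoot (γ τ) * e (γ τ) :=
    ContinuousOn.comp_continuous (f := γ) (g := fun z => quartRoot z * e z) (s := cutPlane)
      (fun z hz => (hasDerivAt_liouville hz (he z hz)).continuousAt.continuousWithinAt) hc hmem
  have cD : Continuous fun τ => liouvilleDeriv e e' (γ τ) :=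
    ContinuousOn.comp_continuous (f := γ) (s := cutPlane)
      (fun z hz => (hasDerivAt_liouvilleDeriv hz (he z hz) (he' z hz)).continuousAt.continuousWithinAt)
      hc hmem
  set E : ℝ → ℂ := fun τ => Complex.exp (k * (xiBar (γ τ) - xiBar (γ τ₀))) with hE
  have cE : Continuous E := by fun_prop
  -- The term c/k·G integrates the forcing by parts in advance: with k² = -u² the terms in u²W and
  -- in the undifferentiated forcing cancel in Φ', leaving only the Ω-integrand and the derivative
  -- of `weightedG`.
  set Φ : ℝ → ℂ := fun τ => E τ * (liouvilleDeriv e e' (γ τ) -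
        k * (quartRoot (γ τ) * e (γ τ)) - c / k * weightedG n R (γ τ)) with hΦ
  set φ : ℝ → ℂ := fun τ => E τ * ((quartRoot (γ τ) * e (γ τ)) / 4 *
    (omegaIntegrand (γ τ) * deriv γ τ) -
      c / k * (deriv (weightedG n R) (γ τ) * deriv γ τ)) with hφ
  have cΦ : Continuous Φ := by fun_prop
  have dΦ : ∀ τ ∈ Set.Ioo (min a b) (max a b) \ S, HasDerivAt Φ (φ τ) τ := by
    intro τ hτ
    have dγ := hder τ hτ.2
    have hz := hmem τ
    have dE : HasDerivAt E (E τ * (k * (quartRoot (γ τ) ^ 2 * deriv γ τ))) τ :=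
      ((((hasDerivAt_xiBar hz).comp τ dγ).sub_const _).const_mul k).cexp
    have dD := (hasDerivAt_liouvilleDeriv hz (he _ hz) (he' _ hz)).comp τ dγ
    have dW := (hasDerivAt_liouville hz (he _ hz)).comp τ dγ
    have dG := (hasDerivAt_weightedG n R hz).comp τ dγ
    refine (dE.fun_mul ((dD.fun_sub (dW.const_mul k)).fun_sub (dG.const_mul (c / k)))).congr_deriv ?_
    simp only [hφ, Function.comp_apply]
    rw [(hasDerivAt_weightedG n R hz).deriv, weightedG_eq]
    have hck : c / k * k = c := div_mul_cancel₀ c hk0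
    linear_combination (-E τ * quartRoot (γ τ) ^ 2 * deriv γ τ * (quartRoot (γ τ) * e (γ τ))) * hk
      - E τ * quartRoot (γ τ) ^ 2 * deriv γ τ * quartRoot (γ τ) * coeffG R n (γ τ) * hck
  have hφb : ∀ τ ∈ Set.Icc a b, ‖φ τ‖ ≤ M / 4 * ‖omegaIntegrand (γ τ) * deriv γ τ‖ +
        ‖c / k‖ * ‖deriv (weightedG n R) (γ τ) * deriv γ τ‖ := by
    intro τ hτ
    rw [hφ, norm_mul]
    refine (mul_le_of_le_one_left (norm_nonneg _) (hexp τ hτ)).trans ((norm_sub_le _ _).trans ?_)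
    rw [norm_mul _ (omegaIntegrand (γ τ) * deriv γ τ), norm_mul (c / k), norm_div,
      Complex.norm_ofNat]
    gcongr
    exact hM τ
  have ih : Integrable (fun τ => M / 4 * ‖omegaIntegrand (γ τ) * deriv γ τ‖ +
        ‖c / k‖ * ‖deriv (weightedG n R) (γ τ) * deriv γ τ‖) :=
    (iΩ.norm.const_mul _).add (iV.norm.const_mul _)
  have iφ : IntegrableOn φ (Set.Ioc a b) := by
    refine Integrable.mono' ih.integrableOn ?_ ?_
    · refine AEStronglyMeasurable.restrict ?_
      refine cE.aestronglyMeasurable.mul (AEStronglyMeasurable.sub ?_ ?_)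
      · exact ((cW.div_const 4).aestronglyMeasurable).mul iΩ.aestronglyMeasurable
      · exact aestronglyMeasurable_const.mul iV.aestronglyMeasurable
    · filter_upwards [ae_restrict_mem measurableSet_Ioc] with τ hτ using
        hφb τ (Set.Ioc_subset_Icc_self hτ)
  have key := integral_eq_of_hasDerivAt_off_countable Φ φ hS.countable cΦ.continuousOn dΦ
    ((intervalIntegrable_iff_integrableOn_Ioc_of_le hab).2 iφ)
  rw [← key, intervalIntegral.integral_of_le hab]
  refine norm_integral_le_of_norm_le ih.integrableOn ?_
  filter_upwards [ae_restrict_mem measurableSet_Ioc] with τ hτ using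
    hφb τ (Set.Ioc_subset_Icc_self hτ)

theorem norm_exp_I_mul_le_one {u : ℝ} {w : ℂ} (h : 0 ≤ u * w.im) :
    ‖Complex.exp (Complex.I * u * w)‖ ≤ 1 := by
  rw [Complex.norm_exp, Real.exp_le_one_iff]
  simp
  linarith

/-- The half estimate is used with k = iu from the initial end up to τ₀ and with k = -iu from τ₀ to
the final end; monotonicity of Im ξ keeps both exponentials at most 1. The two half integrals add up
to integrals over the whole path. -/
theorem liouville_estimate {e e' : ℂ → ℂ} {u : ℝ} (hu : 0 < u) {c : ℂ} {n R : ℕ} {γ : ℝ → ℂ}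
    (hγ : IsPath03 γ)
    (he : ∀ z ∈ cutPlane, HasDerivAt e (e' z) z)
    (he' : ∀ z ∈ cutPlane, HasDerivAt e'
      (-((u : ℂ) ^ 2 * (z ^ 2 + 1) * e z) + c * (z ^ 2 + 1) * coeffG R n z) z)
    (hlim : ∀ l ∈ ({atBot, atTop} : Set (Filter ℝ)),
      Tendsto (fun τ => quartRoot (γ τ) * e (γ τ)) l (𝓝 0) ∧
      Tendsto (fun τ => liouvilleDeriv e e' (γ τ)) l (𝓝 0) ∧
      Tendsto (fun τ => weightedG n R (γ τ)) l (𝓝 0))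
    (hV : pathIntegralAbs γ (deriv (weightedG n R)) ≠ ⊤)
    (hΩ : pathIntegralAbs γ omegaIntegrand ≠ ⊤) {M : ℝ}
    (hM : ∀ τ, ‖quartRoot (γ τ) * e (γ τ)‖ ≤ M) (τ₀ : ℝ) :
    ‖quartRoot (γ τ₀) * e (γ τ₀)‖ ≤ ‖c‖ / u ^ 2 * (‖weightedG n R (γ τ₀)‖ +
      (pathIntegralAbs γ (deriv (weightedG n R))).toReal / 2) +
      M * (pathIntegralAbs γ omegaIntegrand).toReal / (8 * u) := by
  have hc := hγ.chain.1
  have hmem := hγ.mem_cutPlane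
  have huC : (u : ℂ) ≠ 0 := by exact_mod_cast hu.ne'
  obtain ⟨iV, eV⟩ := integrable_of_pathIntegralAbs hc hmem (continuousOn_deriv_weightedG n R) hV
  obtain ⟨iΩ, eΩ⟩ := integrable_of_pathIntegralAbs hc hmem continuousOn_omegaIntegrand hΩ
  have hk1 : (Complex.I * u) ≠ 0 := mul_ne_zero Complex.I_ne_zero huC
  have hk2 : (Complex.I * ((-u : ℝ) : ℂ)) ≠ 0 :=
    mul_ne_zero Complex.I_ne_zero (by exact_mod_cast (neg_ne_zero.2 hu.ne'))
  have hn1 : ‖c / (Complex.I * u)‖ = ‖c‖ / u := by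
    rw [norm_div, norm_mul, Complex.norm_I, one_mul, Complex.norm_real, Real.norm_of_nonneg hu.le]
  have hn2 : ‖c / (Complex.I * ((-u : ℝ) : ℂ))‖ = ‖c‖ / u := by
    rw [norm_div, norm_mul, Complex.norm_I, one_mul, Complex.norm_real, norm_neg,
      Real.norm_of_nonneg hu.le]
  set h : ℝ → ℝ := fun τ => M / 4 * ‖omegaIntegrand (γ τ) * deriv γ τ‖ +
        ‖c‖ / u * ‖deriv (weightedG n R) (γ τ) * deriv γ τ‖ with hh
  have hM0 : 0 ≤ M := (norm_nonneg _).trans (hM 0)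
  have h0 : ∀ τ, 0 ≤ h τ := fun τ => by positivity
  have ih : Integrable h := (iΩ.norm.const_mul _).add (iV.norm.const_mul _)
  let Φ : ℂ → ℝ → ℂ := fun k τ => Complex.exp (k * (xiBar (γ τ) - xiBar (γ τ₀))) *
    (liouvilleDeriv e e' (γ τ) - k * (quartRoot (γ τ) * e (γ τ)) - c / k * weightedG n R (γ τ))
  have hΦ : ∀ (k : ℂ) (l : Filter ℝ), l ∈ ({atBot, atTop} : Set (Filter ℝ)) →
      (∀ᶠ τ in l, ‖Complex.exp (k * (xiBar (γ τ) - xiBar (γ τ₀)))‖ ≤ 1) →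
      Tendsto (Φ k) l (𝓝 0) := by
    intro k l hl hev
    obtain ⟨l1, l2, l3⟩ := hlim l hl
    have l4 := (l2.sub (l1.const_mul k)).sub (l3.const_mul (c / k))
    simp only [mul_zero, sub_zero] at l4
    refine squeeze_zero_norm' ?_ (tendsto_zero_iff_norm_tendsto_zero.1 l4)
    filter_upwards [hev] with τ hτ
    rw [norm_mul]
    exact mul_le_of_le_one_left (norm_nonneg _) hτ
  have b1 : ‖Φ (Complex.I * u) τ₀‖ ≤ ∫ τ in Set.Iic τ₀, h τ := by
    have hexp : ∀ τ ≤ τ₀, ‖Complex.exp (Complex.I * u * (xiBar (γ τ) - xiBar (γ τ₀)))‖ ≤ 1 := by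
      intro τ hτ
      refine norm_exp_I_mul_le_one (mul_nonneg hu.le ?_)
      rw [Complex.sub_im, sub_nonneg]
      exact hγ.monotonic hτ
    have hl := hΦ (Complex.I * u) atBot (by simp)
      ((eventually_le_atBot τ₀).mono fun τ hτ => hexp τ hτ)
    have hl' := (hl.const_sub (Φ (Complex.I * u) τ₀)).norm
    rw [sub_zero] at hl'
    refine le_of_tendsto hl' ((eventually_le_atBot τ₀).mono fun a ha => ?_)
    refine (liouville_half_estimate hγ hk1 (by rw [mul_pow, Complex.I_sq]; ring) he he' hV hΩ hM ha
      (fun τ hτ => hexp τ hτ.2)).trans ?_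
    rw [hn1]
    exact setIntegral_mono_set ih.integrableOn (Eventually.of_forall h0)
      (Set.Ioc_subset_Iic_self.eventuallyLE)
  have b2 : ‖Φ (Complex.I * ((-u : ℝ) : ℂ)) τ₀‖ ≤ ∫ τ in Set.Ioi τ₀, h τ := by
    have hexp : ∀ τ, τ₀ ≤ τ →
        ‖Complex.exp (Complex.I * ((-u : ℝ) : ℂ) * (xiBar (γ τ) - xiBar (γ τ₀)))‖ ≤ 1 := by
      intro τ hτ
      refine norm_exp_I_mul_le_one ?_
      rw [Complex.sub_im]
      have : (xiBar (γ τ)).im ≤ (xiBar (γ τ₀)).im := hγ.monotonic hτ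
      nlinarith
    have hl := hΦ (Complex.I * ((-u : ℝ) : ℂ)) atTop (by simp)
      ((eventually_ge_atTop τ₀).mono fun τ hτ => hexp τ hτ)
    have hl' := (hl.sub_const (Φ (Complex.I * ((-u : ℝ) : ℂ)) τ₀)).norm
    rw [zero_sub, norm_neg] at hl'
    refine le_of_tendsto hl' ((eventually_ge_atTop τ₀).mono fun b hb => ?_)
    refine (liouville_half_estimate hγ hk2 (by rw [mul_pow, Complex.I_sq]; push_cast; ring) he he'
      hV hΩ hM hb (fun τ hτ => hexp τ hτ.1)).trans ?_
    rw [hn2]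
    exact setIntegral_mono_set ih.integrableOn (Eventually.of_forall h0)
      (Set.Ioc_subset_Ioi_self.eventuallyLE)
  have hsum : (∫ τ in Set.Iic τ₀, h τ) + ∫ τ in Set.Ioi τ₀, h τ =
      M / 4 * (pathIntegralAbs γ omegaIntegrand).toReal +
        ‖c‖ / u * (pathIntegralAbs γ (deriv (weightedG n R))).toReal := by
    rw [intervalIntegral.integral_Iic_add_Ioi ih.integrableOn ih.integrableOn, ← eΩ, ← eV,
      ← integral_const_mul, ← integral_const_mul]
    exact integral_add (iΩ.norm.const_mul _) (iV.norm.const_mul _)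
  -- The unknown W_ξ occurs in both identities with coefficient 1 and drops out of their difference.
  have hdiff : 2 * Complex.I * u * (quartRoot (γ τ₀) * e (γ τ₀)) =
      Φ (Complex.I * ((-u : ℝ) : ℂ)) τ₀ - Φ (Complex.I * u) τ₀ -
        2 * (c / (Complex.I * u)) * weightedG n R (γ τ₀) := by
    simp only [Φ, sub_self, mul_zero, Complex.exp_zero, one_mul, Complex.ofReal_neg, mul_neg,
      div_neg]
    ring
  have hn := congrArg norm hdiff
  rw [norm_mul, norm_mul, norm_mul, Complex.norm_ofNat, Complex.norm_I, Complex.norm_real,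
    Real.norm_of_nonneg hu.le] at hn
  have hfin : 2 * u * ‖quartRoot (γ τ₀) * e (γ τ₀)‖ ≤
      M / 4 * (pathIntegralAbs γ omegaIntegrand).toReal +
        ‖c‖ / u * (pathIntegralAbs γ (deriv (weightedG n R))).toReal +
        2 * (‖c‖ / u) * ‖weightedG n R (γ τ₀)‖ := by
    rw [← hsum]
    calc _ = _ := by rw [← hn]; ring
      _ ≤ (‖Φ (Complex.I * ((-u : ℝ) : ℂ)) τ₀‖ + ‖Φ (Complex.I * u) τ₀‖) +
          ‖2 * (c / (Complex.I * u)) * weightedG n R (γ τ₀)‖ :=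
          (norm_sub_le _ _).trans (add_le_add_left (norm_sub_le _ _) _)
      _ ≤ _ := by
          have : ‖2 * (c / (Complex.I * u)) * weightedG n R (γ τ₀)‖ =
              2 * (‖c‖ / u) * ‖weightedG n R (γ τ₀)‖ := by
            rw [norm_mul, norm_mul, Complex.norm_ofNat, hn1]
          rw [this]
          linarith
  have : ‖quartRoot (γ τ₀) * e (γ τ₀)‖ ≤ (M / 4 * (pathIntegralAbs γ omegaIntegrand).toReal +
        ‖c‖ / u * (pathIntegralAbs γ (deriv (weightedG n R))).toReal +
        2 * (‖c‖ / u) * ‖weightedG n R (γ τ₀)‖) / (2 * u) := by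
    rw [le_div_iff₀ (by positivity)]
    linarith
  refine this.trans (le_of_eq ?_)
  field_simp
  ring

theorem exists_bound_of_tendsto {W : ℝ → ℂ} (hW : Continuous W) (h1 : Tendsto W atBot (𝓝 0))
    (h2 : Tendsto W atTop (𝓝 0)) : ∃ M : ℝ, ∀ τ, ‖W τ‖ ≤ M := by
  obtain ⟨a, ha⟩ := eventually_atBot.1 (h1.norm.eventually (ge_mem_nhds (by simp : ‖(0 : ℂ)‖ < 1)))
  obtain ⟨b, hb⟩ := eventually_atTop.1 (h2.norm.eventually (ge_mem_nhds (by simp : ‖(0 : ℂ)‖ < 1)))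
  obtain ⟨C, hC⟩ := (isCompact_Icc (a := a) (b := b)).exists_bound_of_continuousOn hW.continuousOn
  refine ⟨max 1 C, fun τ => ?_⟩
  rcases le_total τ a with h | h
  · exact (ha τ h).trans (le_max_left _ _)
  · rcases le_total b τ with h' | h'
    · exact (hb τ h').trans (le_max_left _ _)
    · exact (hC τ ⟨h, h'⟩).trans (le_max_right _ _)

/-- Taking the supremum M of |W| over the path gives M ≤ |c|L/u² + MΩ/(8u). M is finite because W
vanishes at both ends, so Ω < 8u permits solving for M; inserting this once more at the given point
keeps the sharper leading term there. -/
theorem norm_le_errorBound {e e' : ℂ → ℂ} {u : ℝ} (hu : 0 < u) {c : ℂ} {n R : ℕ}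
    (hcn : ‖c‖ = 1 / u ^ (2 * n)) {γ : ℝ → ℂ}
    (hγ : IsPath03 γ)
    (he : ∀ z ∈ cutPlane, HasDerivAt e (e' z) z)
    (he' : ∀ z ∈ cutPlane, HasDerivAt e'
      (-((u : ℂ) ^ 2 * (z ^ 2 + 1) * e z) + c * (z ^ 2 + 1) * coeffG R n z) z)
    (hlim : ∀ l ∈ ({atBot, atTop} : Set (Filter ℝ)),
      Tendsto (fun τ => quartRoot (γ τ) * e (γ τ)) l (𝓝 0) ∧
      Tendsto (fun τ => liouvilleDeriv e e' (γ τ)) l (𝓝 0) ∧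
      Tendsto (fun τ => weightedG n R (γ τ)) l (𝓝 0))
    (hL : pathL n R γ ≠ ⊤) (hΩ : pathOmega γ < ENNReal.ofReal (8 * u)) {z : ℂ}
    (hz : z ∈ Set.range γ) : ‖e z‖ ≤ errorBound n R u γ z := by
  obtain ⟨τ₀, rfl⟩ := hz
  have hc := hγ.chain.1
  have hmem := hγ.mem_cutPlane
  have hV : pathVar n R γ ≠ ⊤ := by
    intro h
    apply hL
    rw [pathL, h, ENNReal.top_div_of_ne_top (by norm_num), add_top]
  have hsup : (⨆ τ : ℝ, ‖weightedG n R (γ τ)‖ₑ) ≠ ⊤ := by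
    intro h
    apply hL
    rw [pathL, h, top_add]
  have hΩ' : pathOmega γ ≠ ⊤ := (hΩ.trans ENNReal.ofReal_lt_top).ne
  have hLr : (pathL n R γ).toReal = (⨆ τ : ℝ, ‖weightedG n R (γ τ)‖ₑ).toReal +
      (pathVar n R γ).toReal / 2 := by
    rw [pathL, ENNReal.toReal_add hsup (ENNReal.div_ne_top hV (by norm_num)), ENNReal.toReal_div]
    simp
  have hg : ∀ τ, ‖weightedG n R (γ τ)‖ ≤ (⨆ τ : ℝ, ‖weightedG n R (γ τ)‖ₑ).toReal := by
    intro τ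
    rw [← toReal_enorm]
    exact ENNReal.toReal_mono hsup (le_iSup (fun τ : ℝ => ‖weightedG n R (γ τ)‖ₑ) τ)
  set V := (pathVar n R γ).toReal with hVdef
  set Ω := (pathOmega γ).toReal with hΩdef
  set L := (pathL n R γ).toReal with hLdef
  have hΩu : Ω < 8 * u := by
    rw [hΩdef, ← ENNReal.toReal_ofReal (by positivity : 0 ≤ 8 * u)]
    exact ENNReal.toReal_strict_mono ENNReal.ofReal_ne_top hΩ
  have hΩ0 : 0 ≤ Ω := ENNReal.toReal_nonneg
  have est : ∀ M : ℝ, (∀ τ, ‖quartRoot (γ τ) * e (γ τ)‖ ≤ M) → ∀ τ,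
      ‖quartRoot (γ τ) * e (γ τ)‖ ≤ ‖c‖ / u ^ 2 * (‖weightedG n R (γ τ)‖ + V / 2) +
        M * Ω / (8 * u) := fun M hM τ =>
    liouville_estimate hu hγ he he' hlim hV hΩ' hM τ
  have cW : Continuous fun τ => quartRoot (γ τ) * e (γ τ) :=
    ContinuousOn.comp_continuous (f := γ) (g := fun z => quartRoot z * e z) (s := cutPlane)
      (fun z hz => (hasDerivAt_liouville hz (he z hz)).continuousAt.continuousWithinAt) hc hmem
  obtain ⟨M₀, hM₀⟩ := exists_bound_of_tendsto cW (hlim atBot (by simp)).1 (hlim atTop (by simp)).1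
  have hbdd : BddAbove (Set.range fun τ => ‖quartRoot (γ τ) * e (γ τ)‖) :=
    ⟨M₀, by rintro _ ⟨τ, rfl⟩; exact hM₀ τ⟩
  set M := ⨆ τ, ‖quartRoot (γ τ) * e (γ τ)‖ with hMdef
  have hM : ∀ τ, ‖quartRoot (γ τ) * e (γ τ)‖ ≤ M := fun τ => le_ciSup hbdd τ
  have hM' : M ≤ ‖c‖ / u ^ 2 * L + M * Ω / (8 * u) := by
    refine ciSup_le fun τ => (est M hM τ).trans ?_
    rw [hLr]
    have := hg τ
    gcongr
  have hq : 0 < 1 - Ω / (8 * u) := by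
    rw [sub_pos, div_lt_one (by positivity)]
    exact hΩu
  have hM2 : M ≤ ‖c‖ / u ^ 2 * L * (1 - Ω / (8 * u))⁻¹ := by
    rw [← div_eq_mul_inv, le_div_iff₀ hq]
    have : M * Ω / (8 * u) = M * (Ω / (8 * u)) := by ring
    linarith
  have h1 := est M hM τ₀
  have hr : 0 < ‖quartRoot (γ τ₀)‖ := norm_pos_iff.2 (quartRoot_ne_zero (hmem τ₀))
  rw [norm_mul] at h1
  have h2 : ‖e (γ τ₀)‖ ≤ (‖c‖ / u ^ 2 * (‖weightedG n R (γ τ₀)‖ + V / 2) +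
        (‖c‖ / u ^ 2 * L * (1 - Ω / (8 * u))⁻¹) * Ω / (8 * u)) / ‖quartRoot (γ τ₀)‖ := by
    rw [le_div_iff₀ hr, mul_comm]
    refine h1.trans ?_
    gcongr
  refine h2.trans (le_of_eq ?_)
  rw [errorBound, ← norm_quartRoot, hcn, weightedG_eq, norm_mul, ← hVdef, ← hΩdef, ← hLdef,
    show 1 / (8 * u) * Ω = Ω / (8 * u) by ring]
  generalize (1 - Ω / (8 * u))⁻¹ = q
  field_simp
  ring

/-! ### Asymptotics in sectors -/

/-- A bound by `C ‖z‖^β` near infinity in every sector `κ ‖z‖ ≤ Re z` with `κ > 1/2`. -/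
def SectorBound (h : ℂ → ℂ) (β : ℝ) : Prop :=
  ∀ κ : ℝ, 1 / 2 < κ → κ < 1 → ∃ C ρ : ℝ, 0 ≤ C ∧ 2 ≤ ρ ∧
    ∀ z : ℂ, ρ ≤ ‖z‖ → κ * ‖z‖ ≤ z.re → ‖h z‖ ≤ C * ‖z‖ ^ β

theorem SectorBound.mono {h : ℂ → ℂ} {β β' : ℝ} (hh : SectorBound h β) (hβ : β ≤ β') :
    SectorBound h β' := by
  intro κ h1 h2
  obtain ⟨C, ρ, hC, hρ, h⟩ := hh κ h1 h2
  refine ⟨C, ρ, hC, hρ, fun z hz hs => (h z hz hs).trans ?_⟩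
  gcongr
  linarith

theorem SectorBound.mul {g h : ℂ → ℂ} {α β : ℝ} (hg : SectorBound g α) (hh : SectorBound h β) :
    SectorBound (fun z => g z * h z) (α + β) := by
  intro κ h1 h2
  obtain ⟨C, ρ, hC, hρ, h⟩ := hg κ h1 h2
  obtain ⟨C', ρ', hC', hρ', h'⟩ := hh κ h1 h2
  refine ⟨C * C', max ρ ρ', by positivity, hρ.trans (le_max_left _ _), fun z hz hs => ?_⟩
  have hz0 : 0 < ‖z‖ := by linarith [le_max_left ρ ρ']
  have a1 := h z ((le_max_left _ _).trans hz) hs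
  have a2 := h' z ((le_max_right _ _).trans hz) hs
  rw [norm_mul, Real.rpow_add hz0]
  calc _ ≤ (C * ‖z‖ ^ α) * (C' * ‖z‖ ^ β) := by gcongr
    _ = _ := by ring

theorem SectorBound.add {g h : ℂ → ℂ} {β : ℝ} (hg : SectorBound g β) (hh : SectorBound h β) :
    SectorBound (fun z => g z + h z) β := by
  intro κ h1 h2
  obtain ⟨C, ρ, hC, hρ, h⟩ := hg κ h1 h2
  obtain ⟨C', ρ', hC', hρ', h'⟩ := hh κ h1 h2
  refine ⟨C + C', max ρ ρ', by positivity, hρ.trans (le_max_left _ _), fun z hz hs => ?_⟩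
  have a1 := h z ((le_max_left _ _).trans hz) hs
  have a2 := h' z ((le_max_right _ _).trans hz) hs
  refine (norm_add_le _ _).trans ?_
  rw [add_mul]
  exact add_le_add a1 a2

theorem SectorBound.congr {g h : ℂ → ℂ} {β : ℝ} (hg : SectorBound g β)
    (he : ∀ z : ℂ, 2 ≤ ‖z‖ → g z = h z) : SectorBound h β := by
  intro κ h1 h2
  obtain ⟨C, ρ, hC, hρ, h⟩ := hg κ h1 h2
  exact ⟨C, ρ, hC, hρ, fun z hz hs => by rw [← he z (hρ.trans hz)]; exact h z hz hs⟩

theorem SectorBound.of_norm_le {h : ℂ → ℂ} {β C : ℝ} (hC : 0 ≤ C)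
    (hh : ∀ z : ℂ, 2 ≤ ‖z‖ → ‖h z‖ ≤ C * ‖z‖ ^ β) : SectorBound h β :=
  fun _ _ _ => ⟨C, 2, hC, le_rfl, fun z hz _ => hh z hz⟩

theorem SectorBound.const_mul {h : ℂ → ℂ} {β : ℝ} (hh : SectorBound h β) (c : ℂ) :
    SectorBound (fun z => c * h z) β := by
  have := (SectorBound.of_norm_le (h := fun _ => c) (β := 0) (norm_nonneg c)
    (fun z _ => by simp)).mul hh
  rwa [zero_add] at this

theorem sectorBound_zero (β : ℝ) : SectorBound (fun _ => 0) β :=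
  SectorBound.of_norm_le le_rfl (fun z _ => by simp)

theorem sectorBound_coeffG (R s : ℕ) : SectorBound (coeffG R s) ((R : ℝ) - 2 - 4 * s) := by
  obtain ⟨C, hC, h⟩ := norm_coeffG_le R s
  exact SectorBound.of_norm_le hC h

theorem sectorBound_quartRoot : SectorBound quartRoot (1 / 2) :=
  SectorBound.of_norm_le zero_le_two fun _ hz => norm_quartRoot_le hz

theorem sectorBound_quartRoot_inv : SectorBound (fun z => (quartRoot z)⁻¹) (-(1 / 2)) := by
  refine SectorBound.of_norm_le zero_le_two fun z hz => ?_
  have hz0 : 0 < ‖z‖ := by linarith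
  have h1 := norm_quartRoot_ge hz
  have h2 : 0 < ‖z‖ ^ (1 / 2 : ℝ) := by positivity
  rw [norm_inv, Real.rpow_neg hz0.le]
  calc ‖quartRoot z‖⁻¹ ≤ (‖z‖ ^ (1 / 2 : ℝ) / 2)⁻¹ := by gcongr
    _ = _ := by rw [inv_div]; rfl

theorem sectorBound_inv_sq_add_one : SectorBound (fun z => (z ^ 2 + 1)⁻¹) (-2) := by
  refine SectorBound.of_norm_le zero_le_two fun z hz => ?_
  have hz0 : 0 < ‖z‖ := by linarith
  have h1 := norm_sq_add_one_ge hz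
  rw [norm_inv, Real.rpow_neg hz0.le, Real.rpow_two]
  calc ‖z ^ 2 + 1‖⁻¹ ≤ (‖z‖ ^ 2 / 2)⁻¹ := by gcongr
    _ = _ := by rw [inv_div]; rfl

theorem sectorBound_id : SectorBound (fun z => z) 1 :=
  SectorBound.of_norm_le zero_le_one fun z _ => by simp

theorem sq_add_one_ne_zero_of_norm {z : ℂ} (hz : 2 ≤ ‖z‖) : z ^ 2 + 1 ≠ 0 :=
  norm_pos_iff.1 (by nlinarith [norm_sq_add_one_ge hz])

theorem rpow_le_of_comparable {x y : ℝ} (hx : 0 < x) (h1 : x / 2 ≤ y) (h2 : y ≤ 2 * x) (β : ℝ) :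
    y ^ β ≤ 2 ^ |β| * x ^ β := by
  have hy : 0 < y := by linarith
  rcases le_total 0 β with h | h
  · rw [abs_of_nonneg h, ← Real.mul_rpow (by norm_num) hx.le]
    exact Real.rpow_le_rpow hy.le h2 h
  · rw [abs_of_nonpos h, Real.rpow_neg (by norm_num), ← Real.inv_rpow (by norm_num),
      ← Real.mul_rpow (by norm_num) hx.le]
    exact Real.rpow_le_rpow_of_nonpos (by positivity) (by linarith) h

/-- Cauchy's estimate in sectors. -/
theorem SectorBound.deriv {h h' : ℂ → ℂ} {β : ℝ} (hh : SectorBound h β)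
    (hd : ∀ z : ℂ, z ^ 2 + 1 ≠ 0 → HasDerivAt h (h' z) z) : SectorBound h' (β - 1) := by
  intro κ h1 h2
  -- The bound is taken in a wider sector, halfway to the limiting aperture 1/2; since κ is
  -- arbitrary in `SectorBound`, nothing is lost.
  obtain ⟨C, ρ, hC, hρ, hb⟩ := hh ((κ + 1 / 2) / 2) (by linarith) (by linarith)
  -- The two apertures differ by 2δ, so a disc of radius δ‖z‖ about a point of the narrow sector
  -- stays in the wide one. It also stays outside ‖z‖/2, whence the radius 2ρ below.
  set δ : ℝ := (κ - 1 / 2) / 4 with hδ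
  have hδ0 : 0 < δ := by rw [hδ]; linarith
  refine ⟨C * 2 ^ |β| / δ, 2 * ρ, by positivity, by linarith, fun z hz hs => ?_⟩
  have hz0 : 0 < ‖z‖ := by linarith
  have hcomp : ∀ v ∈ Metric.closedBall z (δ * ‖z‖), ‖z‖ / 2 ≤ ‖v‖ ∧ ‖v‖ ≤ 2 * ‖z‖ ∧
      (κ + 1 / 2) / 2 * ‖v‖ ≤ v.re := by
    intro v hv
    rw [mem_closedBall_iff_norm] at hv
    have a1 := norm_sub_norm_le z v
    rw [norm_sub_rev] at a1
    have a2 := norm_le_norm_add_norm_sub' v z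
    have a3 := (abs_le.1 ((Complex.abs_re_le_norm (v - z)).trans hv)).1
    rw [Complex.sub_re] at a3
    have a4 : δ * ‖z‖ ≤ 1 / 2 * ‖z‖ := by
      gcongr; rw [hδ]; linarith
    refine ⟨by linarith, by linarith, ?_⟩
    have a5 : (κ + 1 / 2) / 2 * ‖v‖ ≤ (κ + 1 / 2) / 2 * (‖z‖ + δ * ‖z‖) := by
      gcongr; linarith
    have a6 : (κ + 1 / 2) / 2 * (δ * ‖z‖) ≤ 1 * (δ * ‖z‖) := by
      gcongr; linarith
    have a7 : δ * ‖z‖ = (κ * ‖z‖ - 1 / 2 * ‖z‖) / 4 := by rw [hδ]; ring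
    linarith
  have hdc : DiffContOnCl ℂ h (Metric.ball z (δ * ‖z‖)) := by
    refine DifferentiableOn.diffContOnCl fun v hv => ?_
    rw [closure_ball z (by positivity)] at hv
    have := (hcomp v hv).1
    exact (hd v (sq_add_one_ne_zero_of_norm (by linarith))).differentiableAt.differentiableWithinAt
  have key := Complex.norm_deriv_le_of_forall_mem_sphere_norm_le (C := C * (2 ^ |β| * ‖z‖ ^ β))
    (by positivity) hdc fun v hv => by
      obtain ⟨b1, b2, b3⟩ := hcomp v (Metric.sphere_subset_closedBall hv)
      refine (hb v (by linarith) b3).trans ?_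
      gcongr
      exact rpow_le_of_comparable hz0 b1 b2 β
  rw [(hd z (sq_add_one_ne_zero_of_norm (by linarith))).deriv] at key
  refine key.trans (le_of_eq ?_)
  rw [Real.rpow_sub_one hz0.ne']
  field_simp

/-- Polynomially growing solutions of `e'' + u²(z²+1)e = c(z²+1)G_n` are `O(G_n)`. -/
theorem sectorBound_bootstrap {e e' : ℂ → ℂ} {u c : ℂ} {n R : ℕ} (hu : u ≠ 0)
    (he : ∀ z, z ^ 2 + 1 ≠ 0 → HasDerivAt e (e' z) z)
    (he' : ∀ z, z ^ 2 + 1 ≠ 0 → HasDerivAt e'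
      (-(u ^ 2 * (z ^ 2 + 1) * e z) + c * (z ^ 2 + 1) * coeffG R n z) z)
    {N : ℝ} (hN : SectorBound e N) : SectorBound e ((R : ℝ) - 2 - 4 * n) := by
  set M : ℝ := (R : ℝ) - 2 - 4 * n with hM
  -- Solve the equation for e: e = (c/u²)G_n - e''/(u²(z²+1)). Two Cauchy estimates gain two powers
  -- and the division gains two more, until the order of G_n takes over.
  have step : ∀ β : ℝ, SectorBound e β → SectorBound e (max M (β - 4)) := by
    intro β hβ
    have h2 := (hβ.deriv he).deriv he'
    have h3 := ((sectorBound_inv_sq_add_one.mul h2).const_mul (-1 / u ^ 2)).mono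
      (β' := max M (β - 4)) (by rw [show -2 + (β - 1 - 1) = β - 4 by ring]; exact le_max_right M (β - 4))
    have h4 := ((sectorBound_coeffG R n).const_mul (c / u ^ 2)).mono (le_max_left M (β - 4))
    refine (h4.add h3).congr fun z hz => ?_
    have hz := sq_add_one_ne_zero_of_norm hz
    field_simp
    ring
  have all : ∀ k : ℕ, SectorBound e (max M (N - 4 * k)) := by
    intro k
    induction k with
    | zero => exact hN.mono (by simp)
    | succ k ih =>
      refine (step _ ih).mono (max_le (le_max_left _ _) ?_)
      rw [sub_le_iff_le_add, max_le_iff]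
      constructor
      · linarith [le_max_left M (N - 4 * ((k + 1 : ℕ) : ℝ))]
      · have := le_max_right M (N - 4 * ((k + 1 : ℕ) : ℝ))
        push_cast at this ⊢
        linarith
  obtain ⟨k, hk⟩ := exists_nat_ge ((N - M) / 4)
  have := all k
  rwa [max_eq_left (by linarith)] at this

/-- The threshold 3/5 lies between the aperture 1/2 and cos(π/4), so it serves both directions
e^{±πi/4} and the positive real axis. -/
theorem SectorBound.tendsto {h : ℂ → ℂ} {β : ℝ} (hh : SectorBound h β) (hβ : β < 0)
    {γ : ℝ → ℂ} {l : Filter ℝ} (hn : Tendsto (fun τ => ‖γ τ‖) l atTop) {d : ℂ}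
    (hd : 3 / 5 < d.re) (hdir : Tendsto (fun τ => γ τ / (‖γ τ‖ : ℂ)) l (𝓝 d)) :
    Tendsto (fun τ => h (γ τ)) l (𝓝 0) := by
  obtain ⟨C, ρ, hC, hρ, hb⟩ := hh (3 / 5) (by norm_num) (by norm_num)
  have hlim : Tendsto (fun τ => C * ‖γ τ‖ ^ β) l (𝓝 0) := by
    have := ((tendsto_rpow_neg_atTop (neg_pos.2 hβ)).comp hn).const_mul C
    simpa using this
  refine squeeze_zero_norm' ?_ hlim
  have h1 := ((Complex.continuous_re.tendsto d).comp hdir).eventually (lt_mem_nhds hd)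
  filter_upwards [h1, hn.eventually_ge_atTop ρ] with τ h2 h3
  refine hb _ h3 ?_
  have h0 : 0 < ‖γ τ‖ := by linarith
  have e : (γ τ / (‖γ τ‖ : ℂ)).re = (γ τ).re / ‖γ τ‖ := Complex.div_ofReal_re _ _
  simp only [Function.comp_apply] at h2
  rw [e, lt_div_iff₀ h0] at h2
  exact h2.le

/-! ### The error term and its differential equation -/

/-- The error term of the expansion. -/
noncomputable def expansionError (n R : ℕ) (u : ℝ) (z : ℂ) : ℂ :=
  weberParticular03 R (-(u / 2)) ((Real.sqrt (2 * u) : ℂ) * z) /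
      (((2 * u) ^ ((R : ℝ) / 2 + 1) : ℝ) : ℂ) -
    1 / (u : ℂ) ^ 2 * ∑ s ∈ Finset.range n, (-1) ^ (s + 1) * coeffG R s z / (u : ℂ) ^ (2 * s)

/-- The derivative of `expansionError n R u`. -/
noncomputable def expansionErrorDeriv (n R : ℕ) (u : ℝ) (z : ℂ) : ℂ :=
  weberParticular03deriv R (-(u / 2)) ((Real.sqrt (2 * u) : ℂ) * z) * (Real.sqrt (2 * u) : ℂ) /
      (((2 * u) ^ ((R : ℝ) / 2 + 1) : ℝ) : ℂ) -
    1 / (u : ℂ) ^ 2 * ∑ s ∈ Finset.range n, (-1) ^ (s + 1) * coeffGderiv R s z / (u : ℂ) ^ (2 * s)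

theorem hasDerivAt_expansionError (n R : ℕ) (u : ℝ) {z : ℂ} (hz : z ^ 2 + 1 ≠ 0) :
    HasDerivAt (expansionError n R u) (expansionErrorDeriv n R u z) z := by
  have h1 := ((hasDerivAt_weberParticular03 R (-(u / 2)) _).comp z
    ((hasDerivAt_id' z).const_mul (Real.sqrt (2 * u) : ℂ))).div_const
      (((2 * u) ^ ((R : ℝ) / 2 + 1) : ℝ) : ℂ)
  have h2 := (HasDerivAt.fun_sum (u := Finset.range n) fun s _ =>
    (((hasDerivAt_coeffG R s hz).const_mul ((-1) ^ (s + 1))).div_const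
      ((u : ℂ) ^ (2 * s)))).const_mul (1 / (u : ℂ) ^ 2)
  refine (h1.sub h2).congr_deriv ?_
  rw [expansionErrorDeriv, mul_one]

/-- G_s'' = (z²+1)G_{s+1} cancels the next term multiplied by u²(z²+1), thanks to the alternating
signs. Only z^R from s = 0 and the uncancelled last term remain. -/
theorem expansion_telescopes (n R : ℕ) {u z : ℂ} (hu : u ≠ 0) (hz : z ^ 2 + 1 ≠ 0) :
    1 / u ^ 2 * ∑ s ∈ Finset.range n,
        (-1) ^ (s + 1) * ((z ^ 2 + 1) * coeffG R (s + 1) z) / u ^ (2 * s) +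
      u ^ 2 * (z ^ 2 + 1) * (1 / u ^ 2 * ∑ s ∈ Finset.range n,
        (-1) ^ (s + 1) * coeffG R s z / u ^ (2 * s)) =
      z ^ R - (-1) ^ (n + 1) / u ^ (2 * n) * (z ^ 2 + 1) * coeffG R n z := by
  induction n with
  | zero =>
    simp only [Finset.range_zero, Finset.sum_empty, coeffG]
    field_simp
    ring
  | succ n ih =>
    rw [Finset.sum_range_succ, Finset.sum_range_succ, mul_add (1 / u ^ 2), mul_add (1 / u ^ 2),
      mul_add (u ^ 2 * (z ^ 2 + 1))]
    have e : ∀ A B C D X Y : ℂ, A + B = X → (C + D = Y - X) → A + C + (B + D) = Y := by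
      intro A B C D X Y h1 h2
      linear_combination h1 + h2
    refine e _ _ _ _ _ _ ih ?_
    rw [show 2 * (n + 1) = 2 * n + 2 by ring]
    field_simp
    ring

theorem rpow_half_add_one_eq {u : ℝ} (hu : 0 < u) (R : ℕ) :
    (2 * u) ^ ((R : ℝ) / 2 + 1) = Real.sqrt (2 * u) ^ (R + 2) := by
  rw [Real.sqrt_eq_rpow, ← Real.rpow_natCast, ← Real.rpow_mul (by positivity)]
  congr 1
  push_cast
  ring

/-- With κ² = 2u, the scaled coefficient κ²(-u/2 - κ²z²/4) equals -u²(z²+1), and division by κ^{R+2}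
normalises the forcing to z^R. -/
theorem hasDerivAt_expansionErrorDeriv (n R : ℕ) {u : ℝ} (hu : 0 < u) {z : ℂ}
    (hz : z ^ 2 + 1 ≠ 0) :
    HasDerivAt (expansionErrorDeriv n R u)
      (-((u : ℂ) ^ 2 * (z ^ 2 + 1) * expansionError n R u z) +
        (-1) ^ (n + 1) / (u : ℂ) ^ (2 * n) * (z ^ 2 + 1) * coeffG R n z) z := by
  have h1 := (((hasDerivAt_weberParticular03deriv R (-(u / 2)) _).comp z
    ((hasDerivAt_id' z).const_mul (Real.sqrt (2 * u) : ℂ))).mul_const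
      (Real.sqrt (2 * u) : ℂ)).div_const (((2 * u) ^ ((R : ℝ) / 2 + 1) : ℝ) : ℂ)
  have h2 := (HasDerivAt.fun_sum (u := Finset.range n) fun s _ =>
    (((hasDerivAt_coeffGderiv R s hz).const_mul ((-1) ^ (s + 1))).div_const
      ((u : ℂ) ^ (2 * s)))).const_mul (1 / (u : ℂ) ^ 2)
  refine (h1.sub h2).congr_deriv ?_
  have huC : (u : ℂ) ≠ 0 := by exact_mod_cast hu.ne'
  have ht := expansion_telescopes n R huC hz
  rw [expansionError]
  have hκ : (Real.sqrt (2 * u) : ℂ) ^ 2 = 2 * u := by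
    exact_mod_cast Real.sq_sqrt (by positivity : 0 ≤ 2 * u)
  have hκ0 : (Real.sqrt (2 * u) : ℂ) ≠ 0 := by
    exact_mod_cast (Real.sqrt_pos.2 (by positivity : 0 < 2 * u)).ne'
  rw [rpow_half_add_one_eq hu, Complex.ofReal_pow]
  set κ : ℂ := (Real.sqrt (2 * u) : ℂ)
  set Y := weberParticular03 R (-(u / 2)) (κ * z)
  have h3 : ((((-(u / 2) : ℝ) : ℂ) - (κ * z) ^ 2 / 4) * Y + (κ * z) ^ R) * (κ * 1) * κ / κ ^ (R + 2) =
      -((u : ℂ) ^ 2 * (z ^ 2 + 1) * (Y / κ ^ (R + 2))) + z ^ R := by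
    have hκR : κ ^ (R + 2) ≠ 0 := pow_ne_zero _ hκ0
    have hY := div_mul_cancel₀ Y hκR
    rw [div_eq_iff hκR]
    push_cast
    linear_combination ((-(u : ℂ) / 2 - κ ^ 2 * z ^ 2 / 4 - u * z ^ 2 / 2) * Y) * hκ +
      (u : ℂ) ^ 2 * (z ^ 2 + 1) * hY
  rw [h3]
  linear_combination -ht

/-- This is where the aperture 1/2 comes from: it gives |Im z| ≤ ‖z‖ ≤ 2 Re z, the sector of
polynomial growth. -/
theorem sectorBound_weberParticular03 (R : ℕ) (a : ℝ) {κ : ℝ} (hκ : 0 < κ) :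
    ∃ N : ℝ, SectorBound (fun z => weberParticular03 R a (κ * z)) N := by
  obtain ⟨C, N, hC, h⟩ := weberParticular03_growth R a
  refine ⟨N, fun μ h1 h2 => ⟨C * κ ^ N, max 2 (1 / κ), by positivity, le_max_left _ _,
    fun z hz hs => ?_⟩⟩
  have hn : ‖(κ : ℂ) * z‖ = κ * ‖z‖ := by
    rw [norm_mul, Complex.norm_real, Real.norm_of_nonneg hκ.le]
  have hz1 : 1 / κ ≤ ‖z‖ := (le_max_right _ _).trans hz
  have := h (κ * z) ?_ ?_
  · rw [hn, mul_pow] at this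
    rw [Real.rpow_natCast, mul_assoc]
    exact this
  · rw [hn]
    rw [div_le_iff₀ hκ] at hz1
    linarith
  · rw [Complex.re_ofReal_mul, Complex.im_ofReal_mul, abs_mul, abs_of_pos hκ]
    have h3 := Complex.abs_im_le_norm z
    have h4 : 1 / 2 * ‖z‖ ≤ μ * ‖z‖ := by gcongr
    nlinarith

theorem sectorBound_expansionError (n R : ℕ) {u : ℝ} (hu : 0 < u) :
    SectorBound (expansionError n R u) ((R : ℝ) - 2 - 4 * n) := by
  have huC : (u : ℂ) ≠ 0 := by exact_mod_cast hu.ne'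
  obtain ⟨N, hN⟩ := sectorBound_weberParticular03 R (-(u / 2))
    (Real.sqrt_pos.2 (by positivity : 0 < 2 * u))
  have hsum : SectorBound (fun z => ∑ s ∈ Finset.range n,
      (-1) ^ (s + 1) * coeffG R s z / (u : ℂ) ^ (2 * s)) R := by
    induction n with
    | zero => simpa using sectorBound_zero (R : ℝ)
    | succ n ih =>
      simp only [Finset.sum_range_succ]
      refine ih.add ((((sectorBound_coeffG R n).const_mul
        ((-1) ^ (n + 1) / (u : ℂ) ^ (2 * n))).congr fun z _ => ?_).mono ?_)
      · ring
      · have : (0 : ℝ) ≤ n := n.cast_nonneg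
        linarith
  refine sectorBound_bootstrap (c := (-1) ^ (n + 1) / (u : ℂ) ^ (2 * n)) huC
    (fun z hz => hasDerivAt_expansionError n R u hz)
    (fun z hz => hasDerivAt_expansionErrorDeriv n R hu hz) (N := max N R) ?_
  refine (((hN.const_mul (1 / (((2 * u) ^ ((R : ℝ) / 2 + 1) : ℝ) : ℂ))).mono
    (le_max_left _ (R : ℝ))).add ((hsum.const_mul (-1 / (u : ℂ) ^ 2)).mono
      (le_max_right N _))).congr fun z _ => ?_
  rw [expansionError]
  ring

/-- The orders of the error, of W and of `weightedG` are R-2-4n, R-3/2-4n and R-3/2-4n. The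
hypothesis on n is the negativity of the last two. -/
theorem expansionError_limits {n R : ℕ} (hn : (R : ℝ) / 4 - 3 / 8 < (n : ℝ)) {u : ℝ} (hu : 0 < u)
    {γ : ℝ → ℂ} {l : Filter ℝ} (hnorm : Tendsto (fun τ => ‖γ τ‖) l atTop) {d : ℂ}
    (hd : 3 / 5 < d.re) (hdir : Tendsto (fun τ => γ τ / (‖γ τ‖ : ℂ)) l (𝓝 d)) :
    Tendsto (fun τ => expansionError n R u (γ τ)) l (𝓝 0) ∧
    Tendsto (fun τ => quartRoot (γ τ) * expansionError n R u (γ τ)) l (𝓝 0) ∧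
      Tendsto (fun τ => liouvilleDeriv (expansionError n R u) (expansionErrorDeriv n R u) (γ τ)) l
        (𝓝 0) ∧
      Tendsto (fun τ => weightedG n R (γ τ)) l (𝓝 0) := by
  have he := sectorBound_expansionError n R hu
  have he' := he.deriv fun z hz => hasDerivAt_expansionError n R u hz
  refine ⟨he.tendsto (by linarith) hnorm hd hdir,
    (sectorBound_quartRoot.mul he).tendsto (by linarith) hnorm hd hdir, ?_,
    (sectorBound_quartRoot.mul (sectorBound_coeffG R n)).tendsto (by linarith) hnorm hd hdir⟩
  have i1 := sectorBound_quartRoot_inv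
  have i2 := i1.mul i1
  have i5 := (i2.mul i2).mul i1
  have t1 := (he'.mul i1).tendsto (by linarith) hnorm hd hdir
  have t2 := (((sectorBound_id.mul he).mul i5).const_mul (1 / 2)).tendsto (by linarith) hnorm hd hdir
  have := t1.add t2
  rw [add_zero] at this
  refine this.congr fun τ => ?_
  rw [liouvilleDeriv, div_eq_mul_inv (expansionErrorDeriv n R u (γ τ)),
    div_eq_mul_inv _ (2 * quartRoot (γ τ) ^ 5), mul_inv, ← inv_pow]
  ring

/-! ### Level curves of Im ξ -/

/-- The imaginary part of `xiBar (x + iy)`. -/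
noncomputable def imXi (x y : ℝ) : ℝ := (xiBar (x + y * Complex.I)).im

theorem imXi_re_im (z : ℂ) : imXi z.re z.im = (xiBar z).im := by
  rw [imXi, Complex.re_add_im]

theorem mk_mem_cutPlane_of_ne {x : ℝ} (hx : x ≠ 0) (y : ℝ) : (x + y * Complex.I : ℂ) ∈ cutPlane :=
  Or.inl (by simpa using hx)

theorem mk_mem_cutPlane_of_lt (x : ℝ) {y : ℝ} (hy : |y| < 1) :
    (x + y * Complex.I : ℂ) ∈ cutPlane :=
  Or.inr (by simpa using hy)

theorem hasDerivAt_imXi_right {x y : ℝ} (h : (x + y * Complex.I : ℂ) ∈ cutPlane) :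
    HasDerivAt (imXi x) (quartRoot (x + y * Complex.I) ^ 2).re y := by
  have h1 : HasDerivAt (fun y : ℂ => (x : ℂ) + y * Complex.I) Complex.I (y : ℂ) := by
    simpa using ((hasDerivAt_id' (y : ℂ)).mul_const Complex.I).const_add (x : ℂ)
  have h2 := ((hasDerivAt_xiBar h).comp (y : ℂ) h1).comp_ofReal
  have h3 := (Complex.imCLM.hasFDerivAt (x := xiBar (x + y * Complex.I))).comp_hasDerivAt y h2
  refine h3.congr_deriv ?_
  simp

theorem hasDerivAt_imXi_left {x y : ℝ} (h : (x + y * Complex.I : ℂ) ∈ cutPlane) :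
    HasDerivAt (fun x => imXi x y) (quartRoot (x + y * Complex.I) ^ 2).im x := by
  have h1 : HasDerivAt (fun x : ℂ => x + y * Complex.I) 1 (x : ℂ) :=
    (hasDerivAt_id' (x : ℂ)).add_const _
  have h2 := ((hasDerivAt_xiBar h).comp (x : ℂ) h1).comp_ofReal
  have h3 := (Complex.imCLM.hasFDerivAt (x := xiBar (x + y * Complex.I))).comp_hasDerivAt x h2
  refine h3.congr_deriv ?_
  simp

/-- At the branch points the square root is continuous with value 0, and the logarithm is evaluated
at ±i, off its cut. So ξ may be followed up to y = ±1 even on the imaginary axis. -/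
theorem continuousAt_xiBar_of_sq_eq {z : ℂ} (hz : z = Complex.I ∨ z = -Complex.I) :
    ContinuousAt xiBar z := by
  have h0 : z ^ 2 + 1 = 0 := by
    rcases hz with rfl | rfl <;> simp
  have hq : ContinuousAt (fun z : ℂ => (z ^ 2 + 1) ^ (1 / 2 : ℂ)) z := by
    refine ContinuousAt.comp (f := fun z : ℂ => z ^ 2 + 1) (g := fun z : ℂ => z ^ (1 / 2 : ℂ)) ?_
      (by fun_prop)
    rw [h0]
    exact Complex.continuousAt_cpow_const_of_re_pos (by simp) (by simp)
  have hs : z + (z ^ 2 + 1) ^ (1 / 2 : ℂ) ∈ Complex.slitPlane := by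
    rw [h0, Complex.zero_cpow (by norm_num), add_zero, Complex.mem_slitPlane_iff]
    rcases hz with rfl | rfl <;> simp
  exact ((continuousAt_id.mul hq).div_const 2).add
    (((continuousAt_id.add hq).clog hs).div_const 2)

theorem xiBar_I : (xiBar Complex.I).im = Real.pi / 4 := by
  rw [xiBar, Complex.I_sq, neg_add_cancel, Complex.zero_cpow (by norm_num)]
  rw [mul_zero, zero_div, zero_add, add_zero, Complex.log_I]
  rw [show (Real.pi / 2 * Complex.I / 2 : ℂ) = ((Real.pi / 4 : ℝ) : ℂ) * Complex.I by
    push_cast; ring, Complex.im_ofReal_mul, Complex.I_im, mul_one]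

theorem xiBar_neg_I : (xiBar (-Complex.I)).im = -(Real.pi / 4) := by
  rw [xiBar, neg_sq, Complex.I_sq, neg_add_cancel, Complex.zero_cpow (by norm_num)]
  rw [mul_zero, zero_div, zero_add, add_zero, Complex.log_neg_I]
  rw [show (-(Real.pi / 2) * Complex.I / 2 : ℂ) = ((-(Real.pi / 4) : ℝ) : ℂ) * Complex.I by
    push_cast; ring, Complex.im_ofReal_mul, Complex.I_im, mul_one]

theorem continuousAt_xiBar_of_le {x y : ℝ} (hy : |y| ≤ 1) :
    ContinuousAt xiBar (x + y * Complex.I) := by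
  by_cases hx : x = 0
  · rcases hy.lt_or_eq with h | h
    · exact (hasDerivAt_xiBar (mk_mem_cutPlane_of_lt x h)).continuousAt
    · apply continuousAt_xiBar_of_sq_eq
      rcases eq_or_eq_neg_of_abs_eq h with rfl | rfl
      · left; simp [hx]
      · right; simp [hx]
  · exact (hasDerivAt_xiBar (mk_mem_cutPlane_of_ne hx y)).continuousAt

theorem continuousOn_imXi_right (x : ℝ) : ContinuousOn (imXi x) (Set.Icc (-1) 1) := by
  intro y hy
  refine ContinuousAt.continuousWithinAt ?_
  exact Complex.continuous_im.continuousAt.comp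
    (ContinuousAt.comp (f := fun y : ℝ => (x + y * Complex.I : ℂ))
      (continuousAt_xiBar_of_le (abs_le.2 hy)) (by fun_prop))

theorem strictMonoOn_imXi_right (x : ℝ) : StrictMonoOn (imXi x) (Set.Icc (-1) 1) := by
  refine strictMonoOn_of_deriv_pos (convex_Icc _ _) (continuousOn_imXi_right x) fun y hy => ?_
  rw [interior_Icc] at hy
  have := mk_mem_cutPlane_of_lt x (abs_lt.2 hy)
  rw [(hasDerivAt_imXi_right this).deriv]
  exact quartRoot_sq_re_pos this

theorem strictMono_imXi_right {x : ℝ} (hx : x ≠ 0) : StrictMono (imXi x) := by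
  refine strictMono_of_deriv_pos fun y => ?_
  have := mk_mem_cutPlane_of_ne hx y
  rw [(hasDerivAt_imXi_right this).deriv]
  exact quartRoot_sq_re_pos this

theorem quartRoot_sq_im_nonneg {z : ℂ} (hz : z ∈ cutPlane) (h : 0 ≤ z.re * z.im) :
    0 ≤ (quartRoot z ^ 2).im := by
  rw [← quartRoot_sq_re_mul_im] at h
  exact nonneg_of_mul_nonneg_right h (quartRoot_sq_re_pos hz)

theorem quartRoot_sq_im_nonpos {z : ℂ} (hz : z ∈ cutPlane) (h : z.re * z.im ≤ 0) :
    (quartRoot z ^ 2).im ≤ 0 := by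
  rw [← quartRoot_sq_re_mul_im] at h
  exact nonpos_of_mul_nonpos_right h (quartRoot_sq_re_pos hz)

/-- Along Im z = 1 the x-derivative Im √(z²+1) has the sign of x, so the minimum is at z = i, where
Im ξ = π/4. -/
theorem imXi_one_ge (x : ℝ) : Real.pi / 4 ≤ imXi x 1 := by
  have h0 : imXi 0 1 = Real.pi / 4 := by
    rw [← xiBar_I, imXi]; simp
  have hc : Continuous fun x => imXi x 1 := continuous_iff_continuousAt.2 fun x =>
    Complex.continuous_im.continuousAt.comp
      (ContinuousAt.comp (f := fun x : ℝ => (x + (1 : ℝ) * Complex.I : ℂ))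
        (continuousAt_xiBar_of_le (by simp)) (by fun_prop))
  have hd : ∀ x : ℝ, x ≠ 0 → HasDerivAt (fun x => imXi x 1)
      (quartRoot (x + (1 : ℝ) * Complex.I) ^ 2).im x :=
    fun x hx => hasDerivAt_imXi_left (mk_mem_cutPlane_of_ne hx 1)
  rw [← h0]
  rcases le_total 0 x with hx | hx
  · refine monotoneOn_of_deriv_nonneg (convex_Ici 0) hc.continuousOn ?_ ?_
      Set.self_mem_Ici (show x ∈ Set.Ici 0 from hx) hx
    · rw [interior_Ici]
      exact fun x hx => (hd x (ne_of_gt hx)).differentiableAt.differentiableWithinAt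
    · rw [interior_Ici]
      intro x hx
      rw [(hd x (ne_of_gt hx)).deriv]
      exact quartRoot_sq_im_nonneg (mk_mem_cutPlane_of_ne (ne_of_gt hx) 1)
        (by simpa using le_of_lt hx)
  · refine antitoneOn_of_deriv_nonpos (convex_Iic 0) hc.continuousOn ?_ ?_
      (show x ∈ Set.Iic 0 from hx) Set.self_mem_Iic hx
    · rw [interior_Iic]
      exact fun x hx => (hd x (ne_of_lt hx)).differentiableAt.differentiableWithinAt
    · rw [interior_Iic]
      intro x hx
      rw [(hd x (ne_of_lt hx)).deriv]
      exact quartRoot_sq_im_nonpos (mk_mem_cutPlane_of_ne (ne_of_lt hx) 1)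
        (by simpa using le_of_lt hx)

theorem imXi_neg_one_le (x : ℝ) : imXi x (-1) ≤ -(Real.pi / 4) := by
  by_cases hx : x = 0
  · rw [hx, ← xiBar_neg_I, imXi]; simp
  · have h := xiBar_conj (mk_mem_cutPlane_of_ne hx 1)
    have h1 := imXi_one_ge x
    have : imXi x (-1) = -imXi x 1 := by
      rw [imXi, imXi, ← Complex.conj_im, ← h]
      congr 2
      simp
    linarith

theorem abs_imXi_zero_lt {y : ℝ} (hy : |y| < 1) : |imXi 0 y| < Real.pi / 4 := by
  have h0 : imXi 0 1 = Real.pi / 4 := by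
    rw [← xiBar_I, imXi]; simp
  have h1 : imXi 0 (-1) = -(Real.pi / 4) := by
    rw [← xiBar_neg_I, imXi]; simp
  have hy' := abs_lt.1 hy
  rw [abs_lt, ← h0, ← neg_neg (imXi 0 1), h0, ← h1, neg_neg]
  constructor
  · exact strictMonoOn_imXi_right 0 (by simp) ⟨hy'.1.le, hy'.2.le⟩ hy'.1
  · rw [h1, neg_neg, ← h0]
    exact strictMonoOn_imXi_right 0 ⟨hy'.1.le, hy'.2.le⟩ (by simp) hy'.2

theorem exists_levelPoint {h : ℝ} (hh : |h| < Real.pi / 4) (x : ℝ) :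
    ∃ y : ℝ, |y| < 1 ∧ imXi x y = h := by
  have h' := abs_lt.1 hh
  have h1 := imXi_one_ge x
  have h2 := imXi_neg_one_le x
  obtain ⟨y, hy, hyh⟩ := intermediate_value_Ioo (by norm_num : (-1 : ℝ) ≤ 1)
    (continuousOn_imXi_right x) (show h ∈ Set.Ioo (imXi x (-1)) (imXi x 1) from
      ⟨by linarith, by linarith⟩)
  exact ⟨y, abs_lt.2 hy, hyh⟩

theorem levelPoint_unique {x y y' : ℝ} (hy : |y| < 1) (hy' : |y'| < 1)
    (h : imXi x y = imXi x y') : y = y' :=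
  (strictMonoOn_imXi_right x).injOn ⟨(abs_lt.1 hy).1.le, (abs_lt.1 hy).2.le⟩
    ⟨(abs_lt.1 hy').1.le, (abs_lt.1 hy').2.le⟩ h

theorem abs_im_lt_one_of_level {z : ℂ} (hre : z.re ≠ 0) (h : |(xiBar z).im| < Real.pi / 4) :
    |z.im| < 1 := by
  rw [← imXi_re_im] at h
  have hm := (strictMono_imXi_right hre).monotone
  have h' := abs_lt.1 h
  rw [abs_lt]
  constructor
  · by_contra! hc
    linarith [hm hc, imXi_neg_one_le z.re]
  · by_contra! hc
    linarith [hm hc, imXi_one_ge z.re]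

theorem contDiffAt_xiBar {z : ℂ} (hz : z ∈ cutPlane) : ContDiffAt ℝ 2 xiBar z := by
  have hd : DifferentiableOn ℂ xiBar cutPlane := fun w hw =>
    (hasDerivAt_xiBar hw).differentiableAt.differentiableWithinAt
  exact (((hd.contDiffOn isOpen_cutPlane).contDiffAt
    (isOpen_cutPlane.mem_nhds hz)).of_le le_top).restrict_scalars ℝ

/-- The level curve `Im xiBar = h`, as a graph over the real axis. -/
theorem exists_levelCurve {h : ℝ} (hh : |h| < Real.pi / 4) :
    ∃ Y : ℝ → ℝ, ContDiff ℝ 2 Y ∧ ∀ x, |Y x| < 1 ∧ imXi x (Y x) = h := by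
  choose Y hY1 hY2 using exists_levelPoint hh
  refine ⟨Y, contDiff_iff_contDiffAt.2 fun x₀ => ?_, fun x => ⟨hY1 x, hY2 x⟩⟩
  have hmem := mk_mem_cutPlane_of_lt x₀ (hY1 x₀)
  let F : ℝ × ℝ → ℝ := fun p => imXi p.1 p.2
  have cdf : ContDiffAt ℝ 2 F (x₀, Y x₀) := by
    have h1 : ContDiffAt ℝ 2 (fun p : ℝ × ℝ => ((p.1 : ℂ) + p.2 * Complex.I)) (x₀, Y x₀) := by
      have e1 : ContDiff ℝ 2 (fun p : ℝ × ℝ => (p.1 : ℂ)) :=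
        Complex.ofRealCLM.contDiff.comp contDiff_fst
      have e2 : ContDiff ℝ 2 (fun p : ℝ × ℝ => (p.2 : ℂ)) :=
        Complex.ofRealCLM.contDiff.comp contDiff_snd
      exact (e1.add (e2.mul contDiff_const)).contDiffAt
    exact Complex.imCLM.contDiff.contDiffAt.comp _
      (ContDiffAt.comp (x₀, Y x₀) (contDiffAt_xiBar hmem) h1)
  have hfd : (fderiv ℝ F (x₀, Y x₀)) (0, 1) = (quartRoot (x₀ + Y x₀ * Complex.I) ^ 2).re := by
    have h1 := (cdf.differentiableAt (by norm_num)).hasFDerivAt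
    have h2 : HasDerivAt (fun y : ℝ => (x₀, y)) (0, 1) (Y x₀) :=
      (hasDerivAt_const _ _).prodMk (hasDerivAt_id _)
    exact (h1.comp_hasDerivAt (Y x₀) h2).unique (hasDerivAt_imXi_right hmem)
  have hpos := quartRoot_sq_re_pos hmem
  -- The partial derivative in y is Re √(z²+1) > 0, so the implicit function theorem applies.
  have hinv : (fderiv ℝ F (x₀, Y x₀) ∘L .inr ℝ ℝ ℝ).IsInvertible := by
    refine ⟨ContinuousLinearEquiv.unitsEquivAut ℝ (Units.mk0 _ hpos.ne'), ?_⟩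
    ext
    simp [hfd]
  have two_ne : (2 : WithTop ℕ∞) ≠ 0 := by norm_num
  have hψ := cdf.contDiffAt_implicitFunction two_ne hinv
  refine hψ.congr_of_eventuallyEq ?_
  have e1 := cdf.eventually_apply_implicitFunction two_ne hinv
  have e0 := cdf.implicitFunction_apply_self two_ne hinv
  have e2 : ∀ᶠ x in 𝓝 x₀, |cdf.implicitFunction two_ne hinv x| < 1 := by
    refine hψ.continuousAt.abs.eventually (gt_mem_nhds ?_)
    have e0' : cdf.implicitFunction two_ne hinv x₀ = Y x₀ := e0
    simp only [e0']
    exact hY1 x₀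
  -- Y was chosen pointwise; uniqueness of the level point in |y| < 1 identifies it locally with the
  -- C² implicit function.
  filter_upwards [e1, e2] with x h1 h2
  refine levelPoint_unique (x := x) (hY1 x) h2 ?_
  rw [hY2 x, ← hY2 x₀]
  exact h1.symm

/-! ### Half-paths to e^{πi/4}∞ -/

/-- A globally parametrized regular `C²` arc. -/
def IsRegularArc (β : ℝ → ℂ) : Prop := ContDiff ℝ 2 β ∧ ∀ t, deriv β t ≠ 0

/-- A chain of regular arcs in the cut plane from `z` to `e^{πi/4}∞`, parametrized by `τ ≥ 0`, along
which `Im xiBar` is nondecreasing, and which is eventually a ray. -/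
structure UpPath (z : ℂ) (σ : ℝ → ℂ) : Prop where
  start : σ 0 = z
  cont : ContinuousOn σ (Set.Ici 0)
  pieces : ∃ S : Set ℝ, S.Finite ∧ ∀ a b : ℝ, 0 ≤ a → a < b → Disjoint (Set.Ioo a b) S →
    ∃ β, IsRegularArc β ∧ Set.EqOn σ β (Set.Icc a b)
  mem_cutPlane : ∀ τ, 0 ≤ τ → σ τ ∈ cutPlane
  mono : MonotoneOn (fun τ => (xiBar (σ τ)).im) (Set.Ici 0)
  tail : ∃ (T : ℝ) (p : ℂ), ∀ τ, T ≤ τ → σ τ = p + τ * dirUp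

/-- `∫_σ |h(t) dt|` over the half-path `τ ≥ 0`. -/
noncomputable def halfIntegral (σ : ℝ → ℂ) (h : ℂ → ℂ) : ℝ≥0∞ :=
  ∫⁻ τ in Set.Ioi (0 : ℝ), ‖h (σ τ)‖ₑ * ‖deriv σ τ‖ₑ

/-- The concatenation of the arc `β` on `[0,ℓ]` with the half-path `σ`. -/
noncomputable def prependArc (β : ℝ → ℂ) (l : ℝ) (σ : ℝ → ℂ) (τ : ℝ) : ℂ :=
  if τ ≤ l then β τ else σ (τ - l)

theorem monotoneOn_im_xiBar {β : ℝ → ℂ} {I : Set ℝ} (hI : Convex ℝ I) (hβ : Differentiable ℝ β)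
    (hmem : ∀ τ ∈ I, β τ ∈ cutPlane)
    (hd : ∀ τ ∈ I, 0 ≤ (quartRoot (β τ) ^ 2 * deriv β τ).im) :
    MonotoneOn (fun τ => (xiBar (β τ)).im) I := by
  have hder : ∀ τ ∈ I, HasDerivAt (fun τ => (xiBar (β τ)).im)
      (quartRoot (β τ) ^ 2 * deriv β τ).im τ := fun τ hτ => by
    have h2 := (hasDerivAt_xiBar (hmem τ hτ)).comp τ (hβ τ).hasDerivAt
    have h3 := (Complex.imCLM.hasFDerivAt (x := xiBar (β τ))).comp_hasDerivAt τ h2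
    exact h3
  refine monotoneOn_of_deriv_nonneg hI
    (fun τ hτ => (hder τ hτ).continuousAt.continuousWithinAt)
    (fun τ hτ => (hder τ (interior_subset hτ)).differentiableAt.differentiableWithinAt) ?_
  intro τ hτ
  rw [(hder τ (interior_subset hτ)).deriv]
  exact hd τ (interior_subset hτ)

theorem hasDerivAt_ray (z d : ℂ) (τ : ℝ) : HasDerivAt (fun τ : ℝ => z + τ * d) d τ := by
  have h1 : HasDerivAt (fun r : ℂ => z + r * d) d (τ : ℂ) := by
    simpa using ((hasDerivAt_id' (τ : ℂ)).mul_const d).const_add z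
  exact h1.comp_ofReal

theorem isRegularArc_ray (z : ℂ) {d : ℂ} (hd : d ≠ 0) :
    IsRegularArc (fun τ : ℝ => z + τ * d) := by
  refine ⟨contDiff_const.add (Complex.ofRealCLM.contDiff.mul contDiff_const), fun t => ?_⟩
  rw [(hasDerivAt_ray z d t).deriv]
  exact hd

theorem dirUp_ne_zero : dirUp ≠ 0 := norm_pos_iff.1 (by rw [norm_dirUp]; exact one_pos)

theorem ray_mem_cutPlane {z : ℂ} (hz : z ∈ cutPlane) (hre : 0 ≤ z.re) {τ : ℝ} (hτ : 0 ≤ τ) :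
    z + τ * dirUp ∈ cutPlane := by
  rcases hτ.eq_or_lt with rfl | h
  · simpa using hz
  · left
    have : 0 < τ * dirUp.re := by rw [dirUp_re]; positivity
    rw [Complex.add_re, Complex.re_ofReal_mul]
    linarith

/-- In the closed first quadrant both √(z²+1) and e^{πi/4} have nonnegative real and imaginary
parts, so Im ξ cannot decrease along the ray. -/
theorem upPath_ray {z : ℂ} (hz : z ∈ cutPlane) (hre : 0 ≤ z.re) (him : 0 ≤ z.im) :
    UpPath z (fun τ : ℝ => z + τ * dirUp) where
  start := by simp
  cont := by fun_prop
  pieces := ⟨∅, Set.finite_empty, fun _ _ _ _ _ =>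
    ⟨_, isRegularArc_ray z dirUp_ne_zero, fun _ _ => rfl⟩⟩
  mem_cutPlane := fun τ hτ => ray_mem_cutPlane hz hre hτ
  mono := by
    refine monotoneOn_im_xiBar (convex_Ici 0) (fun τ => (hasDerivAt_ray z dirUp τ).differentiableAt)
      (fun τ hτ => ray_mem_cutPlane hz hre hτ) fun τ hτ => ?_
    have hτ0 : 0 ≤ τ := hτ
    have hmem := ray_mem_cutPlane hz hre hτ0
    rw [(hasDerivAt_ray z dirUp τ).deriv, Complex.mul_im, dirUp_re, dirUp_im]
    have h1 := quartRoot_sq_re_pos hmem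
    have h2 : 0 ≤ (quartRoot (z + τ * dirUp) ^ 2).im := by
      refine quartRoot_sq_im_nonneg hmem (mul_nonneg ?_ ?_)
      · rw [Complex.add_re, Complex.re_ofReal_mul, dirUp_re]; positivity
      · rw [Complex.add_im, Complex.im_ofReal_mul, dirUp_im]; positivity
    positivity
  tail := ⟨0, z, fun _ _ => rfl⟩

theorem prependArc_of_le {β σ : ℝ → ℂ} {l τ : ℝ} (h : τ ≤ l) : prependArc β l σ τ = β τ :=
  if_pos h

theorem prependArc_of_ge {β σ : ℝ → ℂ} {l τ : ℝ} (hj : β l = σ 0) (h : l ≤ τ) :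
    prependArc β l σ τ = σ (τ - l) := by
  rcases h.eq_or_lt with rfl | h
  · rw [prependArc_of_le le_rfl, hj, sub_self]
  · exact if_neg (not_le.2 h)

theorem UpPath.prepend {z₁ : ℂ} {σ β : ℝ → ℂ} {l : ℝ} (hσ : UpPath z₁ σ) (hl : 0 ≤ l)
    (hβ : IsRegularArc β) (hj : β l = z₁) (hmem : ∀ τ ∈ Set.Icc 0 l, β τ ∈ cutPlane)
    (hmono : MonotoneOn (fun τ => (xiBar (β τ)).im) (Set.Icc 0 l)) :
    UpPath (β 0) (prependArc β l σ) := by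
  have hj' : β l = σ 0 := hj.trans hσ.start.symm
  refine ⟨prependArc_of_le hl, ?_, ?_, ?_, ?_, ?_⟩
  · have e : Set.Ici (0 : ℝ) = Set.Icc 0 l ∪ Set.Ici l := (Set.Icc_union_Ici_eq_Ici hl).symm
    rw [e]
    refine ContinuousOn.union_of_isClosed ?_ ?_ isClosed_Icc isClosed_Ici
    · exact hβ.1.continuous.continuousOn.congr fun τ hτ => prependArc_of_le hτ.2
    · have : ContinuousOn (fun τ => σ (τ - l)) (Set.Ici l) :=
        hσ.cont.comp (by fun_prop) fun τ hτ => by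
          have : l ≤ τ := hτ
          simpa using this
      exact this.congr fun τ hτ => prependArc_of_ge hj' hτ
  · obtain ⟨S, hS, hp⟩ := hσ.pieces
    -- The junction l becomes a break point, so each piece lies entirely in the arc or entirely in
    -- the shifted half-path.
    refine ⟨insert l ((fun τ => τ + l) '' S), (hS.image _).insert l, fun a b ha hab hdis => ?_⟩
    rw [Set.disjoint_insert_right] at hdis
    by_cases hbl : b ≤ l
    · exact ⟨β, hβ, fun τ hτ => prependArc_of_le (hτ.2.trans hbl)⟩
    · have hal : l ≤ a := by
        by_contra! h
        exact hdis.1 ⟨h, not_le.1 hbl⟩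
      obtain ⟨η, hη, he⟩ := hp (a - l) (b - l) (by linarith) (by linarith) (by
        rw [Set.disjoint_left]
        intro τ hτ hτS
        exact Set.disjoint_left.1 hdis.2 (show τ + l ∈ Set.Ioo a b from
          ⟨by linarith [hτ.1], by linarith [hτ.2]⟩) ⟨τ, hτS, rfl⟩)
      refine ⟨fun τ => η (τ - l), ⟨hη.1.comp (contDiff_id.sub contDiff_const), fun t => ?_⟩,
        fun τ hτ => ?_⟩
      · rw [deriv_comp_sub_const]
        exact hη.2 _
      · rw [prependArc_of_ge hj' (hal.trans hτ.1)]
        exact he ⟨by linarith [hτ.1], by linarith [hτ.2]⟩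
  · intro τ hτ
    rcases le_total τ l with h | h
    · rw [prependArc_of_le h]; exact hmem τ ⟨hτ, h⟩
    · rw [prependArc_of_ge hj' h]; exact hσ.mem_cutPlane _ (by linarith)
  · have e : Set.Ici (0 : ℝ) = Set.Icc 0 l ∪ Set.Ici l := (Set.Icc_union_Ici_eq_Ici hl).symm
    rw [e]
    refine MonotoneOn.union_right (c := l) ?_ ?_ (isGreatest_Icc hl) isLeast_Ici
    · exact hmono.congr fun τ hτ => by simp only [prependArc_of_le hτ.2]
    · intro τ hτ τ' hτ' h
      have h1 : l ≤ τ := hτ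
      have h2 : l ≤ τ' := hτ'
      simp only [prependArc_of_ge hj' h1, prependArc_of_ge hj' h2]
      exact hσ.mono (by simpa using h1) (by simpa using h2) (by linarith)
  · obtain ⟨T, p, ht⟩ := hσ.tail
    refine ⟨max l (T + l), p - l * dirUp, fun τ hτ => ?_⟩
    rw [prependArc_of_ge hj' ((le_max_left _ _).trans hτ),
      ht _ (by linarith [(le_max_right l (T + l)).trans hτ])]
    push_cast
    ring

theorem setLIntegral_Ioi_comp_sub (f : ℝ → ℝ≥0∞) (l : ℝ) :
    ∫⁻ τ in Set.Ioi l, f (τ - l) = ∫⁻ τ in Set.Ioi (0 : ℝ), f τ := by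
  rw [← lintegral_indicator measurableSet_Ioi, ← lintegral_indicator measurableSet_Ioi,
    ← lintegral_sub_right_eq_self (fun τ => (Set.Ioi (0 : ℝ)).indicator f τ) l]
  refine lintegral_congr fun τ => ?_
  simp only [Set.indicator, Set.mem_Ioi, sub_pos]

theorem halfIntegral_prependArc {β σ : ℝ → ℂ} {l : ℝ} (hl : 0 ≤ l) (hj : β l = σ 0) (h : ℂ → ℂ) :
    halfIntegral (prependArc β l σ) h =
      (∫⁻ τ in Set.Ioc 0 l, ‖h (β τ)‖ₑ * ‖deriv β τ‖ₑ) + halfIntegral σ h := by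
  rw [halfIntegral, ← Set.Ioc_union_Ioi_eq_Ioi hl,
    lintegral_union measurableSet_Ioi (Set.Ioc_disjoint_Ioi le_rfl)]
  congr 1
  · rw [← setLIntegral_congr (Ioo_ae_eq_Ioc (a := (0 : ℝ)) (b := l)),
      ← setLIntegral_congr (Ioo_ae_eq_Ioc (a := (0 : ℝ)) (b := l))]
    refine setLIntegral_congr_fun measurableSet_Ioo fun τ hτ => ?_
    have e : prependArc β l σ =ᶠ[𝓝 τ] β := by
      filter_upwards [Iio_mem_nhds hτ.2] with v hv using prependArc_of_le (le_of_lt hv)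
    simp only [e.deriv_eq, e.self_of_nhds]
  · rw [halfIntegral, ← setLIntegral_Ioi_comp_sub _ l]
    refine setLIntegral_congr_fun measurableSet_Ioi fun τ hτ => ?_
    have e : prependArc β l σ =ᶠ[𝓝 τ] fun v => σ (v - l) := by
      filter_upwards [Ioi_mem_nhds hτ] with v hv using prependArc_of_ge hj (le_of_lt hv)
    simp only [e.deriv_eq, e.self_of_nhds, deriv_comp_sub_const]

theorem norm_le_of_hasDecay {h : ℂ → ℂ} {β : ℝ} (hβ : β ≤ 0) (hc : ContinuousOn h cutPlane)
    (hd : HasDecay h β) (z : ℂ) {d : ℂ} (hd1 : ‖d‖ = 1) {I : Set ℝ} (hI : IsClosed I)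
    (hmem : ∀ τ ∈ I, z + (τ : ℂ) * d ∈ cutPlane) :
    ∃ C : ℝ, 0 ≤ C ∧ ∀ τ ∈ I, ‖h (z + (τ : ℂ) * d)‖ ≤ C * (1 + ‖τ‖) ^ β := by
  obtain ⟨C₀, hC₀, h₀⟩ := hd
  -- Compactness handles |τ| ≤ T. Beyond T one has ‖z+τd‖ ≥ (1+|τ|)/2 and ‖z+τd‖ ≥ 2, so the decay
  -- hypothesis applies.
  set T : ℝ := 2 * ‖z‖ + 4 with hT
  have hcomp : IsCompact (Set.Icc (-T) T ∩ I) := isCompact_Icc.inter_right hI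
  obtain ⟨C₁, hC₁⟩ := hcomp.exists_bound_of_continuousOn
    (f := fun τ : ℝ => h (z + (τ : ℂ) * d))
    (hc.comp (by fun_prop) fun τ hτ => hmem τ hτ.2)
  have hT0 : 0 < 1 + T := by positivity
  refine ⟨C₀ * (1 / 2) ^ β + |C₁| * (1 + T) ^ (-β), by positivity, fun τ hτ => ?_⟩
  have hτ0 : 0 < 1 + ‖τ‖ := by positivity
  have hnn : 0 ≤ (1 + ‖τ‖) ^ β := by positivity
  rw [add_mul]
  by_cases hτT : ‖τ‖ ≤ T
  · have h1 := hC₁ τ ⟨abs_le.1 hτT, hτ⟩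
    have h2 : 1 ≤ (1 + T) ^ (-β) * (1 + ‖τ‖) ^ β := by
      rw [Real.rpow_neg hT0.le, inv_mul_eq_div, one_le_div (by positivity)]
      exact Real.rpow_le_rpow_of_nonpos hτ0 (by linarith) hβ
    have h3 : 0 ≤ C₀ * (1 / 2) ^ β * (1 + ‖τ‖) ^ β := by positivity
    calc _ ≤ C₁ := h1
      _ ≤ |C₁| * 1 := by rw [mul_one]; exact le_abs_self _
      _ ≤ |C₁| * ((1 + T) ^ (-β) * (1 + ‖τ‖) ^ β) := by gcongr
      _ ≤ _ := by linarith
  · have h1 : ‖τ‖ - ‖z‖ ≤ ‖z + (τ : ℂ) * d‖ := by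
      have := norm_sub_norm_le ((τ : ℂ) * d) (-z)
      rw [norm_mul, hd1, mul_one, Complex.norm_real, norm_neg, sub_neg_eq_add, add_comm _ z] at this
      exact this
    have h2 : (1 / 2) * (1 + ‖τ‖) ≤ ‖z + (τ : ℂ) * d‖ := by linarith
    have hz0 := norm_nonneg z
    have h3 := h₀ _ (hmem τ hτ) (by linarith)
    have h4 : 0 ≤ |C₁| * (1 + T) ^ (-β) * (1 + ‖τ‖) ^ β := by positivity
    have h5 : ‖z + (τ : ℂ) * d‖ ^ β ≤ (1 / 2) ^ β * (1 + ‖τ‖) ^ β := by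
      rw [← Real.mul_rpow (by norm_num) hτ0.le]
      exact Real.rpow_le_rpow_of_nonpos (by positivity) h2 hβ
    calc _ ≤ C₀ * ((1 / 2) ^ β * (1 + ‖τ‖) ^ β) := h3.trans (by gcongr)
      _ ≤ _ := by linarith

theorem lintegral_ray_ne_top {h : ℂ → ℂ} {β : ℝ} (hβ : β < -1) (hc : ContinuousOn h cutPlane)
    (hd : HasDecay h β) (z : ℂ) {d : ℂ} (hd1 : ‖d‖ = 1) {I : Set ℝ} (hI : IsClosed I)
    (hmem : ∀ τ ∈ I, z + (τ : ℂ) * d ∈ cutPlane) :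
    ∫⁻ τ in I, ‖h (z + (τ : ℂ) * d)‖ₑ ≠ ⊤ := by
  obtain ⟨C, hC, hb⟩ := norm_le_of_hasDecay (by linarith) hc hd z hd1 hI hmem
  have hint : Integrable (fun τ : ℝ => C * (1 + ‖τ‖) ^ β) := by
    have := (integrable_one_add_norm (E := ℝ) (μ := volume) (r := -β) (by simp; linarith)).const_mul C
    simpa using this
  have : IntegrableOn (fun τ : ℝ => h (z + (τ : ℂ) * d)) I := by
    refine Integrable.mono' hint.integrableOn ?_ ?_
    · exact (hc.comp (by fun_prop) fun τ hτ => hmem τ hτ).aestronglyMeasurable hI.measurableSet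
    · filter_upwards [ae_restrict_mem hI.measurableSet] with τ hτ using hb τ hτ
  exact (hasFiniteIntegral_iff_enorm.1 this.2).ne

theorem bounded_ray {h : ℂ → ℂ} {β : ℝ} (hβ : β ≤ 0) (hc : ContinuousOn h cutPlane)
    (hd : HasDecay h β) (z : ℂ) {d : ℂ} (hd1 : ‖d‖ = 1) {I : Set ℝ} (hI : IsClosed I)
    (hmem : ∀ τ ∈ I, z + (τ : ℂ) * d ∈ cutPlane) :
    ∃ C : ℝ, ∀ τ ∈ I, ‖h (z + (τ : ℂ) * d)‖ ≤ C := by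
  obtain ⟨C, hC, hb⟩ := norm_le_of_hasDecay hβ hc hd z hd1 hI hmem
  refine ⟨C, fun τ hτ => (hb τ hτ).trans (mul_le_of_le_one_right hC ?_)⟩
  exact Real.rpow_le_one_of_one_le_of_nonpos (by linarith [norm_nonneg τ]) hβ

/-- All functions with sufficient decay are integrable, respectively bounded, along `σ`. -/
def Tame (σ : ℝ → ℂ) : Prop :=
  ∀ (h : ℂ → ℂ) (β : ℝ), ContinuousOn h cutPlane → HasDecay h β →
    (β < -1 → halfIntegral σ h ≠ ⊤) ∧ (β ≤ 0 → ∃ C : ℝ, ∀ τ, 0 ≤ τ → ‖h (σ τ)‖ ≤ C)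

theorem halfIntegral_ray (z : ℂ) (h : ℂ → ℂ) : halfIntegral (fun τ : ℝ => z + τ * dirUp) h =
    ∫⁻ τ in Set.Ici (0 : ℝ), ‖h (z + (τ : ℂ) * dirUp)‖ₑ := by
  rw [halfIntegral, ← setLIntegral_congr Ioi_ae_eq_Ici]
  refine lintegral_congr fun τ => ?_
  rw [(hasDerivAt_ray z dirUp τ).deriv, ← ofReal_norm dirUp, norm_dirUp,
    ENNReal.ofReal_one, mul_one]

theorem tame_ray {z : ℂ} (hz : z ∈ cutPlane) (hre : 0 ≤ z.re) :
    Tame (fun τ : ℝ => z + τ * dirUp) := by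
  intro h β hc hd
  refine ⟨fun hβ => ?_, fun hβ => ?_⟩
  · rw [halfIntegral_ray]
    exact lintegral_ray_ne_top hβ hc hd z norm_dirUp isClosed_Ici
      fun τ hτ => ray_mem_cutPlane hz hre hτ
  · exact bounded_ray hβ hc hd z norm_dirUp isClosed_Ici fun τ hτ => ray_mem_cutPlane hz hre hτ

theorem Tame.prepend {σ β : ℝ → ℂ} {l : ℝ} (hσ : Tame σ) (hl : 0 ≤ l)
    (hβ : IsRegularArc β) (hj : β l = σ 0) (hmem : ∀ τ ∈ Set.Icc 0 l, β τ ∈ cutPlane) :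
    Tame (prependArc β l σ) := by
  intro h b hc hd
  obtain ⟨h1, h2⟩ := hσ h b hc hd
  have hcont : ContinuousOn (fun τ => h (β τ)) (Set.Icc 0 l) :=
    hc.comp hβ.1.continuous.continuousOn hmem
  refine ⟨fun hb => ?_, fun hb => ?_⟩
  · rw [halfIntegral_prependArc hl hj]
    refine ENNReal.add_ne_top.2 ⟨?_, h1 hb⟩
    have hi : IntegrableOn (fun τ => h (β τ) * deriv β τ) (Set.Icc 0 l) :=
      (hcont.mul (hβ.1.continuous_deriv (by norm_num)).continuousOn).integrableOn_Icc
    have := (hasFiniteIntegral_iff_enorm.1 (hi.mono_set Set.Ioc_subset_Icc_self).2).ne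
    simpa only [enorm_mul] using this
  · obtain ⟨C, hC⟩ := h2 hb
    obtain ⟨C', hC'⟩ := isCompact_Icc.exists_bound_of_continuousOn hcont
    refine ⟨max C C', fun τ hτ => ?_⟩
    rcases le_total τ l with h | h
    · rw [prependArc_of_le h]
      exact (hC' τ ⟨hτ, h⟩).trans (le_max_right _ _)
    · rw [prependArc_of_ge hj h]
      exact (hC _ (by linarith)).trans (le_max_left _ _)

/-- Below the real axis, first rise vertically to it: Im ξ increases because Re √(z²+1) > 0. From
there the ray works. -/
theorem exists_upPath_of_re_nonneg {z : ℂ} (hz : z ∈ cutPlane) (hre : 0 ≤ z.re) :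
    ∃ σ, UpPath z σ ∧ Tame σ := by
  rcases le_total 0 z.im with him | him
  · exact ⟨_, upPath_ray hz hre him, tame_ray hz hre⟩
  · have harc := isRegularArc_ray z Complex.I_ne_zero
    have hz1 : (z.re : ℂ) ∈ cutPlane := Or.inr (by simp)
    have hre1 : 0 ≤ (z.re : ℂ).re := by simpa using hre
    have hup := upPath_ray hz1 hre1 (by simp)
    have hj : z + ((-z.im : ℝ) : ℂ) * Complex.I = (z.re : ℂ) := by
      apply Complex.ext <;> simp
    have hmem : ∀ τ ∈ Set.Icc 0 (-z.im), z + (τ : ℂ) * Complex.I ∈ cutPlane := by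
      intro τ hτ
      rcases hz with h | h
      · left; simpa using h
      · right
        have : (z + (τ : ℂ) * Complex.I).im = z.im + τ := by simp
        rw [this, abs_lt]
        rw [abs_lt] at h
        constructor <;> linarith [hτ.1, hτ.2]
    have hmono := monotoneOn_im_xiBar (convex_Icc 0 (-z.im))
      (fun τ => (hasDerivAt_ray z Complex.I τ).differentiableAt) hmem fun τ hτ => by
        rw [(hasDerivAt_ray z Complex.I τ).deriv]
        have := quartRoot_sq_re_pos (hmem τ hτ)
        rw [Complex.mul_im, Complex.I_re, Complex.I_im]
        linarith
    have h0 : 0 ≤ -z.im := by linarith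
    have hp := hup.prepend h0 harc hj hmem hmono
    refine ⟨_, by simpa using hp, (tame_ray hz1 hre1).prepend h0 harc ?_ hmem⟩
    rw [hj]; simp

/-- The cut plane without the parts of the left half plane
beyond the level curves through `± i`. -/
def validityRegion : Set ℂ :=
  {z : ℂ | z ∈ cutPlane ∧ (0 < z.re ∨ |(xiBar z).im| < Real.pi / 4)}

/-- In the left half plane follow the level curve of Im ξ rightwards to the imaginary axis, which it
meets between the branch points. -/
theorem exists_upPath {z : ℂ} (hz : z ∈ validityRegion) : ∃ σ, UpPath z σ ∧ Tame σ := by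
  rcases le_or_gt 0 z.re with hre | hre
  · exact exists_upPath_of_re_nonneg hz.1 hre
  · have hlev : |(xiBar z).im| < Real.pi / 4 := hz.2.resolve_left (by linarith)
    obtain ⟨Y, hY, hY'⟩ := exists_levelCurve hlev
    have hd : ∀ τ : ℝ, HasDerivAt (fun τ : ℝ => ((z.re + τ : ℝ) : ℂ) + (Y (z.re + τ) : ℂ) * Complex.I)
        (1 + ((deriv Y (z.re + τ) : ℝ) : ℂ) * Complex.I) τ := by
      intro τ
      have h1 : HasDerivAt (fun τ : ℝ => z.re + τ) 1 τ := (hasDerivAt_id' τ).const_add _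
      have h2 := ((hY.differentiable (by norm_num) (z.re + τ)).hasDerivAt.comp τ h1)
      have h3 := h1.ofReal_comp.fun_add (h2.ofReal_comp.mul_const Complex.I)
      simpa using h3
    have harc : IsRegularArc
        (fun τ : ℝ => ((z.re + τ : ℝ) : ℂ) + (Y (z.re + τ) : ℂ) * Complex.I) := by
      refine ⟨?_, fun t => ?_⟩
      · have e : ContDiff ℝ 2 fun τ : ℝ => z.re + τ := contDiff_const.add contDiff_id
        exact (Complex.ofRealCLM.contDiff.comp e).add
          ((Complex.ofRealCLM.contDiff.comp (hY.comp e)).mul contDiff_const)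
      · rw [(hd t).deriv]
        intro h
        have := congrArg Complex.re h
        simp at this
    have h0 : 0 ≤ -z.re := by linarith
    have hmem : ∀ τ ∈ Set.Icc 0 (-z.re),
        ((z.re + τ : ℝ) : ℂ) + (Y (z.re + τ) : ℂ) * Complex.I ∈ cutPlane :=
      fun τ _ => mk_mem_cutPlane_of_lt _ (hY' _).1
    have hz1 := mk_mem_cutPlane_of_lt 0 (hY' 0).1
    obtain ⟨σ, hσ, hσt⟩ := exists_upPath_of_re_nonneg hz1 (by simp)
    have hj : ((z.re + (-z.re) : ℝ) : ℂ) + (Y (z.re + (-z.re)) : ℂ) * Complex.I =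
        ((0 : ℝ) : ℂ) + (Y 0 : ℂ) * Complex.I := by
      rw [add_neg_cancel]
    have hmono : MonotoneOn (fun τ : ℝ =>
        (xiBar (((z.re + τ : ℝ) : ℂ) + (Y (z.re + τ) : ℂ) * Complex.I)).im)
        (Set.Icc 0 (-z.re)) := by
      intro τ _ τ' _ _
      exact le_of_eq ((hY' (z.re + τ)).2.trans (hY' (z.re + τ')).2.symm)
    have hp := hσ.prepend h0 harc hj hmem hmono
    have hstart : ((z.re + 0 : ℝ) : ℂ) + (Y (z.re + 0) : ℂ) * Complex.I = z := by
      have : Y z.re = z.im := levelPoint_unique (x := z.re) (hY' _).1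
        (abs_im_lt_one_of_level hre.ne hlev) (by rw [(hY' _).2, imXi_re_im])
      rw [add_zero, this, Complex.re_add_im]
    rw [hstart] at hp
    exact ⟨_, hp, hσt.prepend h0 harc (hj.trans hσ.start.symm) hmem⟩

/-! ### Full paths and the region of validity -/

theorem IsRegularArc.conj {β : ℝ → ℂ} (h : IsRegularArc β) :
    IsRegularArc (fun τ => (starRingEnd ℂ) (β τ)) := by
  refine ⟨Complex.conjCLE.contDiff.comp h.1, fun t => ?_⟩
  have e : deriv (fun τ => (starRingEnd ℂ) (β τ)) t = (starRingEnd ℂ) (deriv β t) :=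
    deriv.star
  rw [e]
  simpa using h.2 t

theorem IsRegularArc.comp_neg {β : ℝ → ℂ} (h : IsRegularArc β) :
    IsRegularArc (fun τ => β (-τ)) := by
  refine ⟨h.1.comp contDiff_neg, fun t => ?_⟩
  rw [deriv_comp_neg]
  exact neg_ne_zero.2 (h.2 _)

/-- Agreement with a globally regular arc on the closed piece settles smoothness and the one-sided
derivatives at its end points. -/
theorem IsRegularArc.contDiffOn_congr {γ β : ℝ → ℂ} (h : IsRegularArc β) {a b : ℝ} (hab : a < b)
    (he : Set.EqOn γ β (Set.Icc a b)) : ContDiffOn ℝ 2 γ (Set.Icc a b) ∧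
      ∀ t ∈ Set.Icc a b, derivWithin γ (Set.Icc a b) t ≠ 0 := by
  refine ⟨h.1.contDiffOn.congr he, fun t ht => ?_⟩
  rw [derivWithin_congr he (he ht),
    ((h.1.differentiable (by norm_num) t).hasDerivAt.hasDerivWithinAt).derivWithin
      (uniqueDiffOn_Icc hab t ht)]
  exact h.2 t

theorem tendsto_norm_ray (p : ℂ) {d : ℂ} (hd : ‖d‖ = 1) :
    Tendsto (fun τ : ℝ => ‖p + τ * d‖) atTop atTop := by
  refine tendsto_atTop_mono (f := fun τ : ℝ => τ - ‖p‖) (fun τ => ?_)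
    (tendsto_atTop_add_const_right _ _ tendsto_id)
  have := norm_sub_norm_le ((τ : ℂ) * d) (-p)
  rw [norm_mul, hd, mul_one, Complex.norm_real, norm_neg, sub_neg_eq_add, add_comm _ p] at this
  exact (sub_le_sub_right (le_abs_self τ) _).trans this

theorem tendsto_dir_ray (p : ℂ) {d : ℂ} (hd : ‖d‖ = 1) :
    Tendsto (fun τ : ℝ => (p + τ * d) / (‖p + τ * d‖ : ℂ)) atTop (𝓝 d) := by
  have h1 : Tendsto (fun τ : ℝ => p * ((τ⁻¹ : ℝ) : ℂ) + d) atTop (𝓝 d) := by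
    have := (((Complex.continuous_ofReal.tendsto 0).comp tendsto_inv_atTop_zero).const_mul p).add_const d
    simpa using this
  have h2 : Tendsto (fun τ : ℝ => (p * ((τ⁻¹ : ℝ) : ℂ) + d) / (‖p * ((τ⁻¹ : ℝ) : ℂ) + d‖ : ℂ)) atTop
      (𝓝 (d / (‖d‖ : ℂ))) :=
    h1.div ((Complex.continuous_ofReal.tendsto _).comp h1.norm) (by simp [hd])
  rw [hd, Complex.ofReal_one, div_one] at h2
  refine h2.congr' ?_
  filter_upwards [eventually_gt_atTop 0] with τ hτ
  have hτ' : (τ : ℂ) ≠ 0 := by exact_mod_cast hτ.ne'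
  have e : p + τ * d = τ * (p * ((τ⁻¹ : ℝ) : ℂ) + d) := by
    push_cast; field_simp
  rw [e, norm_mul, Complex.norm_of_nonneg hτ.le, Complex.ofReal_mul, mul_div_mul_left _ _ hτ']

/-- The path which runs along the reversed half-path `σ₁` and then along the conjugate of `σ₂`. -/
noncomputable def fullPath (σ₁ σ₂ : ℝ → ℂ) (τ : ℝ) : ℂ :=
  if τ ≤ 0 then σ₁ (-τ) else (starRingEnd ℂ) (σ₂ τ)

theorem fullPath_of_nonpos {σ₁ σ₂ : ℝ → ℂ} {τ : ℝ} (h : τ ≤ 0) : fullPath σ₁ σ₂ τ = σ₁ (-τ) :=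
  if_pos h

theorem fullPath_of_nonneg {z : ℂ} {σ₁ σ₂ : ℝ → ℂ} (h₁ : UpPath z σ₁)
    (h₂ : UpPath ((starRingEnd ℂ) z) σ₂) {τ : ℝ} (h : 0 ≤ τ) :
    fullPath σ₁ σ₂ τ = (starRingEnd ℂ) (σ₂ τ) := by
  rcases h.eq_or_lt with rfl | h
  · rw [fullPath_of_nonpos le_rfl, neg_zero, h₁.start, h₂.start, Complex.conj_conj]
  · exact if_neg (not_le.2 h)

theorem fullPath_zero {z : ℂ} {σ₁ σ₂ : ℝ → ℂ} (h₁ : UpPath z σ₁) : fullPath σ₁ σ₂ 0 = z := by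
  rw [fullPath_of_nonpos le_rfl, neg_zero, h₁.start]

/-- Conjugation exchanges the directions e^{±πi/4} and negates Im ξ, so the conjugate of a rising
half-path from the conjugate point descends from z to e^{-πi/4}∞. -/
theorem isPath03_fullPath {z : ℂ} {σ₁ σ₂ : ℝ → ℂ} (h₁ : UpPath z σ₁)
    (h₂ : UpPath ((starRingEnd ℂ) z) σ₂) : IsPath03 (fullPath σ₁ σ₂) := by
  obtain ⟨T₁, p₁, ht₁⟩ := h₁.tail
  obtain ⟨T₂, p₂, ht₂⟩ := h₂.tail
  have hneg : (fun τ : ℝ => fullPath σ₁ σ₂ τ) =ᶠ[atBot] fun τ => p₁ + ((-τ : ℝ) : ℂ) * dirUp := by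
    filter_upwards [eventually_le_atBot 0, eventually_le_atBot (-T₁)] with τ h h'
    rw [fullPath_of_nonpos h, ht₁ _ (by linarith)]
  have hpos : (fun τ : ℝ => fullPath σ₁ σ₂ τ) =ᶠ[atTop]
      fun τ => (starRingEnd ℂ) p₂ + (τ : ℂ) * dirDown := by
    filter_upwards [eventually_ge_atTop 0, eventually_ge_atTop T₂] with τ h h'
    rw [fullPath_of_nonneg h₁ h₂ h, ht₂ _ h', map_add, map_mul, Complex.conj_ofReal, conj_dirUp]
  refine ⟨⟨?_, ?_⟩, ?_, ?_, ?_, ?_, ?_, ?_⟩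
  · rw [← continuousOn_univ, ← Set.Iic_union_Ici (a := (0 : ℝ))]
    refine ContinuousOn.union_of_isClosed ?_ ?_ isClosed_Iic isClosed_Ici
    · exact (h₁.cont.comp (by fun_prop) fun τ hτ => neg_nonneg.2 hτ).congr
        fun τ (hτ : τ ≤ 0) => fullPath_of_nonpos hτ
    · exact (Complex.continuous_conj.comp_continuousOn h₂.cont).congr
        fun τ (hτ : 0 ≤ τ) => fullPath_of_nonneg h₁ h₂ hτ
  · obtain ⟨S₁, hS₁, hp₁⟩ := h₁.pieces
    obtain ⟨S₂, hS₂, hp₂⟩ := h₂.pieces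
    refine ⟨insert 0 ((fun τ => -τ) '' S₁ ∪ S₂), ((hS₁.image _).union hS₂).insert 0,
      fun a b hab hdis => ?_⟩
    rw [Set.disjoint_insert_right, Set.disjoint_union_right] at hdis
    obtain ⟨h0, hd₁, hd₂⟩ := hdis
    by_cases ha : 0 ≤ a
    · obtain ⟨β, hβ, he⟩ := hp₂ a b ha hab hd₂
      refine hβ.conj.contDiffOn_congr hab fun τ hτ => ?_
      rw [fullPath_of_nonneg h₁ h₂ (ha.trans hτ.1), he hτ]
    · have hb : b ≤ 0 := by
        by_contra! h
        exact h0 ⟨not_le.1 ha, h⟩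
      obtain ⟨β, hβ, he⟩ := hp₁ (-b) (-a) (by linarith) (by linarith) (by
        rw [Set.disjoint_left]
        intro τ hτ hτS
        exact Set.disjoint_left.1 hd₁ (show -τ ∈ Set.Ioo a b from
          ⟨by linarith [hτ.2], by linarith [hτ.1]⟩) ⟨τ, hτS, rfl⟩)
      refine hβ.comp_neg.contDiffOn_congr hab fun τ hτ => ?_
      rw [fullPath_of_nonpos (hτ.2.trans hb)]
      exact he ⟨by linarith [hτ.2], by linarith [hτ.1]⟩
  · intro τ
    rcases le_total τ 0 with h | h
    · rw [fullPath_of_nonpos h]; exact h₁.mem_cutPlane _ (by linarith)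
    · rw [fullPath_of_nonneg h₁ h₂ h]; exact conj_mem_cutPlane (h₂.mem_cutPlane _ h)
  · refine Tendsto.congr' (hneg.symm.fun_comp norm) ?_
    exact (tendsto_norm_ray p₁ norm_dirUp).comp tendsto_neg_atBot_atTop
  · refine Tendsto.congr' (hneg.symm.fun_comp fun w => w / (‖w‖ : ℂ)) ?_
    exact (tendsto_dir_ray p₁ norm_dirUp).comp tendsto_neg_atBot_atTop
  · refine Tendsto.congr' (hpos.symm.fun_comp norm) ?_
    exact tendsto_norm_ray _ norm_dirDown
  · refine Tendsto.congr' (hpos.symm.fun_comp fun w => w / (‖w‖ : ℂ)) ?_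
    exact tendsto_dir_ray _ norm_dirDown
  · rw [← antitoneOn_univ, ← Set.Iic_union_Ici (a := (0 : ℝ))]
    refine AntitoneOn.union_right (c := (0 : ℝ)) ?_ ?_ isGreatest_Iic isLeast_Ici
    · intro τ hτ τ' hτ' h
      have h0 : τ ≤ 0 := hτ
      have h0' : τ' ≤ 0 := hτ'
      simp only [fullPath_of_nonpos h0, fullPath_of_nonpos h0']
      exact h₁.mono (neg_nonneg.2 h0') (neg_nonneg.2 h0) (neg_le_neg h)
    · intro τ hτ τ' hτ' h
      have h0 : 0 ≤ τ := hτ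
      have h0' : 0 ≤ τ' := hτ'
      simp only [fullPath_of_nonneg h₁ h₂ h0, fullPath_of_nonneg h₁ h₂ h0',
        xiBar_conj (h₂.mem_cutPlane _ h0), xiBar_conj (h₂.mem_cutPlane _ h0'), Complex.conj_im]
      exact neg_le_neg (h₂.mono h0 h0' h)

theorem pathIntegralAbs_fullPath (σ₁ σ₂ : ℝ → ℂ) (h : ℂ → ℂ) :
    pathIntegralAbs (fullPath σ₁ σ₂) h =
      halfIntegral σ₁ h + halfIntegral σ₂ (fun w => h ((starRingEnd ℂ) w)) := by
  rw [pathIntegralAbs, ← lintegral_add_compl _ (measurableSet_Iic (a := (0 : ℝ))), Set.compl_Iic]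
  congr 1
  · rw [halfIntegral, ← setLIntegral_congr Iio_ae_eq_Iic, ← lintegral_indicator measurableSet_Iio,
      ← lintegral_indicator measurableSet_Ioi, ← lintegral_neg_eq_self]
    refine lintegral_congr fun τ => ?_
    simp only [Set.indicator, Set.mem_Iio, Set.mem_Ioi, Left.neg_neg_iff]
    split_ifs with hτ
    · have e : fullPath σ₁ σ₂ =ᶠ[𝓝 (-τ)] fun v => σ₁ (-v) := by
        filter_upwards [Iio_mem_nhds (show -τ < 0 by linarith)] with v hv using
          fullPath_of_nonpos (le_of_lt hv)
      simp only [e.deriv_eq, e.self_of_nhds, deriv_comp_neg, neg_neg, enorm_neg]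
    · rfl
  · refine setLIntegral_congr_fun measurableSet_Ioi fun τ hτ => ?_
    have e : fullPath σ₁ σ₂ =ᶠ[𝓝 τ] fun v => (starRingEnd ℂ) (σ₂ v) := by
      filter_upwards [Ioi_mem_nhds hτ] with v hv using if_neg (not_le.2 hv)
    have e2 : deriv (fun v => (starRingEnd ℂ) (σ₂ v)) τ = (starRingEnd ℂ) (deriv σ₂ τ) :=
      deriv.star
    have e3 : ‖(starRingEnd ℂ) (deriv σ₂ τ)‖ₑ = ‖deriv σ₂ τ‖ₑ := by
      rw [← ofReal_norm, ← ofReal_norm, Complex.norm_conj]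
    simp only [e.deriv_eq, e.self_of_nhds, e2, e3]

theorem HasDecay.comp_conj {h : ℂ → ℂ} {β : ℝ} (hd : HasDecay h β) :
    HasDecay (fun w => h ((starRingEnd ℂ) w)) β := by
  obtain ⟨C, hC, hb⟩ := hd
  refine ⟨C, hC, fun z hz hz2 => ?_⟩
  have := hb _ (conj_mem_cutPlane hz) (by rwa [Complex.norm_conj])
  rwa [Complex.norm_conj] at this

theorem continuousOn_comp_conj {h : ℂ → ℂ} (hc : ContinuousOn h cutPlane) :
    ContinuousOn (fun w => h ((starRingEnd ℂ) w)) cutPlane :=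
  hc.comp Complex.continuous_conj.continuousOn fun _ => conj_mem_cutPlane

theorem pathIntegralAbs_fullPath_ne_top {σ₁ σ₂ : ℝ → ℂ} (h₁ : Tame σ₁) (h₂ : Tame σ₂)
    {h : ℂ → ℂ} {β : ℝ} (hc : ContinuousOn h cutPlane) (hd : HasDecay h β) (hβ : β < -1) :
    pathIntegralAbs (fullPath σ₁ σ₂) h ≠ ⊤ := by
  rw [pathIntegralAbs_fullPath]
  exact ENNReal.add_ne_top.2 ⟨(h₁ h β hc hd).1 hβ,
    (h₂ _ β (continuousOn_comp_conj hc) hd.comp_conj).1 hβ⟩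

theorem iSup_fullPath_ne_top {σ₁ σ₂ : ℝ → ℂ} (h₁ : Tame σ₁) (h₂ : Tame σ₂)
    {h : ℂ → ℂ} {β : ℝ} (hc : ContinuousOn h cutPlane) (hd : HasDecay h β) (hβ : β ≤ 0) :
    (⨆ τ : ℝ, ‖h (fullPath σ₁ σ₂ τ)‖ₑ) ≠ ⊤ := by
  obtain ⟨C₁, hC₁⟩ := (h₁ h β hc hd).2 hβ
  obtain ⟨C₂, hC₂⟩ := (h₂ _ β (continuousOn_comp_conj hc) hd.comp_conj).2 hβ
  refine ne_top_of_le_ne_top (ENNReal.ofReal_ne_top (r := max C₁ C₂)) (iSup_le fun τ => ?_)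
  rw [← ofReal_norm]
  refine ENNReal.ofReal_le_ofReal ?_
  rcases le_or_gt τ 0 with h | h
  · rw [fullPath_of_nonpos h]
    exact (hC₁ _ (by linarith)).trans (le_max_left _ _)
  · rw [fullPath, if_neg (not_le.2 h)]
    exact (hC₂ _ h.le).trans (le_max_right _ _)

theorem conj_mem_validityRegion {z : ℂ} (hz : z ∈ validityRegion) :
    (starRingEnd ℂ) z ∈ validityRegion := by
  refine ⟨conj_mem_cutPlane hz.1, ?_⟩
  rw [xiBar_conj hz.1, Complex.conj_re, Complex.conj_im, abs_neg]
  exact hz.2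

/-- Convergence is read off from the orders at infinity: R-3/2-4n ≤ 0 for the supremum, R-5/2-4n <
-1 for the variation, -3 for Ω. -/
theorem exists_path03 {R n : ℕ} (hn : (R : ℝ) / 4 - 3 / 8 < (n : ℝ)) {z : ℂ}
    (hz : z ∈ validityRegion) : ∃ γ : ℝ → ℂ, IsPath03 γ ∧ z ∈ Set.range γ ∧
      pathL n R γ ≠ ⊤ ∧ pathOmega γ ≠ ⊤ := by
  obtain ⟨σ₁, h₁, t₁⟩ := exists_upPath hz
  obtain ⟨σ₂, h₂, t₂⟩ := exists_upPath (conj_mem_validityRegion hz)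
  refine ⟨fullPath σ₁ σ₂, isPath03_fullPath h₁ h₂, ⟨0, fullPath_zero h₁⟩, ?_, ?_⟩
  · refine ENNReal.add_ne_top.2 ⟨?_, ENNReal.div_ne_top ?_ two_ne_zero⟩
    · exact iSup_fullPath_ne_top t₁ t₂ (continuousOn_weightedG n R) (hasDecay_weightedG n R)
        (by linarith)
    · exact pathIntegralAbs_fullPath_ne_top t₁ t₂ (continuousOn_deriv_weightedG n R)
        (hasDecay_deriv_weightedG n R) (by linarith)
  · exact pathIntegralAbs_fullPath_ne_top t₁ t₂ continuousOn_omegaIntegrand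
      hasDecay_omegaIntegrand (by norm_num)

theorem eventually_re_pos {γ : ℝ → ℂ} {l : Filter ℝ} {d : ℂ} (hd : 0 < d.re)
    (h : Tendsto (fun τ => γ τ / (‖γ τ‖ : ℂ)) l (𝓝 d)) : ∀ᶠ τ in l, 0 < (γ τ).re := by
  filter_upwards [((Complex.continuous_re.tendsto d).comp h).eventually (lt_mem_nhds hd)] with τ hτ
  simp only [Function.comp_apply, Complex.div_ofReal_re] at hτ
  by_contra! hle
  exact absurd hτ (not_lt.2 (div_nonpos_of_nonpos_of_nonneg hle (norm_nonneg _)))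

theorem abs_im_xiBar_lt_of_re_eq_zero {z : ℂ} (hz : z ∈ cutPlane) (hre : z.re = 0) :
    |(xiBar z).im| < Real.pi / 4 := by
  rw [← imXi_re_im, hre]
  exact abs_imXi_zero_lt (hz.resolve_left (not_not.2 hre))

/-- Both ends of the path lie in Re z > 0. If Re γ(τ₀) ≤ 0, the path meets the imaginary axis before
and after τ₀, necessarily between ±i where |Im ξ| < π/4, and monotonicity squeezes the value at τ₀.
-/
theorem IsPath03.mem_validityRegion {γ : ℝ → ℂ} (hγ : IsPath03 γ) (τ₀ : ℝ) :
    γ τ₀ ∈ validityRegion := by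
  refine ⟨hγ.mem_cutPlane τ₀, ?_⟩
  by_contra! hcon
  obtain ⟨hre, hlev⟩ := hcon
  refine not_lt.2 hlev ?_
  have hc : Continuous fun τ => (γ τ).re := Complex.continuous_re.comp hγ.chain.1
  have hup : 0 < dirUp.re := by rw [dirUp_re]; positivity
  have hdown : 0 < dirDown.re := by rw [dirDown_re]; positivity
  obtain ⟨b, hb, hbτ⟩ := ((eventually_re_pos hdown hγ.dir_atTop).and
    (eventually_ge_atTop τ₀)).exists
  obtain ⟨a, ha, haτ⟩ := ((eventually_re_pos hup hγ.dir_atBot).and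
    (eventually_le_atBot τ₀)).exists
  obtain ⟨t, ht, ht0⟩ := intermediate_value_Icc hbτ hc.continuousOn ⟨hre, hb.le⟩
  obtain ⟨s, hs, hs0⟩ := intermediate_value_Icc' haτ hc.continuousOn ⟨hre, ha.le⟩
  have h1 := abs_lt.1 (abs_im_xiBar_lt_of_re_eq_zero (hγ.mem_cutPlane t) ht0)
  have h2 := abs_lt.1 (abs_im_xiBar_lt_of_re_eq_zero (hγ.mem_cutPlane s) hs0)
  have h3 := hγ.monotonic ht.1
  have h4 := hγ.monotonic hs.2
  exact abs_lt.2 ⟨h1.1.trans_le h3, h4.trans_lt h2.2⟩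

theorem region03_eq_validityRegion : region03 = validityRegion := by
  ext z
  constructor
  · rintro ⟨γ, hγ, τ, rfl⟩
    exact hγ.mem_validityRegion τ
  · intro hz
    obtain ⟨σ₁, h₁, -⟩ := exists_upPath hz
    obtain ⟨σ₂, h₂, -⟩ := exists_upPath (conj_mem_validityRegion hz)
    exact ⟨_, isPath03_fullPath h₁ h₂, 0, fullPath_zero h₁⟩

/-! ### Uniform bounds on the real axis -/

theorem ofReal_mem_cutPlane (x : ℝ) : (x : ℂ) ∈ cutPlane := Or.inr (by simp)

theorem im_xiBar_ofReal (x : ℝ) : (xiBar x).im = 0 := by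
  have := congrArg Complex.im (xiBar_conj (ofReal_mem_cutPlane x))
  rw [Complex.conj_ofReal, Complex.conj_im] at this
  linarith

theorem ofReal_mem_region03 (x : ℝ) : (x : ℂ) ∈ region03 := by
  rw [region03_eq_validityRegion]
  refine ⟨ofReal_mem_cutPlane x, Or.inr ?_⟩
  rw [im_xiBar_ofReal, abs_zero]
  positivity

theorem lintegral_real_translate_le (h : ℂ → ℂ) (x l : ℝ) {d : ℝ} (hd : d = 1 ∨ d = -1) :
    ∫⁻ τ in Set.Ioc 0 l, ‖h ((x : ℂ) + τ * (d : ℂ))‖ₑ ≤ ∫⁻ t : ℝ, ‖h t‖ₑ := by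
  refine (setLIntegral_le_lintegral _ _).trans (le_of_eq ?_)
  rcases hd with rfl | rfl
  · rw [← lintegral_add_left_eq_self (fun t : ℝ => ‖h t‖ₑ) x]
    refine lintegral_congr fun τ => ?_
    push_cast
    rw [mul_one]
  · rw [← lintegral_sub_left_eq_self (fun t : ℝ => ‖h t‖ₑ) x]
    refine lintegral_congr fun τ => ?_
    push_cast
    rw [mul_neg_one, sub_eq_add_neg]

/-- From each real point there is a half-path which follows the real axis to the origin and then the
ray from the origin to infinity. -/
theorem exists_upPath_ofReal (x : ℝ) : ∃ σ, UpPath (x : ℂ) σ ∧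
    (∀ h : ℂ → ℂ, halfIntegral σ h ≤
      (∫⁻ t : ℝ, ‖h t‖ₑ) + halfIntegral (fun τ : ℝ => 0 + τ * dirUp) h) ∧
    ∀ τ, 0 ≤ τ → (∃ t : ℝ, σ τ = t) ∨ ∃ t : ℝ, 0 ≤ t ∧ σ τ = 0 + t * dirUp := by
  -- The sign d points from x towards the origin, which is reached after length |x|.
  obtain ⟨d, hd, hdx⟩ : ∃ d : ℝ, (d = 1 ∨ d = -1) ∧ x + |x| * d = 0 := by
    rcases le_total 0 x with h | h
    · exact ⟨-1, Or.inr rfl, by rw [abs_of_nonneg h]; ring⟩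
    · exact ⟨1, Or.inl rfl, by rw [abs_of_nonpos h]; ring⟩
  have hd0 : (d : ℂ) ≠ 0 := by rcases hd with rfl | rfl <;> norm_num
  have hreal : ∀ τ : ℝ, (x : ℂ) + τ * (d : ℂ) = ((x + τ * d : ℝ) : ℂ) := fun τ => by push_cast; rfl
  have hray : UpPath 0 fun τ : ℝ => 0 + τ * dirUp :=
    upPath_ray (Or.inr (by simp)) le_rfl le_rfl
  have hj : (x : ℂ) + ((|x| : ℝ) : ℂ) * (d : ℂ) = 0 := by
    rw [hreal, hdx, Complex.ofReal_zero]
  have hp := hray.prepend (abs_nonneg x) (isRegularArc_ray (x : ℂ) hd0) hj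
    (fun τ _ => by rw [hreal]; exact ofReal_mem_cutPlane _)
    (fun τ _ τ' _ _ => by simp only [hreal, im_xiBar_ofReal, le_refl])
  have hj' : (x : ℂ) + ((|x| : ℝ) : ℂ) * (d : ℂ) = 0 + ((0 : ℝ) : ℂ) * dirUp := by
    rw [hj]; simp
  have hs : (x : ℂ) + ((0 : ℝ) : ℂ) * (d : ℂ) = x := by simp
  rw [hs] at hp
  refine ⟨_, hp, fun h => ?_, fun τ hτ => ?_⟩
  · rw [halfIntegral_prependArc (abs_nonneg x) hj']
    refine add_le_add_left ?_ _
    refine le_trans (le_of_eq ?_) (lintegral_real_translate_le h x |x| hd)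
    refine lintegral_congr fun τ => ?_
    rw [(hasDerivAt_ray (x : ℂ) d τ).deriv, ← ofReal_norm (d : ℂ), Complex.norm_real]
    rcases hd with rfl | rfl <;> simp
  · rcases le_total τ |x| with h | h
    · left
      exact ⟨_, (prependArc_of_le h).trans (hreal τ)⟩
    · right
      exact ⟨τ - |x|, by linarith, prependArc_of_ge hj' h⟩

/-- The real segment contributes at most the integral over all of ℝ, and the ray starts at 0 for
every x, so the bound does not depend on x. -/
theorem exists_uniform_pathIntegralAbs {h : ℂ → ℂ} {β : ℝ} (hc : ContinuousOn h cutPlane)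
    (hd : HasDecay h β) (hβ : β < -1) : ∃ M : ℝ≥0∞, M ≠ ⊤ ∧ ∀ σ : ℝ → ℂ,
      (∀ g : ℂ → ℂ, halfIntegral σ g ≤
        (∫⁻ t : ℝ, ‖g t‖ₑ) + halfIntegral (fun τ : ℝ => 0 + τ * dirUp) g) →
      pathIntegralAbs (fullPath σ σ) h ≤ M := by
  have key : ∀ g : ℂ → ℂ, ContinuousOn g cutPlane → HasDecay g β →
      (∫⁻ t : ℝ, ‖g t‖ₑ) + halfIntegral (fun τ : ℝ => 0 + τ * dirUp) g ≠ ⊤ := by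
    intro g hc hd
    have h1 := lintegral_ray_ne_top hβ hc hd 0 (d := 1) norm_one isClosed_univ
      fun τ _ => by simpa using ofReal_mem_cutPlane τ
    have h2 := (tame_ray (z := 0) (Or.inr (by simp)) le_rfl g β hc hd).1 hβ
    simp only [zero_add, mul_one, Measure.restrict_univ] at h1
    exact ENNReal.add_ne_top.2 ⟨h1, h2⟩
  refine ⟨_, ENNReal.add_ne_top.2 ⟨key h hc hd, key _ (continuousOn_comp_conj hc) hd.comp_conj⟩,
    fun σ hσ => ?_⟩
  rw [pathIntegralAbs_fullPath]
  exact add_le_add (hσ _) (hσ _)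

theorem exists_bound_ofReal {h : ℂ → ℂ} {β : ℝ} (hc : ContinuousOn h cutPlane)
    (hd : HasDecay h β) (hβ : β ≤ 0) : ∃ C : ℝ, ∀ t : ℝ, ‖h t‖ ≤ C := by
  obtain ⟨C, hC⟩ := bounded_ray hβ hc hd 0 (d := 1) norm_one isClosed_univ
    fun τ _ => by simpa using ofReal_mem_cutPlane τ
  exact ⟨C, fun t => by simpa using hC t trivial⟩

theorem exists_uniform_iSup {h : ℂ → ℂ} {β : ℝ} (hc : ContinuousOn h cutPlane)
    (hd : HasDecay h β) (hβ : β ≤ 0) : ∃ M : ℝ≥0∞, M ≠ ⊤ ∧ ∀ σ : ℝ → ℂ,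
      (∀ τ, 0 ≤ τ → (∃ t : ℝ, σ τ = t) ∨ ∃ t : ℝ, 0 ≤ t ∧ σ τ = 0 + t * dirUp) →
      (⨆ τ : ℝ, ‖h (fullPath σ σ τ)‖ₑ) ≤ M := by
  have key : ∀ g : ℂ → ℂ, ContinuousOn g cutPlane → HasDecay g β →
      ∃ C : ℝ, ∀ w : ℂ, ((∃ t : ℝ, w = t) ∨ ∃ t : ℝ, 0 ≤ t ∧ w = 0 + t * dirUp) → ‖g w‖ ≤ C := by
    intro g hc hd
    obtain ⟨C₁, h1⟩ := exists_bound_ofReal hc hd hβ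
    obtain ⟨C₂, h2⟩ := (tame_ray (z := 0) (Or.inr (by simp)) le_rfl g β hc hd).2 hβ
    refine ⟨max C₁ C₂, ?_⟩
    rintro w (⟨t, rfl⟩ | ⟨t, ht, rfl⟩)
    · exact (h1 t).trans (le_max_left _ _)
    · exact (h2 t ht).trans (le_max_right _ _)
  obtain ⟨C, hC⟩ := key h hc hd
  obtain ⟨D, hD⟩ := key _ (continuousOn_comp_conj hc) hd.comp_conj
  refine ⟨ENNReal.ofReal (max C D), ENNReal.ofReal_ne_top, fun σ hσ => iSup_le fun τ => ?_⟩
  rw [← ofReal_norm]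
  refine ENNReal.ofReal_le_ofReal ?_
  rcases le_or_gt τ 0 with h | h
  · rw [fullPath_of_nonpos h]
    exact (hC _ (hσ _ (by linarith))).trans (le_max_left _ _)
  · rw [fullPath, if_neg (not_le.2 h)]
    exact (hD _ (hσ _ h.le)).trans (le_max_right _ _)

/-- The path integrals are uniformly bounded on suitable paths through the real points. -/
theorem exists_uniform_path03 {R n : ℕ} (hn : (R : ℝ) / 4 - 3 / 8 < (n : ℝ)) :
    ∃ A B : ℝ≥0∞, A ≠ ⊤ ∧ B ≠ ⊤ ∧ ∀ x : ℝ, ∃ γ : ℝ → ℂ, IsPath03 γ ∧ (x : ℂ) ∈ Set.range γ ∧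
      pathL n R γ ≤ A ∧ pathOmega γ ≤ B := by
  obtain ⟨M₁, hM₁, h1⟩ := exists_uniform_iSup (continuousOn_weightedG n R)
    (hasDecay_weightedG n R) (by linarith)
  obtain ⟨M₂, hM₂, h2⟩ := exists_uniform_pathIntegralAbs (continuousOn_deriv_weightedG n R)
    (hasDecay_deriv_weightedG n R) (by linarith)
  obtain ⟨M₃, hM₃, h3⟩ := exists_uniform_pathIntegralAbs continuousOn_omegaIntegrand
    hasDecay_omegaIntegrand (by norm_num)
  refine ⟨M₁ + M₂ / 2, M₃, ENNReal.add_ne_top.2 ⟨hM₁, ENNReal.div_ne_top hM₂ two_ne_zero⟩, hM₃,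
    fun x => ?_⟩
  obtain ⟨σ, hσ, hi, hs⟩ := exists_upPath_ofReal x
  have hσ' : UpPath ((starRingEnd ℂ) (x : ℂ)) σ := by rwa [Complex.conj_ofReal]
  exact ⟨fullPath σ σ, isPath03_fullPath hσ hσ', ⟨0, fullPath_zero hσ⟩,
    add_le_add (h1 σ hs) (ENNReal.div_le_div_right (h2 σ hi) _), h3 σ hi⟩

theorem toReal_pathVar_le {n R : ℕ} {γ : ℝ → ℂ} (hL : pathL n R γ ≠ ⊤) :
    (pathVar n R γ).toReal ≤ 2 * (pathL n R γ).toReal := by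
  have h := ENNReal.toReal_mono hL (le_add_self : pathVar n R γ / 2 ≤ pathL n R γ)
  rw [ENNReal.toReal_div, ENNReal.toReal_ofNat] at h
  linarith

/-- On the real axis |x²+1|^{1/4} ≥ 1, V ≤ 2L, and Ω ≤ 4u makes the factor {1-Ω/(8u)}^{-1} at most
2. -/
theorem errorBound_ofReal_le {n R : ℕ} {u x g A B : ℝ} {γ : ℝ → ℂ} (hu : 1 ≤ u) (huB : B ≤ 4 * u)
    (hB : 0 ≤ B) (hL : pathL n R γ ≠ ⊤) (hLA : (pathL n R γ).toReal ≤ A)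
    (hΩB : (pathOmega γ).toReal ≤ B) (hg : ‖coeffG R n (x : ℂ)‖ ≤ g) :
    errorBound n R u γ x ≤ (g + A + A * B) / u ^ (2 * n + 2) := by
  have hV := toReal_pathVar_le hL
  have hL0 : 0 ≤ (pathL n R γ).toReal := ENNReal.toReal_nonneg
  have hV0 : 0 ≤ (pathVar n R γ).toReal := ENNReal.toReal_nonneg
  have hΩ0 : 0 ≤ (pathOmega γ).toReal := ENNReal.toReal_nonneg
  have hu0 : 0 < u := by linarith
  have hq : 1 ≤ ‖(x : ℂ) ^ 2 + 1‖ ^ (1 / 4 : ℝ) := by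
    refine Real.one_le_rpow ?_ (by norm_num)
    rw [show (x : ℂ) ^ 2 + 1 = ((x ^ 2 + 1 : ℝ) : ℂ) by push_cast; rfl,
      Complex.norm_of_nonneg (by positivity)]
    nlinarith
  have hP : 0 < u ^ (2 * n + 2) := by positivity
  have hpow : u ^ (2 * n + 3) = u ^ (2 * n + 2) * u := pow_succ _ _
  have hfac : (1 - 1 / (8 * u) * (pathOmega γ).toReal)⁻¹ ≤ 2 := by
    rw [inv_le_comm₀ ?_ two_pos]
    · rw [one_div_mul_eq_div, le_sub_comm, div_le_iff₀ (by positivity)]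
      linarith
    · rw [one_div_mul_eq_div, sub_pos, div_lt_one (by positivity)]
      linarith
  have hfac0 : 0 ≤ (1 - 1 / (8 * u) * (pathOmega γ).toReal)⁻¹ := by
    rw [inv_nonneg, one_div_mul_eq_div, sub_nonneg, div_le_one (by positivity)]
    linarith
  have t1 : 1 / u ^ (2 * n + 2) * (‖coeffG R n (x : ℂ)‖ +
      1 / (2 * ‖(x : ℂ) ^ 2 + 1‖ ^ (1 / 4 : ℝ)) * (pathVar n R γ).toReal) ≤
      1 / u ^ (2 * n + 2) * (g + A) := by
    have : 1 / (2 * ‖(x : ℂ) ^ 2 + 1‖ ^ (1 / 4 : ℝ)) ≤ 1 / 2 :=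
      one_div_le_one_div_of_le two_pos (by linarith)
    have := mul_le_mul_of_nonneg_right this hV0
    gcongr
    linarith
  have t2 : (pathL n R γ).toReal / (8 * u ^ (2 * n + 3) * ‖(x : ℂ) ^ 2 + 1‖ ^ (1 / 4 : ℝ)) *
      (1 - 1 / (8 * u) * (pathOmega γ).toReal)⁻¹ * (pathOmega γ).toReal ≤
      A / (8 * u ^ (2 * n + 2)) * 2 * B := by
    have hden : 8 * u ^ (2 * n + 2) ≤
        8 * u ^ (2 * n + 3) * ‖(x : ℂ) ^ 2 + 1‖ ^ (1 / 4 : ℝ) := by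
      rw [hpow]
      have : 1 ≤ u * ‖(x : ℂ) ^ 2 + 1‖ ^ (1 / 4 : ℝ) := one_le_mul_of_one_le_of_one_le hu hq
      nlinarith
    have hA : 0 ≤ A := hL0.trans hLA
    have : (pathL n R γ).toReal / (8 * u ^ (2 * n + 3) * ‖(x : ℂ) ^ 2 + 1‖ ^ (1 / 4 : ℝ)) ≤
        A / (8 * u ^ (2 * n + 2)) := div_le_div₀ hA hLA (by positivity) hden
    exact mul_le_mul (mul_le_mul this hfac hfac0 (by positivity)) hΩB hΩ0 (by positivity)
  have hAB : 0 ≤ A * B := mul_nonneg (hL0.trans hLA) hB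
  calc errorBound n R u γ x ≤ 1 / u ^ (2 * n + 2) * (g + A) + A / (8 * u ^ (2 * n + 2)) * 2 * B :=
        add_le_add t1 t2
    _ = (g + A + A * B / 4) / u ^ (2 * n + 2) := by field_simp; ring
    _ ≤ _ := by gcongr; linarith

/-! ### The error bounds for the expansion -/

theorem norm_expansionError_le {R n : ℕ} (hn : (R : ℝ) / 4 - 3 / 8 < (n : ℝ)) {u : ℝ}
    (hu : 0 < u) {γ : ℝ → ℂ} (hγ : IsPath03 γ) (hL : pathL n R γ ≠ ⊤)
    (hΩ : pathOmega γ < ENNReal.ofReal (8 * u)) {z : ℂ} (hz : z ∈ Set.range γ) :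
    ‖expansionError n R u z‖ ≤ errorBound n R u γ z := by
  have hsq : (3 / 5 : ℝ) < Real.sqrt 2 / 2 := by
    rw [lt_div_iff₀ two_pos]
    exact Real.lt_sqrt_of_sq_lt (by norm_num)
  refine norm_le_errorBound hu (c := (-1) ^ (n + 1) / (u : ℂ) ^ (2 * n)) ?_ hγ
    (fun z hz => hasDerivAt_expansionError n R u (sq_add_one_ne_zero hz))
    (fun z hz => hasDerivAt_expansionErrorDeriv n R hu (sq_add_one_ne_zero hz)) ?_ hL hΩ hz
  · rw [norm_div, norm_pow, norm_pow, norm_neg, norm_one, one_pow, Complex.norm_of_nonneg hu.le]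
  · rintro l (rfl | rfl)
    · exact (expansionError_limits hn hu hγ.norm_atBot (d := dirUp) (by rwa [dirUp_re])
        hγ.dir_atBot).2
    · exact (expansionError_limits hn hu hγ.norm_atTop (d := dirDown) (by rwa [dirDown_re])
        hγ.dir_atTop).2

theorem exists_norm_expansionError_ofReal_le {R n : ℕ} (hn : (R : ℝ) / 4 - 3 / 8 < (n : ℝ)) :
    ∃ C u₀ : ℝ, 0 < u₀ ∧ ∀ u : ℝ, u₀ ≤ u → ∀ x : ℝ,
      ‖expansionError n R u (x : ℂ)‖ ≤ C / u ^ (2 * n + 2) := by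
  obtain ⟨A, B, hA, hB, h⟩ := exists_uniform_path03 hn
  obtain ⟨D, hD, hdec⟩ := norm_coeffG_le R n
  obtain ⟨g, hg⟩ := exists_bound_ofReal (continuousOn_coeffG R n)
    ⟨D, hD, fun z _ hz => hdec z hz⟩ (by linarith)
  -- The threshold 1+B ensures u ≥ 1, B ≤ 4u and Ω < 8u at once.
  refine ⟨g + A.toReal + A.toReal * B.toReal, 1 + B.toReal, by positivity, fun u hu x => ?_⟩
  obtain ⟨γ, hγ, hx, hL, hΩ⟩ := h x
  have hB0 : 0 ≤ B.toReal := ENNReal.toReal_nonneg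
  have hL' : pathL n R γ ≠ ⊤ := ne_top_of_le_ne_top hA hL
  have hΩ' : pathOmega γ < ENNReal.ofReal (8 * u) := by
    refine hΩ.trans_lt ?_
    rw [← ENNReal.ofReal_toReal hB]
    exact (ENNReal.ofReal_lt_ofReal_iff (by linarith)).2 (by linarith)
  refine (norm_expansionError_le hn (by linarith) hγ hL' hΩ' hx).trans ?_
  exact errorBound_ofReal_le (by linarith) (by linarith) hB0 hL' (ENNReal.toReal_mono hA hL)
    (ENNReal.toReal_mono hB hΩ) (hg x)

theorem tendsto_expansionError_ofReal {R n : ℕ} (hn : (R : ℝ) / 4 - 3 / 8 < (n : ℝ)) {u : ℝ}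
    (hu : 0 < u) : Tendsto (fun x : ℝ => expansionError n R u (x : ℂ)) atTop (𝓝 0) := by
  refine (expansionError_limits hn hu (γ := fun x : ℝ => (x : ℂ)) (d := 1) ?_ (by norm_num) ?_).1
  · simpa using tendsto_norm_ray 0 norm_one
  · simpa using tendsto_dir_ray 0 norm_one

end Weber

theorem mainTheorem12 (R n : ℕ) (hn : (R : ℝ) / 4 - 3 / 8 < (n : ℝ)) :
    -- the function is an (entire) solution of the inhomogeneous equation
    (∀ a : ℝ, 0 < a →
      Differentiable ℂ (Weber.weberParticular03 R (-a)) ∧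
      ∀ z : ℂ, deriv (deriv (Weber.weberParticular03 R (-a))) z
        + (z ^ 2 / 4 + (a : ℂ)) * Weber.weberParticular03 R (-a) z = z ^ R) ∧
    -- the region of validity, which contains the real axis
    Weber.region03 =
      {z : ℂ | z ∈ Weber.cutPlane ∧ (0 < z.re ∨ |(Weber.xiBar z).im| < Real.pi / 4)} ∧
    (∀ x : ℝ, (x : ℂ) ∈ Weber.region03) ∧
    -- through each point of the region there is a path on which all integrals converge
    (∀ z ∈ Weber.region03, ∃ γ : ℝ → ℂ, Weber.IsPath03 γ ∧ z ∈ Set.range γ ∧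
      Weber.pathL n R γ ≠ ⊤ ∧ Weber.pathOmega γ ≠ ⊤) ∧
    -- the expansion with its error term
    ∃ ε : ℝ → ℂ → ℂ,
      (∀ u : ℝ, 0 < u → ∀ z ∈ Weber.region03,
        Weber.weberParticular03 R (-(u / 2)) ((Real.sqrt (2 * u) : ℂ) * z) =
          (((2 * u) ^ ((R : ℝ) / 2 + 1) : ℝ) : ℂ) *
            (1 / (u : ℂ) ^ 2 *
                ∑ s ∈ Finset.range n,
                  (-1) ^ (s + 1) * Weber.coeffG R s z / (u : ℂ) ^ (2 * s)
              + ε u z)) ∧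
      -- the explicit error bound
      (∀ u : ℝ, 0 < u → ∀ γ : ℝ → ℂ, Weber.IsPath03 γ →
        Weber.pathL n R γ ≠ ⊤ → Weber.pathOmega γ < ENNReal.ofReal (8 * u) →
        ∀ z ∈ Set.range γ, ‖ε u z‖ ≤ Weber.errorBound n R u γ z) ∧
      -- on the real axis the error is uniformly of order `u^(-2n-2)`
      (∃ C u₀ : ℝ, 0 < u₀ ∧ ∀ u : ℝ, u₀ ≤ u → ∀ x : ℝ,
        ‖ε u (x : ℂ)‖ ≤ C / u ^ (2 * n + 2)) ∧
      -- and it vanishes at `+∞`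
      (∀ u : ℝ, 0 < u →
        Filter.Tendsto (fun x : ℝ => ε u (x : ℂ)) Filter.atTop (nhds 0)) := by
  refine ⟨fun a _ => ⟨Weber.differentiable_weberParticular03 R (-a), fun z => ?_⟩,
    Weber.region03_eq_validityRegion, Weber.ofReal_mem_region03, fun z hz => ?_,
    Weber.expansionError n R, fun u hu z _ => ?_, fun u hu γ hγ hL hΩ z hz =>
      Weber.norm_expansionError_le hn hu hγ hL hΩ hz,
    Weber.exists_norm_expansionError_ofReal_le hn, fun u hu =>
      Weber.tendsto_expansionError_ofReal hn hu⟩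
  · rw [Weber.deriv_deriv_weberParticular03]
    push_cast
    ring
  · rw [Weber.region03_eq_validityRegion] at hz
    exact Weber.exists_path03 hn hz
  · have hne : (((2 * u) ^ ((R : ℝ) / 2 + 1) : ℝ) : ℂ) ≠ 0 :=
      Complex.ofReal_ne_zero.2 (Real.rpow_pos_of_pos (by positivity) _).ne'
    rw [Weber.expansionError, add_sub_cancel, mul_div_cancel₀ _ hne]
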